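/- Let $1\le r<d$ and $n_1,\dots,n_r\ge d+1$; write $[r]=\{1,\dots,r\}$ and $n_S=\sum_{i\in S}n_i$. **Polytopes.** For $1\le i\le r$ let $\gamma_i(t;\zeta)\in\mathbb R^d$ be the point whose $i$-th coordinate is $t$, whose $j$-th coordinate is $\zeta t^{d-r+1+j}$ for $1\le j\le r$, $j\ne i$, and whose last $d-r$ coordinates are $t^2,\dots,t^{d-r+1}$. Choose reals $0<x_{i,1}<\dots<x_{i,n_i}$ with $x_{i,n_i}<x_{i+1,1}$ and integers $\beta_1>\dots>\beta_r\ge0$. For $\tau>0$, $\zeta\ge 0$ let $P_i=P_i(\tau,\zeta)=\mathrm{conv}\{\gamma_i(x_{i,j}\tau^{\beta_i};\zeta):1\le j\le n_i\}$ and $\hat P_i=P_i(\tau,0)$. **Faces.** Let $V_i$ be the vertex set of $P_i$ and $e_0=0,e_1,\dots,e_{r-1}$ the standard affine basis of $\mathbb R^{r-1}$. For $\emptyset\ne R\subseteq[r]$ the Cayley polytope $\mathcal C_R$ is the convex hull of $\bigcup_{i\in R}\{e_{i-1}\}\times V_i$ in $\mathbb R^{r-1}\times\mathbb R^d$, and $\mathcal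 F_R$ is the set of its faces, other than $\mathcal C_R$, having a vertex in $\{e_{i-1}\}\times V_i$ for every $i\in R$; $\hat{\mathcal F}_R$ is the same set for the $\hat P_i$. As usual $f_k$ counts $k$-dimensional faces. $\mathcal C_{R}$ is Minkowski-neighborly if for all $\emptyset\ne S\subseteq R$ every set of $\ell$ points of $\bigcup_{i\in S}\{e_{i-1}\}\times V_i$, $|S|\le\ell\le\lfloor (d+|S|-1)/2\rfloor$, that meets every $\{e_{i-1}\}\times V_i$, $i\in S$, is the vertex set of a face of $\mathcal C_S$. **Bounds.** Binomial coefficients $\binom{a}{k}$ are polynomials in $a$ (which may be negative) and vanish for $k<0$. For $\emptyset\neq R\subseteq[r]$ put $D=d+|R|-1$ and define integers $h_k(R)$, recursively in $|R|$, by $h_k(R)=\sum_{\emptyset\ne S\subseteq R}(-1)^{|R|-|S|}\binom{n_S-d-|R|+k}{k}$ for $0\le k\le\lfloor D/2\rfloor$, $h_k(R)=h_{D-k}(R)+\sum_{\emptyset\ne S\subsetneq R}g^{(|R|-|S|)}_{D-k}(S)$ for $\lfloor D/2\rfloor<k\le D$, and $h_k(R)=0$ for all other $k$, where $g^{(m)}_k(S)=\sum_{j=0}^m(-1)^j\binom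 mj h_{k-j}(S)$. Let $$c_{\delta,k}(n)=\sideset{}{^*}\sum_{i=0}^{\lfloor\delta/2\rfloor}\Bigl(\tbinom{\delta-i}{k-i}+\tbinom{i}{k-\delta+i}\Bigr)\tbinom{n-\delta-1+i}{i},$$ the star meaning that the last term is halved if $\delta$ is even (for $n>\delta$ this is the number of $(k-1)$-faces of the cyclic $\delta$-polytope with $n$ vertices), and $$\Phi_k(\mathbf n_R)=\sum_{\emptyset\ne S\subseteq R}(-1)^{|R|-|S|}c_{D,k}(n_S)+\sum_{i=0}^{\lfloor (D-1)/2\rfloor}\tbinom{i}{k-D+i}\sum_{\emptyset\ne S\subsetneq R}g_i^{(|R|-|S|)}(S).$$ (For $0\le k\le \lfloor D/2\rfloor$ this equals $\sum_{\emptyset\ne S\subseteq R}(-1)^{|R|-|S|}\binom{n_S}{k}$.) **Claim.** There is $\tau_0>0$ such that for every $\tau\in(0,\tau_0)$: (a) $f_{k-1}(\hat{\mathcal F}_R)=\Phi_k(\mathbf n_R)$ for all $\emptyset\ne R\subseteq[r]$ and $|R|\le k\le\lfloor(d-r+2|R|-1)/2\rfloor$ (for $R=[r]$ the upper limit is $\lfloor(d+r-1)/2\rfloor$);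 (b) there is $\zeta_0>0$ such that for every $\zeta\in(0,\zeta_0)$: each $P_i$ is a $d$-polytope whose vertices are exactly the $n_i$ chosen points; $f_{k-1}(\mathcal F_R)=\Phi_k(\mathbf n_R)$ for all $\emptyset\ne R\subseteq[r]$ and all $|R|\le k\le\lfloor(d+|R|-1)/2\rfloor$; the Cayley polytope $\mathcal C_{[r]}$ is Minkowski-neighborly; and the upper bounds for Minkowski sums are attained: $f_{k-1}(P_1+\dots+P_r)=\Phi_{k+r-1}(\mathbf n_{[r]})$ for all $1\le k\le d$. -/

import Mathlib

namespace CayleyTight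

open scoped Pointwise

/-! ### Faces of polytopes -/

section Faces

variable {E : Type*} [AddCommGroup E] [Module ℝ E] [TopologicalSpace E]

/-- The non-empty faces of a polytope `P`: the intersections of `P` with its supporting
hyperplanes, and `P` itself (zero functional). -/
def IsFace (P F : Set E) : Prop :=
  F.Nonempty ∧ IsExposed ℝ P F

/-- The dimension of a (non-empty) convex set: the dimension of its affine span. -/
noncomputable def dim (F : Set E) : ℕ :=
  Module.finrank ℝ (vectorSpan ℝ F)

/-- The vertex set of a polytope. -/
def vertices (P : Set E) : Set E :=
  P.extremePoints ℝ

/-- `numFaces P k = f_k(P)` is the number of `k`-dimensional faces of `P`. -/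
noncomputable def numFaces (P : Set E) (k : ℕ) : ℕ :=
  {F : Set E | IsFace P F ∧ dim F = k}.ncard

end Faces

/-! ### Cayley polytopes, mixed faces, neighborliness -/

/-- The standard affine basis `e_0 = 0, e_1, …, e_{r-1}` of `ℝ^{r-1}`. -/
def affBasis (r : ℕ) (i : Fin r) : Fin (r - 1) → ℝ :=
  fun j => if (i : ℕ) = (j : ℕ) + 1 then 1 else 0

/-- The affine inclusion `μ_i(x) = (e_i, x)` of `ℝ^d` into `ℝ^{r-1} × ℝ^d`. -/
def cayleyIncl {r d : ℕ} (i : Fin r) (x : Fin d → ℝ) : (Fin (r - 1) → ℝ) × (Fin d → ℝ) :=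
  (affBasis r i, x)

/-- The set `μ_i(V_i)`, `V_i` the vertex set of `P_i`. -/
def cayleyVertices {r d : ℕ} (P : Fin r → Set (Fin d → ℝ)) (i : Fin r) :
    Set ((Fin (r - 1) → ℝ) × (Fin d → ℝ)) :=
  cayleyIncl i '' vertices (P i)

/-- The Cayley polytope `C_R` of the polytopes `P_i`, `i ∈ R`. It is placed in the common space
`ℝ^{r-1} × ℝ^d`, using the affinely independent points `e_i`, `i ∈ R`. -/
def cayleyPolytope {r d : ℕ} (P : Fin r → Set (Fin d → ℝ)) (R : Finset (Fin r)) :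
    Set ((Fin (r - 1) → ℝ) × (Fin d → ℝ)) :=
  convexHull ℝ (⋃ i ∈ R, cayleyVertices P i)

/-- The set `F_R` of mixed faces of `C_R`: the faces, other than `C_R` itself, that contain at
least one vertex from each `V_i`, `i ∈ R`. -/
def mixedFaces {r d : ℕ} (P : Fin r → Set (Fin d → ℝ)) (R : Finset (Fin r)) :
    Set (Set ((Fin (r - 1) → ℝ) × (Fin d → ℝ))) :=
  {F | IsFace (cayleyPolytope P R) F ∧ F ≠ cayleyPolytope P R ∧
    ∀ i ∈ R, (F ∩ cayleyVertices P i).Nonempty}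

/-- `numMixedFaces P R k = f_k(F_R)` is the number of `k`-dimensional mixed faces of `C_R`. -/
noncomputable def numMixedFaces {r d : ℕ} (P : Fin r → Set (Fin d → ℝ)) (R : Finset (Fin r))
    (k : ℕ) : ℕ :=
  {F ∈ mixedFaces P R | dim F = k}.ncard

/-- `C_R` is `R`-neighborly: every spanning subset `A` of `⋃_{i ∈ R} V_i` of size
`|R| ≤ ℓ ≤ ⌊(d + |R| - 1) / 2⌋` is (the vertex set of) a face of `C_R`. -/
def IsNeighborly {r d : ℕ} (P : Fin r → Set (Fin d → ℝ)) (R : Finset (Fin r)) : Prop :=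
  ∀ A : Set ((Fin (r - 1) → ℝ) × (Fin d → ℝ)),
    A ⊆ (⋃ i ∈ R, cayleyVertices P i) →
    (∀ i ∈ R, (A ∩ cayleyVertices P i).Nonempty) →
    R.card ≤ A.ncard → A.ncard ≤ (d + R.card - 1) / 2 →
    IsFace (cayleyPolytope P R) (convexHull ℝ A) ∧ vertices (convexHull ℝ A) = A

/-- `C_R` is Minkowski-neighborly: `C_S` is `S`-neighborly for all `∅ ≠ S ⊆ R`. -/
def IsMinkowskiNeighborly {r d : ℕ} (P : Fin r → Set (Fin d → ℝ)) (R : Finset (Fin r)) : Prop :=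
  ∀ S ⊆ R, S.Nonempty → IsNeighborly P S

/-- The Minkowski sum `P_1 + ⋯ + P_r`. -/
def minkowskiSum {r d : ℕ} (P : Fin r → Set (Fin d → ℝ)) : Set (Fin d → ℝ) :=
  ∑ i, P i

/-! ### The bounds -/

/-- The binomial coefficient `n` over `k` for an integer `k`, zero for `k < 0`. -/
def binom (n : ℕ) (k : ℤ) : ℤ :=
  if 0 ≤ k then (n.choose k.toNat : ℤ) else 0

section Bounds

variable {r : ℕ}

/-- The sum over `∅ ≠ S ⊆ R` of `(-1)^{|R|-|S|} binom(n_S - d - |R| + k, k)`, where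
`n_S = ∑_{i ∈ S} n_i` and the binomial coefficient is a polynomial in its upper index (which can
be negative). -/
noncomputable def hLower (d : ℕ) (n : Fin r → ℕ) (R : Finset (Fin r)) (k : ℕ) : ℤ :=
  ∑ S ∈ R.powerset with S.Nonempty, (-1) ^ (R.card - S.card) *
    Ring.choose ((∑ i ∈ S, (n i : ℤ)) - d - R.card + k) k

/-- The bound for `h_k(F_R)`. For `k ≤ ⌊D/2⌋`, `D = d + |R| - 1`, it is `hLower`; for
`⌊D/2⌋ < k ≤ D` it is, recursively, the sum over `∅ ≠ S ⊆ R` of the `(|R|-|S|)`-th backward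
differences, at index `D - k`, of the bounds for `S`. It is zero for other `k`. -/
noncomputable def hBound (d : ℕ) (n : Fin r → ℕ) (R : Finset (Fin r)) (k : ℤ) : ℤ :=
  if k < 0 ∨ (d : ℤ) + R.card - 1 < k then 0
  else if 2 * k ≤ (d : ℤ) + R.card - 1 then hLower d n R k.toNat
  else hLower d n R ((d : ℤ) + R.card - 1 - k).toNat +
    ∑ S ∈ R.ssubsets.attach, if S.1.Nonempty then
      ∑ j ∈ Finset.range (R.card - S.1.card + 1), (-1) ^ j *
        ((R.card - S.1.card).choose j : ℤ) *
          hBound d n S.1 ((d : ℤ) + R.card - 1 - k - j)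
      else 0
termination_by R.card
decreasing_by exact Finset.card_lt_card (Finset.mem_ssubsets.mp S.2)

/-- The `m`-th backward difference of the bound for the `h`-vector of `F_R`. -/
noncomputable def gBound (d : ℕ) (n : Fin r → ℕ) (m : ℕ) (R : Finset (Fin r)) (k : ℤ) : ℤ :=
  ∑ j ∈ Finset.range (m + 1), (-1) ^ j * (m.choose j : ℤ) * hBound d n R (k - j)

/-- The number `f_{k-1}(C_δ(n))` of `(k-1)`-faces of the cyclic `δ`-polytope with `n` vertices,
by the closed formula `∑*_{0 ≤ i ≤ δ/2} (binom(δ-i, k-i) + binom(i, k-δ+i)) binom(n-δ-1+i, i)`,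
where the last term is halved if `δ` is even (the two summands in that term are equal). The
formula is used as a polynomial in `n`, also for `n ≤ δ`. -/
noncomputable def cyclicFaces (δ : ℕ) (n : ℤ) (k : ℤ) : ℤ :=
  ∑ i ∈ Finset.range (δ / 2 + 1),
    (if 2 * i = δ then binom (δ - i) (k - i)
      else binom (δ - i) (k - i) + binom i (k - δ + i)) * Ring.choose (n - δ - 1 + i) i

/-- The bound for `f_{k-1}(F_R)`, in terms of the numbers `n_i`, `i ∈ R`, of vertices. -/
noncomputable def faceBound (d : ℕ) (n : Fin r → ℕ) (R : Finset (Fin r)) (k : ℕ) : ℤ :=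
  (∑ S ∈ R.powerset with S.Nonempty, (-1) ^ (R.card - S.card) *
    cyclicFaces (d + R.card - 1) (∑ i ∈ S, (n i : ℤ)) k) +
  ∑ i ∈ Finset.range ((d + R.card - 2) / 2 + 1),
    binom i ((k : ℤ) - d - R.card + 1 + i) *
      ∑ S ∈ R.ssubsets with S.Nonempty, gBound d n (R.card - S.card) S i

end Bounds

/-! ### The construction -/

/-- The moment-like curve `γ_i(t; ζ)` in `ℝ^d`. With coordinates and `i` numbered from `1`, its
`i`-th coordinate is `t`, its `j`-th coordinate is `ζ t^{d-r+1+j}` for `j ≤ r`, `j ≠ i`, and its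
last `d - r` coordinates are `t^2, …, t^{d-r+1}`. (Below, indices start at `0`.) -/
noncomputable def curve (d r : ℕ) (i : Fin r) (ζ t : ℝ) : Fin d → ℝ :=
  fun c =>
    if (c : ℕ) = (i : ℕ) then t
    else if (c : ℕ) < r then ζ * t ^ (d - r + 2 + (c : ℕ))
    else t ^ ((c : ℕ) - r + 2)

/-- The parameters of the construction: reals `0 < x_{i,1} < ⋯ < x_{i,n_i}` with
`x_{i,n_i} < x_{i+1,1}`, and integers `β_1 > ⋯ > β_r ≥ 0`. -/
structure Params (r : ℕ) (n : Fin r → ℕ) where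
  x : (i : Fin r) → Fin (n i) → ℝ
  β : Fin r → ℕ
  x_pos : ∀ i j, 0 < x i j
  x_strictMono : ∀ i, StrictMono (x i)
  x_lt : ∀ i i', i < i' → ∀ j j', x i j < x i' j'
  β_strictAnti : StrictAnti β

/-- The point `γ_i(y_{i,j}; ζ)`, `y_{i,j} = x_{i,j} τ^{β_i}`. -/
noncomputable def point {r : ℕ} {n : Fin r → ℕ} (d : ℕ) (p : Params r n) (τ ζ : ℝ) (i : Fin r)
    (j : Fin (n i)) : Fin d → ℝ :=
  curve d r i ζ (p.x i j * τ ^ p.β i)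

/-- The polytope `P_i`, the convex hull of the points `γ_i(y_{i,j}; ζ)`, `1 ≤ j ≤ n_i`. -/
noncomputable def poly {r : ℕ} {n : Fin r → ℕ} (d : ℕ) (p : Params r n) (τ ζ : ℝ) (i : Fin r) :
    Set (Fin d → ℝ) :=
  convexHull ℝ (Set.range (point d p τ ζ i))

end CayleyTight

open CayleyTight

/-!
An affine functional on the Cayley polytope restricts to the curve `γ_i` as a function
`a i + c i * t + q t`. For the limit systems below, `q` is a polynomial common to all the curves
under consideration, with exponents from a fixed set `E` of integers `≥ 2`. Both general position
and neighborliness are statements about the zeros of such families. All functions of a family have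
the second derivative `q''`, so Rolle's theorem on disjoint intervals of positive reals and
Descartes' rule of signs for `q''` bound the total number of zeros by one less than the number of
parameters (`sum_rootCount_lt`). A family with more zeros vanishes (`family_eq_zero`), and for
prescribed zeros, fewer than half of the number of parameters, there is a family that is
non-negative on all the intervals and vanishes only there (`exists_nonneg_family`). The polytopes
are separated well enough for this as soon as `τ < 1`.

With `ζ = 0` the set `E` belongs to the last `d - r` coordinates, and `exists_nonneg_family` yields
the faces of the unperturbed polytopes. With `ζ > 0` and a set `S` of colors, the coordinates of the
colors outside `S` can be rescaled so that their coefficient `ζ` becomes `1`; then as `ζ → 0` the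
curves of the colors in `S` tend to a limit system with `|E| = d - |S|`, to which the results on
zeros apply. Independence of functionals and strict positivity persist under small perturbations,
so that for small `ζ > 0` the vertices are in general position (`eventually_genericConfig`) and the
configuration is neighborly (`eventually_neighborlyConfig`).

In general position, Euler's relation for polyhedral cones (`eulerSum_eq_zero`) and Möbius inversion
over the sets of colors give the Dehn-Sommerville equations for mixed faces
(`GenericConfig.dehn_sommerville`). Together with neighborliness, which determines the lower half of
the `h`-numbers, they determine all the numbers of mixed faces, and the bounds are the solution
(`eq_faceBound`, `GenericConfig.card_mixedSets`).

All this is about sets of vertices and functionals. The faces of the Cayley polytopes and of the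
Minkowski sum are the convex hulls of the sets of vertices at which some functional is maximal; the
faces of the sum correspond to the mixed faces for all colors by the Cayley trick
(`exists_eq_selections`), which lowers dimensions by `r - 1`. For `ζ = 0` the vertices need not be
in general position. There a mixed face of small dimension contains a spanning set of vertices, of the
right size, that is a face by itself, and so coincides with it
(`IsEval.numMixedFaces_of_forall_isFaceSet`). As the number of spanning sets does not depend on the
configuration, it is identified with the bound through a perturbed one.
-/

namespace CayleyTight

/-! ### Counting real roots of polynomials -/

section Roots

open Polynomial

/-- The number of roots of `p` in `[lo, hi]`, counted with multiplicity. -/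
noncomputable def rootCount (p : ℝ[X]) (lo hi : ℝ) : ℕ :=
  p.roots.countP (fun x => lo ≤ x ∧ x ≤ hi)

/-- Rolle's theorem on an interval, roots counted with multiplicity. -/
lemma rootCount_le_derivative (p : ℝ[X]) (lo hi : ℝ) :
    rootCount p lo hi ≤ rootCount (derivative p) lo hi + 1 := by
  classical
  unfold rootCount
  rw [Multiset.countP_eq_card_filter, Multiset.countP_eq_card_filter]
  set P : ℝ → Prop := fun x => lo ≤ x ∧ x ≤ hi with hP
  set s := (p.roots.filter P).toFinset with hs
  set s' := ((derivative p).roots.filter P).toFinset with hs'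
  have hinter : s.card ≤ (s' \ s).card + 1 := by
    rcases eq_or_ne (derivative p) 0 with hp' | hp'
    · have : s = ∅ := by
        rw [hs, eq_C_of_derivative_eq_zero hp']
        simp
      simp [this]
    have hp : p ≠ 0 := ne_of_apply_ne derivative (by rwa [derivative_zero])
    refine Finset.card_le_sdiff_of_interleaved fun x hx y hy hxy hxy' => ?_
    rw [hs, Multiset.mem_toFinset, Multiset.mem_filter, mem_roots hp] at hx hy
    obtain ⟨z, hz1, hz2⟩ := exists_deriv_eq_zero hxy p.continuousOn (hx.1.trans hy.1.symm)
    refine ⟨z, ?_, hz1⟩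
    rw [hs', Multiset.mem_toFinset, Multiset.mem_filter, mem_roots hp', IsRoot, ← p.deriv]
    exact ⟨hz2, hx.2.1.trans hz1.1.le, hz1.2.le.trans hy.2.2⟩
  have hcount : ∀ q : ℝ[X], ∀ x, P x → (q.roots.filter P).count x = q.rootMultiplicity x := by
    intro q x hx
    rw [Multiset.count_filter_of_pos hx, count_roots]
  have hPs : ∀ x ∈ s, P x := fun x hx => by
    rw [hs, Multiset.mem_toFinset, Multiset.mem_filter] at hx; exact hx.2
  have hPs' : ∀ x ∈ s', P x := fun x hx => by
    rw [hs', Multiset.mem_toFinset, Multiset.mem_filter] at hx; exact hx.2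
  calc
    Multiset.card (p.roots.filter P) = ∑ x ∈ s, (p.roots.filter P).count x :=
      (Multiset.toFinset_sum_count_eq _).symm
    _ = ∑ x ∈ s, (p.rootMultiplicity x - 1 + 1) := by
      refine Finset.sum_congr rfl fun x hx => ?_
      have h1 : 0 < (p.roots.filter P).count x :=
        Multiset.count_pos.2 (Multiset.mem_toFinset.1 hx)
      rw [hcount p x (hPs x hx)] at h1 ⊢
      omega
    _ = (∑ x ∈ s, (p.rootMultiplicity x - 1)) + s.card := by
      simp only [Finset.sum_add_distrib, Finset.card_eq_sum_ones]
    _ ≤ (∑ x ∈ s, (derivative p).rootMultiplicity x) + ((s' \ s).card + 1) :=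
      add_le_add (Finset.sum_le_sum fun _ _ =>
        rootMultiplicity_sub_one_le_derivative_rootMultiplicity _ _) hinter
    _ ≤ (∑ x ∈ s, ((derivative p).roots.filter P).count x) +
          ((∑ x ∈ s' \ s, ((derivative p).roots.filter P).count x) + 1) := by
      gcongr with x hx
      · exact (hcount _ x (hPs x hx)).ge
      · rw [Finset.card_eq_sum_ones]
        refine Finset.sum_le_sum fun x hx => ?_
        exact Multiset.count_pos.2 (Multiset.mem_toFinset.1 (Finset.mem_sdiff.1 hx).1)
    _ = Multiset.card ((derivative p).roots.filter P) + 1 := by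
      rw [← add_assoc, ← Finset.sum_union Finset.disjoint_sdiff, Finset.union_sdiff_self_eq_union,
        ← Multiset.toFinset_sum_count_eq, ← Finset.sum_subset Finset.subset_union_right]
      intro x _ hx₂
      simpa only [hs', Multiset.mem_toFinset, Multiset.count_eq_zero] using hx₂

lemma rootCount_mul {p q : ℝ[X]} (h : p * q ≠ 0) (lo hi : ℝ) :
    rootCount (p * q) lo hi = rootCount p lo hi + rootCount q lo hi := by
  simp [rootCount, roots_mul h, Multiset.countP_add]

lemma rootCount_prod_X_sub_C (A : Finset ℝ) {lo hi : ℝ} (h : ∀ x ∈ A, lo ≤ x ∧ x ≤ hi) :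
    rootCount (∏ a ∈ A, (X - C a)) lo hi = A.card := by
  rw [rootCount, roots_prod_X_sub_C]
  exact Multiset.countP_eq_card.2 h

lemma signVariations_lt_card_support {Q : ℝ[X]} (hQ : Q ≠ 0) :
    Q.signVariations + 1 ≤ Q.support.card := by
  induction hn : Q.support.card using Nat.strong_induction_on generalizing Q with
  | _ n ih =>
    subst hn
    have hc := card_support_eraseLead_add_one hQ
    by_cases he : Q.eraseLead = 0
    · have h1 := Q.eraseLead_add_monomial_natDegree_leadingCoeff
      rw [he, zero_add] at h1
      have : Q.signVariations = 0 := by rw [← h1]; exact signVariations_monomial _ _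
      omega
    · have h1 := ih _ (by omega) he rfl
      have h2 := signVariations_le_eraseLead_succ (P := Q)
      omega

/-- A weak form of Descartes' rule of signs. -/
lemma countP_pos_roots_lt {Q : ℝ[X]} (hQ : Q ≠ 0) :
    Q.roots.countP (0 < ·) + 1 ≤ Q.support.card :=
  (Nat.add_le_add_right (roots_countP_pos_le_signVariations (P := Q)) 1).trans
    (signVariations_lt_card_support hQ)

lemma sum_countP_add_le {α ι : Type*} (m : Multiset α) (S : Finset ι) (P : α → Prop)
    (p : ι → α → Prop) [DecidablePred P] [∀ i, DecidablePred (p i)]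
    [DecidablePred fun x => P x ∧ ∀ i ∈ S, ¬ p i x]
    (hp : ∀ i ∈ S, ∀ x, p i x → P x)
    (hd : ∀ i ∈ S, ∀ j ∈ S, ∀ x, p i x → p j x → i = j) :
    ∑ i ∈ S, m.countP (p i) + m.countP (fun x => P x ∧ ∀ i ∈ S, ¬ p i x) ≤ m.countP P := by
  classical
  induction m using Multiset.induction_on with
  | empty => simp
  | cons a m ih =>
    simp only [Multiset.countP_cons, Finset.sum_add_distrib]
    have key : ∑ i ∈ S, (if p i a then 1 else 0) + (if P a ∧ ∀ i ∈ S, ¬ p i a then 1 else 0)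
        ≤ (if P a then 1 else 0) := by
      by_cases h : ∃ i ∈ S, p i a
      · obtain ⟨i, hi, hia⟩ := h
        have h1 : ∑ j ∈ S, (if p j a then 1 else 0) = 1 := by
          rw [Finset.sum_eq_single_of_mem i hi]
          · simp [hia]
          · intro j hj hne
            rw [if_neg]
            exact fun hja => hne (hd j hj i hi a hja hia)
        have h2 : ¬ (P a ∧ ∀ i ∈ S, ¬ p i a) := fun h => h.2 i hi hia
        rw [h1, if_neg h2, if_pos (hp i hi a hia)]
      · push Not at h
        rw [Finset.sum_eq_zero (fun i hi => if_neg (h i hi))]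
        by_cases hPa : P a
        · rw [if_pos hPa, zero_add]; split_ifs <;> simp
        · simp [hPa]
    omega

end Roots

/-! ### Functions with a common non-affine part -/

section Family

open Polynomial

lemma support_derivative_card_le (q : ℝ[X]) : (derivative q).support.card ≤ q.support.card := by
  calc (derivative q).support.card ≤ (q.support.image (fun n => n - 1)).card := by
        refine Finset.card_le_card fun n hn => ?_
        rw [mem_support_iff, coeff_derivative] at hn
        rw [Finset.mem_image]
        exact ⟨n + 1, mem_support_iff.2 (left_ne_zero_of_mul hn), by simp⟩
    _ ≤ _ := Finset.card_image_le

lemma eq_zero_of_second_derivative_eq_zero {q : ℝ[X]} (hq : ∀ m ∈ q.support, 2 ≤ m)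
    (h : derivative (derivative q) = 0) : q = 0 := by
  ext n
  by_contra hn
  have h2 := hq n (mem_support_iff.2 (by simpa using hn))
  obtain ⟨m, rfl⟩ := Nat.exists_eq_add_of_le h2
  have := congrArg (fun p => p.coeff m) h
  simp only [coeff_derivative, coeff_zero, mul_eq_zero] at this
  rcases this with (h1 | h1) | h1
  · apply hn; rw [coeff_zero, show 2 + m = m + 1 + 1 by ring]; exact h1
  · have : (0 : ℝ) < ((m + 1 : ℕ) : ℝ) + 1 := by positivity
    exact this.ne' h1
  · have : (0 : ℝ) < (m : ℝ) + 1 := by positivity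
    exact this.ne' h1

lemma second_derivative_affine_add (a c : ℝ) (q : ℝ[X]) :
    derivative (derivative (C a + C c * X + q)) = derivative (derivative q) := by
  simp

variable {ι : Type*} [LinearOrder ι]

/-- The disjoint intervals `[lo i, hi i]` of positive reals, `i ∈ S`. -/
structure OrderedIntervals (S : Finset ι) (lo hi : ι → ℝ) : Prop where
  pos : ∀ i ∈ S, 0 < lo i
  lt : ∀ i ∈ S, ∀ j ∈ S, i < j → hi i < lo j

lemma OrderedIntervals.eq {S : Finset ι} {lo hi : ι → ℝ} (h : OrderedIntervals S lo hi)
    {i j : ι} (hiS : i ∈ S) (hjS : j ∈ S) {x : ℝ} (hx : lo i ≤ x ∧ x ≤ hi i)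
    (hx' : lo j ≤ x ∧ x ≤ hi j) : i = j := by
  rcases lt_trichotomy i j with hij | hij | hij
  · have := h.lt i hiS j hjS hij; linarith [hx.2, hx'.1]
  · exact hij
  · have := h.lt j hjS i hiS hij; linarith [hx'.2, hx.1]

/-- Functions `f i` with a common second derivative `q''` that is not identically zero have
few zeros in disjoint intervals of positive reals: each `f i` has at most two zeros more than `q''`
has in the same interval, and `q''` has fewer positive zeros than it has terms. -/
lemma sum_rootCount_lt {S : Finset ι} {lo hi : ι → ℝ} (h : OrderedIntervals S lo hi)
    (f : ι → ℝ[X]) (q : ℝ[X])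
    (hf : ∀ i ∈ S, derivative (derivative (f i)) = derivative (derivative q))
    (hq : derivative (derivative q) ≠ 0) :
    ∑ i ∈ S, rootCount (f i) (lo i) (hi i) + 1 ≤ 2 * S.card + q.support.card := by
  classical
  have h1 := countP_pos_roots_lt hq
  have h2 := sum_countP_add_le (derivative (derivative q)).roots S (0 < ·)
    (fun i x => lo i ≤ x ∧ x ≤ hi i) (fun i hi x hx => (h.pos i hi).trans_le hx.1)
    (fun i hi j hj x hx hx' => h.eq hi hj hx hx')
  have h3 : ∑ i ∈ S, rootCount (f i) (lo i) (hi i) ≤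
      ∑ i ∈ S, ((derivative (derivative q)).roots.countP (fun x => lo i ≤ x ∧ x ≤ hi i) + 2) := by
    refine Finset.sum_le_sum fun i hiS => ?_
    have e1 := rootCount_le_derivative (f i) (lo i) (hi i)
    have e2 := rootCount_le_derivative (derivative (f i)) (lo i) (hi i)
    rw [hf i hiS] at e2
    unfold rootCount at e1 e2 ⊢
    omega
  rw [Finset.sum_add_distrib, Finset.sum_const, smul_eq_mul] at h3
  have h4 := (support_derivative_card_le (derivative q)).trans (support_derivative_card_le q)
  omega

lemma prod_dvd_of_eval_eq_zero {A : Finset ℝ} {p : ℝ[X]} (h : ∀ x ∈ A, p.eval x = 0) :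
    ∏ a ∈ A, (X - C a) ∣ p := by
  refine Finset.prod_dvd_of_coprime (fun x _ y _ hxy => ?_) fun x hx => dvd_iff_isRoot.2 (h x hx)
  exact pairwise_coprime_X_sub_C Function.injective_id hxy

lemma prod_sq_dvd_of_eval_eq_zero {A : Finset ℝ} {p : ℝ[X]} (hp : p ≠ 0)
    (h : ∀ x ∈ A, p.eval x = 0) (h' : ∀ x ∈ A, (derivative p).eval x = 0) :
    (∏ a ∈ A, (X - C a)) ^ 2 ∣ p := by
  rw [← Finset.prod_pow]
  refine Finset.prod_dvd_of_coprime (fun x _ y _ hxy => ?_) fun x hx => ?_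
  · exact (pairwise_coprime_X_sub_C (K := ℝ) Function.injective_id hxy).pow
  · rw [← le_rootMultiplicity_iff hp]
    exact (one_lt_rootMultiplicity_iff_isRoot hp).2 ⟨h x hx, h' x hx⟩

/-- Uniqueness: a family with at least as many zeros as parameters, at least two for each index,
vanishes. -/
lemma family_eq_zero {S : Finset ι} {lo hi : ι → ℝ} (h : OrderedIntervals S lo hi)
    (A : ι → Finset ℝ) (hA : ∀ i ∈ S, ∀ x ∈ A i, lo i ≤ x ∧ x ≤ hi i)
    (hA2 : ∀ i ∈ S, 2 ≤ (A i).card) (E : Finset ℕ) (hE : ∀ m ∈ E, 2 ≤ m)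
    (hcard : 2 * S.card + E.card ≤ ∑ i ∈ S, (A i).card)
    (a c : ι → ℝ) (q : ℝ[X]) (hq : q.support ⊆ E)
    (hz : ∀ i ∈ S, ∀ x ∈ A i, a i + c i * x + q.eval x = 0) :
    q = 0 ∧ ∀ i ∈ S, a i = 0 ∧ c i = 0 := by
  have hq0 : q = 0 := by
    by_contra hne
    have hQ : derivative (derivative q) ≠ 0 := fun h0 =>
      hne (eq_zero_of_second_derivative_eq_zero (fun m hm => hE m (hq hm)) h0)
    have h1 := sum_rootCount_lt h (fun i => C (a i) + C (c i) * X + q) q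
      (fun i _ => second_derivative_affine_add _ _ _) hQ
    have h2 : ∑ i ∈ S, (A i).card ≤
        ∑ i ∈ S, rootCount (C (a i) + C (c i) * X + q) (lo i) (hi i) := by
      refine Finset.sum_le_sum fun i hiS => ?_
      obtain ⟨g, hg⟩ := prod_dvd_of_eval_eq_zero (A := A i) (p := C (a i) + C (c i) * X + q)
        (fun x hx => by simpa using hz i hiS x hx)
      have hne : C (a i) + C (c i) * X + q ≠ 0 := fun h0 => hQ (by
        rw [← second_derivative_affine_add (a i) (c i) q, h0]; simp)
      rw [hg] at hne ⊢
      rw [rootCount_mul hne, rootCount_prod_X_sub_C _ (hA i hiS)]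
      exact Nat.le_add_right _ _
    have h3 := Finset.card_le_card hq
    omega
  refine ⟨hq0, fun i hiS => ?_⟩
  obtain ⟨x, hx, y, hy, hxy⟩ := Finset.one_lt_card.1 (hA2 i hiS)
  have e1 := hz i hiS x hx
  have e2 := hz i hiS y hy
  simp only [hq0, eval_zero, add_zero] at e1 e2
  have : c i * (x - y) = 0 := by linarith
  have hc : c i = 0 := (mul_eq_zero.1 this).resolve_right (sub_ne_zero.2 hxy)
  rw [hc] at e1
  exact ⟨by linarith, hc⟩

end Family

/-! ### Non-negative functions with prescribed zeros -/

section Existence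

open Polynomial

variable {ι : Type*} [LinearOrder ι]

/-- A non-trivial family with double zeros at prescribed points, one parameter more than there are
conditions. -/
lemma exists_family_double_zeros (S : Finset ι) (A : ι → Finset ℝ) (E : Finset ℕ)
    (hcard : 2 * ∑ i ∈ S, (A i).card < 2 * S.card + E.card) :
    ∃ (a c : ι → ℝ) (q : ℝ[X]), q.support ⊆ E ∧
      (∀ i ∈ S, ∀ x ∈ A i, (C (a i) + C (c i) * X + q).eval x = 0 ∧
        (derivative (C (a i) + C (c i) * X + q)).eval x = 0) ∧
      (q ≠ 0 ∨ ∃ i ∈ S, a i ≠ 0 ∨ c i ≠ 0) := by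
  classical
  let q : (S → ℝ) × (S → ℝ) × (E → ℝ) → ℝ[X] := fun v => ∑ e : E, monomial (e : ℕ) (v.2.2 e)
  have hqadd : ∀ v w, q (v + w) = q v + q w := fun v w => by
    simp [q, Finset.sum_add_distrib]
  have hqsmul : ∀ (t : ℝ) v, q (t • v) = C t * q v := fun t v => by
    simp [q, Finset.mul_sum, C_mul_monomial]
  let T : (S → ℝ) × (S → ℝ) × (E → ℝ) →ₗ[ℝ]
      ((Σ i : S, A i) → ℝ) × ((Σ i : S, A i) → ℝ) :=
    { toFun := fun v =>
        (fun x => (C (v.1 x.1) + C (v.2.1 x.1) * X + q v).eval (x.2 : ℝ),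
          fun x => (derivative (C (v.1 x.1) + C (v.2.1 x.1) * X + q v)).eval (x.2 : ℝ))
      map_add' := fun v w => by
        ext x <;> simp [hqadd] <;> ring
      map_smul' := fun t v => by
        ext x <;> simp [hqsmul] <;> ring }
  have hdim : Module.finrank ℝ (((Σ i : S, A i) → ℝ) × ((Σ i : S, A i) → ℝ)) <
      Module.finrank ℝ ((S → ℝ) × (S → ℝ) × (E → ℝ)) := by
    simp only [Module.finrank_prod, Module.finrank_fintype_fun_eq_card, Fintype.card_sigma,
      Fintype.card_coe]
    rw [Finset.sum_coe_sort S (fun i => (A i).card)]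
    omega
  obtain ⟨v, hv, hv0⟩ :=
    (Submodule.ne_bot_iff _).1 (LinearMap.ker_ne_bot_of_finrank_lt (f := T) hdim)
  rw [LinearMap.mem_ker] at hv
  have hcoef : ∀ e : E, (q v).coeff e = v.2.2 e := fun e => by
    simp only [q, finsetSum_coeff, coeff_monomial]
    rw [Finset.sum_eq_single e]
    · simp
    · intro b _ hb; rw [if_neg]; exact fun h => hb (Subtype.ext h)
    · simp
  refine ⟨fun i => if h : i ∈ S then v.1 ⟨i, h⟩ else 0,
    fun i => if h : i ∈ S then v.2.1 ⟨i, h⟩ else 0, q v, ?_, ?_, ?_⟩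
  · intro m hm
    by_contra hmE
    rw [mem_support_iff] at hm
    apply hm
    simp only [q, finsetSum_coeff, coeff_monomial]
    refine Finset.sum_eq_zero fun e _ => if_neg ?_
    rintro rfl
    exact hmE e.2
  · intro i hi x hx
    have e1 := congrFun (congrArg Prod.fst hv) ⟨⟨i, hi⟩, ⟨x, hx⟩⟩
    have e2 := congrFun (congrArg Prod.snd hv) ⟨⟨i, hi⟩, ⟨x, hx⟩⟩
    simp only [hi, dif_pos]
    exact ⟨e1, e2⟩
  · by_contra hcon
    push Not at hcon
    obtain ⟨h1, h2⟩ := hcon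
    apply hv0
    refine Prod.ext (funext fun i => ?_) (Prod.ext (funext fun i => ?_) (funext fun e => ?_))
    · simpa using (h2 i i.2).1
    · simpa using (h2 i i.2).2
    · rw [← hcoef e, h1]; simp

lemma mul_pos_of_no_root (g : ℝ[X]) {lo hi : ℝ} (h : ∀ x, lo ≤ x → x ≤ hi → g.eval x ≠ 0)
    {x y : ℝ} (hx : lo ≤ x ∧ x ≤ hi) (hy : lo ≤ y ∧ y ≤ hi) : 0 < g.eval x * g.eval y := by
  by_contra hcon
  have hc : ContinuousOn (fun x => g.eval x) (Set.Icc lo hi) := g.continuous.continuousOn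
  have hne := mul_ne_zero (h x hx.1 hx.2) (h y hy.1 hy.2)
  have hneg : g.eval x * g.eval y < 0 := lt_of_le_of_ne (not_lt.1 hcon) hne
  have key : (0 : ℝ) ∈ (fun x => g.eval x) '' Set.Icc lo hi := by
    rcases mul_neg_iff.1 hneg with h1 | h1
    · exact isPreconnected_Icc.intermediate_value (Set.mem_Icc.2 hy) (Set.mem_Icc.2 hx) hc
        ⟨h1.2.le, h1.1.le⟩
    · exact isPreconnected_Icc.intermediate_value (Set.mem_Icc.2 hx) (Set.mem_Icc.2 hy) hc
        ⟨h1.1.le, h1.2.le⟩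
  obtain ⟨z, hz, hz0⟩ := key
  exact h z hz.1 hz.2 hz0

lemma rootCount_eq_zero_iff {g : ℝ[X]} (hg : g ≠ 0) {lo hi : ℝ} :
    rootCount g lo hi = 0 ↔ ∀ x, lo ≤ x → x ≤ hi → g.eval x ≠ 0 := by
  rw [rootCount, Multiset.countP_eq_zero]
  constructor
  · intro h x h1 h2 h3
    exact h x ((mem_roots hg).2 h3) ⟨h1, h2⟩
  · intro h x hx hx'
    exact h x hx'.1 hx'.2 ((mem_roots hg).1 hx)

/-- The sign of the second derivative at a double zero. -/
lemma second_derivative_eval_mul_pos (A : Finset ℝ) (g : ℝ[X]) {a : ℝ} (ha : a ∈ A)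
    (hga : g.eval a ≠ 0) :
    0 < (derivative (derivative ((∏ b ∈ A, (X - C b)) ^ 2 * g))).eval a * g.eval a := by
  set P : ℝ[X] := ∏ b ∈ A, (X - C b) with hP
  have hPa : P.eval a = 0 := by
    rw [hP, eval_prod]; exact Finset.prod_eq_zero ha (by simp)
  have hP' : (derivative P).eval a ≠ 0 := by
    have hsep : P.Separable := by
      rw [hP]; exact separable_prod_X_sub_C_iff'.2 fun x _ y _ h => h
    obtain ⟨u, w, huw⟩ := hsep
    intro h0
    have := congrArg (fun p => p.eval a) huw
    simp [hPa, h0] at this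
  have : (derivative (derivative (P ^ 2 * g))).eval a =
      2 * (derivative P).eval a ^ 2 * g.eval a := by
    simp only [pow_two, derivative_mul, derivative_add, eval_add, eval_mul, hPa]
    ring
  rw [this]
  have : 0 < (derivative P).eval a ^ 2 := by positivity
  have : 0 < g.eval a ^ 2 := by positivity
  nlinarith

/-- For prescribed zeros `A i`, `i ∈ S`, there are functions `a i + c i * x + q x` with a common
part `q` that vanish on `A i` and are positive on the rest of `[lo i, hi i]`. By counting parameters
there is a non-trivial family with double zeros at the `A i`. Its number of zeros is the largest that
Rolle's theorem and Descartes' rule allow for the common second derivative `Q`. So there are no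
further zeros, and `Q` does not change sign between the intervals spanned by the `A i`, which gives all the
functions the same sign. -/
lemma exists_nonneg_family {S : Finset ι} {lo hi lo' hi' : ι → ℝ} (h : OrderedIntervals S lo hi)
    (A : ι → Finset ℝ) (hA0 : ∀ i ∈ S, lo' i ∈ A i ∧ hi' i ∈ A i)
    (hA : ∀ i ∈ S, ∀ x ∈ A i, lo' i ≤ x ∧ x ≤ hi' i)
    (hsub : ∀ i ∈ S, lo i ≤ lo' i ∧ hi' i ≤ hi i)
    (E : Finset ℕ) (hE : ∀ m ∈ E, 2 ≤ m)
    (hcard : 2 * ∑ i ∈ S, (A i).card + 1 = 2 * S.card + E.card) :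
    ∃ (a c : ι → ℝ) (q : ℝ[X]), q.support ⊆ E ∧ ∀ i ∈ S,
      (∀ x ∈ A i, a i + c i * x + q.eval x = 0) ∧
      ∀ x, lo i ≤ x → x ≤ hi i → x ∉ A i → 0 < a i + c i * x + q.eval x := by
  classical
  obtain ⟨a, c, q, hqE, hz, hnt⟩ := exists_family_double_zeros S A E (by omega)
  set f : ι → ℝ[X] := fun i => C (a i) + C (c i) * X + q with hf
  set Q := derivative (derivative q) with hQdef
  have hfQ : ∀ i, derivative (derivative (f i)) = Q := fun i => second_derivative_affine_add _ _ _
  have hQ : Q ≠ 0 := by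
    intro h0
    have hq0 := eq_zero_of_second_derivative_eq_zero (fun m hm => hE m (hqE hm)) h0
    rcases hnt with hnt | ⟨i, hi, hnt⟩
    · exact hnt hq0
    · obtain ⟨e1, e2⟩ := hz i hi _ (hA0 i hi).1
      simp [hq0] at e1 e2
      rw [e2] at e1
      simp at e1
      rcases hnt with hnt | hnt
      · exact hnt e1
      · exact hnt e2
  have hf0 : ∀ i, f i ≠ 0 := fun i h0 => hQ (by rw [← hfQ i, h0]; simp)
  have hdvd : ∀ i, ∃ g, i ∈ S → f i = (∏ b ∈ A i, (X - C b)) ^ 2 * g := by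
    intro i
    by_cases hi : i ∈ S
    · obtain ⟨g, hg⟩ := prod_sq_dvd_of_eval_eq_zero (A := A i) (hf0 i)
        (fun x hx => (hz i hi x hx).1) (fun x hx => (hz i hi x hx).2)
      exact ⟨g, fun _ => hg⟩
    · exact ⟨0, fun h => absurd h hi⟩
  choose g hg using hdvd
  have hg0 : ∀ i ∈ S, g i ≠ 0 := fun i hi h0 => hf0 i (by rw [hg i hi, h0, mul_zero])
  have hcnt : ∀ i ∈ S, ∀ l u : ℝ, (∀ x ∈ A i, l ≤ x ∧ x ≤ u) →
      rootCount (f i) l u = 2 * (A i).card + rootCount (g i) l u := by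
    intro i hi l u hlu
    have h1 : (∏ b ∈ A i, (X - C b)) ^ 2 * g i ≠ 0 := by rw [← hg i hi]; exact hf0 i
    rw [hg i hi, rootCount_mul h1, pow_two, rootCount_mul, rootCount_prod_X_sub_C _ hlu, two_mul]
    rw [← pow_two]; exact left_ne_zero_of_mul h1
  have hEc := Finset.card_le_card hqE
  -- the cofactors have no zero in the large intervals
  have hgnr : ∀ i ∈ S, ∀ x, lo i ≤ x → x ≤ hi i → (g i).eval x ≠ 0 := by
    have h1 := sum_rootCount_lt h f q (fun i _ => hfQ i) hQ
    have h2 : ∑ i ∈ S, rootCount (f i) (lo i) (hi i) =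
        ∑ i ∈ S, (2 * (A i).card + rootCount (g i) (lo i) (hi i)) :=
      Finset.sum_congr rfl fun i hi => hcnt i hi _ _ fun x hx =>
        ⟨(hsub i hi).1.trans (hA i hi x hx).1, (hA i hi x hx).2.trans (hsub i hi).2⟩
    rw [h2, Finset.sum_add_distrib, ← Finset.mul_sum] at h1
    have h3 : ∑ i ∈ S, rootCount (g i) (lo i) (hi i) = 0 := by omega
    intro i hi
    exact (rootCount_eq_zero_iff (hg0 i hi)).1 (Finset.sum_eq_zero_iff.1 h3 i hi)
  -- all positive zeros of `Q` lie in the small intervals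
  have hQr : ∀ x, 0 < x → Q.eval x = 0 → ∃ i ∈ S, lo' i ≤ x ∧ x ≤ hi' i := by
    have hord : OrderedIntervals S lo' hi' :=
      ⟨fun i hi => (h.pos i hi).trans_le (hsub i hi).1, fun i hi j hj hij =>
        (hsub i hi).2.trans_lt ((h.lt i hi j hj hij).trans_le (hsub j hj).1)⟩
    have h1 := countP_pos_roots_lt hQ
    have h2 := sum_countP_add_le Q.roots S (0 < ·)
      (fun i x => lo' i ≤ x ∧ x ≤ hi' i) (fun i hi x hx => (hord.pos i hi).trans_le hx.1)
      (fun i hi j hj x hx hx' => hord.eq hi hj hx hx')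
    have h3 : ∑ i ∈ S, 2 * (A i).card ≤
        ∑ i ∈ S, (Q.roots.countP (fun x => lo' i ≤ x ∧ x ≤ hi' i) + 2) := by
      refine Finset.sum_le_sum fun i hiS => ?_
      have e1 := rootCount_le_derivative (f i) (lo' i) (hi' i)
      have e2 := rootCount_le_derivative (derivative (f i)) (lo' i) (hi' i)
      rw [hfQ i] at e2
      rw [hcnt i hiS _ _ (hA i hiS)] at e1
      unfold rootCount at e1 e2
      omega
    rw [Finset.sum_add_distrib, Finset.sum_const, smul_eq_mul, ← Finset.mul_sum] at h3
    have h4 := (support_derivative_card_le (derivative q)).trans (support_derivative_card_le q)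
    have h5 : Q.roots.countP (fun x => 0 < x ∧ ∀ i ∈ S, ¬ (lo' i ≤ x ∧ x ≤ hi' i)) = 0 := by
      rw [hQdef] at *
      omega
    rw [Multiset.countP_eq_zero] at h5
    intro x hx hx0
    by_contra hcon
    push Not at hcon
    exact h5 x ((mem_roots hQ).2 hx0) ⟨hx, fun i hi h' => (hcon i hi h'.1).not_ge h'.2⟩
  have hAI : ∀ i ∈ S, ∀ x ∈ A i, lo i ≤ x ∧ x ≤ hi i := fun i hi x hx =>
    ⟨(hsub i hi).1.trans (hA i hi x hx).1, (hA i hi x hx).2.trans (hsub i hi).2⟩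
  -- at the prescribed zeros `Q` has the sign of the cofactor
  have hQg : ∀ i ∈ S, ∀ x ∈ A i, 0 < Q.eval x * (g i).eval x := by
    intro i hi x hx
    rw [← hfQ i, hg i hi]
    exact second_derivative_eval_mul_pos _ _ hx (hgnr i hi x (hAI i hi x hx).1 (hAI i hi x hx).2)
  have trans_sign : ∀ x y z : ℝ, 0 < x * y → 0 < y * z → 0 < x * z := by
    intro x y z h1 h2
    have h3 : 0 < y ^ 2 := by
      have : y ≠ 0 := fun h0 => by simp [h0] at h1
      positivity
    have h4 := mul_pos h1 h2
    by_contra h5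
    nlinarith
  have hQ1 : ∀ i ∈ S, ∀ x ∈ A i, ∀ y ∈ A i, 0 < Q.eval x * Q.eval y := by
    intro i hi x hx y hy
    refine trans_sign _ _ _ (hQg i hi x hx) (trans_sign _ ((g i).eval y) _ ?_ ?_)
    · exact mul_pos_of_no_root _ (hgnr i hi) (hAI i hi x hx) (hAI i hi y hy)
    · rw [mul_comm]; exact hQg i hi y hy
  -- `Q` has the same sign at all of them: it has no zeros between consecutive small intervals
  have hQ2 : ∀ n : ℕ, ∀ i ∈ S, ∀ j ∈ S, i < j → (S.filter fun l => i < l ∧ l < j).card = n →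
      0 < Q.eval (hi' i) * Q.eval (lo' j) := by
    intro n
    induction n using Nat.strong_induction_on with
    | _ n ih =>
      intro i hi j hj hij hn
      by_cases hl : ∃ l ∈ S, i < l ∧ l < j
      · obtain ⟨l, hl, hil, hlj⟩ := hl
        have c1 : (S.filter fun m => i < m ∧ m < l).card < n := by
          rw [← hn]
          refine Finset.card_lt_card (Finset.ssubset_iff_of_subset ?_ |>.2
            ⟨l, by simp [hl, hil, hlj], by simp⟩)
          intro m hm
          simp only [Finset.mem_filter] at hm ⊢
          exact ⟨hm.1, hm.2.1, hm.2.2.trans hlj⟩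
        have c2 : (S.filter fun m => l < m ∧ m < j).card < n := by
          rw [← hn]
          refine Finset.card_lt_card (Finset.ssubset_iff_of_subset ?_ |>.2
            ⟨l, by simp [hl, hil, hlj], by simp⟩)
          intro m hm
          simp only [Finset.mem_filter] at hm ⊢
          exact ⟨hm.1, hil.trans hm.2.1, hm.2.2⟩
        refine trans_sign _ _ _ (ih _ c1 i hi l hl hil rfl)
          (trans_sign _ _ _ (hQ1 l hl _ (hA0 l hl).1 _ (hA0 l hl).2) (ih _ c2 l hl j hj hlj rfl))
      · push Not at hl
        have hlt := h.lt i hi j hj hij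
        have hle : hi' i ≤ lo' j :=
          (hsub i hi).2.trans (hlt.le.trans (hsub j hj).1)
        refine mul_pos_of_no_root Q (lo := hi' i) (hi := lo' j) ?_ ⟨le_rfl, hle⟩ ⟨hle, le_rfl⟩
        intro x hx1 hx2 hx0
        have hp : 0 < x := ((h.pos i hi).trans_le (hAI i hi _ (hA0 i hi).2).1).trans_le hx1
        obtain ⟨l, hlS, hlx⟩ := hQr x hp hx0
        rcases lt_trichotomy l i with hli | rfl | hli
        · have e1 := h.lt l hlS i hi hli
          have e2 := (hsub l hlS).2
          have e3 := (hAI i hi _ (hA0 i hi).2).1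
          linarith [hlx.2]
        · have : x = hi' l := le_antisymm hlx.2 hx1
          have e := hQ1 l hi _ (hA0 l hi).2 _ (hA0 l hi).2
          rw [← this, hx0] at e
          simp at e
        · have hjl := hl l hlS hli
          rcases hjl.lt_or_eq with hjl | rfl
          · have e1 := h.lt j hj l hlS hjl
            have e2 := (hsub l hlS).1
            have e3 := (hAI j hj _ (hA0 j hj).1).2
            linarith [hlx.1]
          · have : x = lo' j := le_antisymm hx2 hlx.1
            have e := hQ1 j hj _ (hA0 j hj).1 _ (hA0 j hj).1
            rw [← this, hx0] at e
            simp at e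
  rcases S.eq_empty_or_nonempty with rfl | ⟨i₀, hi₀⟩
  · exact ⟨0, 0, 0, by simp, by simp⟩
  have hQ3 : ∀ i ∈ S, 0 < Q.eval (lo' i₀) * Q.eval (lo' i) := by
    intro i hi
    rcases lt_trichotomy i₀ i with hlt | rfl | hlt
    · exact trans_sign _ _ _ (hQ1 i₀ hi₀ _ (hA0 i₀ hi₀).1 _ (hA0 i₀ hi₀).2)
        (hQ2 _ i₀ hi₀ i hi hlt rfl)
    · exact hQ1 i₀ hi₀ _ (hA0 i₀ hi₀).1 _ (hA0 i₀ hi₀).1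
    · rw [mul_comm]
      exact trans_sign _ _ _ (hQ1 i hi _ (hA0 i hi).1 _ (hA0 i hi).2)
        (hQ2 _ i hi i₀ hi₀ hlt rfl)
  -- the common sign is made positive by the factor `s`
  set s := Q.eval (lo' i₀) with hs
  refine ⟨fun i => s * a i, fun i => s * c i, C s * q, ?_, fun i hi => ⟨fun x hx => ?_, ?_⟩⟩
  · intro m hm
    rw [mem_support_iff, coeff_C_mul] at hm
    exact hqE (mem_support_iff.2 (right_ne_zero_of_mul hm))
  · have := (hz i hi x hx).1
    simp only [eval_add, eval_C, eval_mul, eval_X] at this ⊢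
    linear_combination s * this
  · intro x hx1 hx2 hxA
    have e1 : s * a i + s * c i * x + (C s * q).eval x = s * (f i).eval x := by
      simp [hf]; ring
    rw [e1, hg i hi, eval_mul, eval_pow, mul_left_comm]
    refine mul_pos ?_ ?_
    · have : (∏ b ∈ A i, (X - C b)).eval x ≠ 0 := by
        rw [eval_prod]
        refine Finset.prod_ne_zero_iff.2 fun b hb => ?_
        simp only [eval_sub, eval_X, eval_C]
        exact sub_ne_zero.2 fun hxb => hxA (hxb ▸ hb)
      positivity
    · refine trans_sign _ _ _ (hQ3 i hi) (trans_sign _ _ _ (hQg i hi _ (hA0 i hi).1) ?_)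
      exact mul_pos_of_no_root _ (hgnr i hi) (hAI i hi _ (hA0 i hi).1) ⟨hx1, hx2⟩

end Existence

/-! ### Euler's relation for polyhedral cones -/

section Euler

set_option linter.unusedSectionVars false

variable {W : Type*} [NormedAddCommGroup W] [NormedSpace ℝ W] [FiniteDimensional ℝ W]
variable {ι : Type*} [DecidableEq ι]

open Classical in
/-- The Euler characteristic (with compact support) of `U ∩ L`, for a subspace `L` and an open
convex set `U`. -/
noncomputable def cellChar (U : Set W) (L : Submodule ℝ W) : ℤ :=
  if (U ∩ L).Nonempty then (-1) ^ Module.finrank ℝ L else 0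

/-- The common zeros of the functionals `ℓ v`, `v ∈ Z`. -/
def zeroSpace (ℓ : ι → W →ₗ[ℝ] ℝ) (Z : Finset ι) : Submodule ℝ W := ⨅ v ∈ Z, LinearMap.ker (ℓ v)

lemma mem_zeroSpace {ℓ : ι → W →ₗ[ℝ] ℝ} {Z : Finset ι} {f : W} :
    f ∈ zeroSpace ℓ Z ↔ ∀ v ∈ Z, ℓ v f = 0 := by
  simp [zeroSpace]

/-- The set where the functionals `ℓ v`, `v ∈ S`, are positive. -/
def posSet (ℓ : ι → W →ₗ[ℝ] ℝ) (S : Finset ι) : Set W := {f | ∀ v ∈ S, 0 < ℓ v f}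

lemma isOpen_pos (g : W →ₗ[ℝ] ℝ) : IsOpen {f | 0 < g f} :=
  isOpen_lt continuous_const g.continuous_of_finiteDimensional

lemma convex_pos (g : W →ₗ[ℝ] ℝ) : Convex ℝ {f | 0 < g f} := convex_halfSpace_gt g.isLinear 0

lemma isOpen_posSet (ℓ : ι → W →ₗ[ℝ] ℝ) (S : Finset ι) : IsOpen (posSet ℓ S) := by
  have : posSet ℓ S = ⋂ v ∈ S, {f | 0 < ℓ v f} := by ext; simp [posSet]
  rw [this]
  exact isOpen_biInter_finset fun v _ => isOpen_pos (ℓ v)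

lemma convex_posSet (ℓ : ι → W →ₗ[ℝ] ℝ) (S : Finset ι) : Convex ℝ (posSet ℓ S) := by
  have : posSet ℓ S = ⋂ v ∈ S, {f | 0 < ℓ v f} := by ext; simp [posSet]
  rw [this]
  exact convex_iInter fun v => convex_iInter fun _ => convex_pos (ℓ v)

lemma finrank_inf_ker (L : Submodule ℝ W) (g : W →ₗ[ℝ] ℝ) {h : W} (hL : h ∈ L) (hg : g h ≠ 0) :
    Module.finrank ℝ (L ⊓ LinearMap.ker g : Submodule ℝ W) + 1 = Module.finrank ℝ L := by
  have h1 := LinearMap.finrank_range_add_finrank_ker (g.domRestrict L)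
  have h2 : LinearMap.range (g.domRestrict L) = ⊤ := by
    rw [LinearMap.range_eq_top]
    intro t
    refine ⟨(t / g h) • ⟨h, hL⟩, ?_⟩
    simp [hg]
  rw [h2, finrank_top, Module.finrank_self] at h1
  have h3 : (L ⊓ LinearMap.ker g : Submodule ℝ W) =
      (LinearMap.ker (g.domRestrict L)).map L.subtype := by
    ext x
    simp only [Submodule.mem_inf, LinearMap.mem_ker, Submodule.mem_map, Submodule.subtype_apply,
      Subtype.exists, LinearMap.domRestrict_apply]
    constructor
    · rintro ⟨a, b⟩; exact ⟨x, a, b, rfl⟩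
    · rintro ⟨y, a, b, rfl⟩; exact ⟨a, b⟩
  rw [h3, Submodule.finrank_map_subtype_eq]
  omega

lemma cellChar_of_empty {U : Set W} {L : Submodule ℝ W} (h : ∀ f ∈ U, f ∉ L) :
    cellChar U L = 0 := by
  rw [cellChar, if_neg]
  rintro ⟨f, hf, hf'⟩
  exact h f hf hf'

lemma cellChar_of_mem {U : Set W} {L : Submodule ℝ W} {f : W} (h : f ∈ U) (h' : f ∈ L) :
    cellChar U L = (-1) ^ Module.finrank ℝ L := by
  rw [cellChar, if_pos ⟨f, h, h'⟩]

/-- The Euler characteristic is additive when a cell is cut by a hyperplane. -/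
lemma cellChar_split {U : Set W} (hU : IsOpen U) (hc : Convex ℝ U) (L : Submodule ℝ W)
    (g : W →ₗ[ℝ] ℝ) :
    cellChar U L = cellChar (U ∩ {f | 0 < g f}) L + cellChar (U ∩ {f | 0 < (-g) f}) L +
      cellChar U (L ⊓ LinearMap.ker g) := by
  by_cases hg : ∀ f ∈ L, g f = 0
  · have hL : L ⊓ LinearMap.ker g = L := inf_eq_left.2 fun f hf => hg f hf
    have e1 : cellChar (U ∩ {f | 0 < g f}) L = 0 := cellChar_of_empty (by
      rintro f ⟨_, hf⟩ hfL
      simp [hg f hfL] at hf)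
    have e2 : cellChar (U ∩ {f | 0 < (-g) f}) L = 0 := cellChar_of_empty (by
      rintro f ⟨_, hf⟩ hfL
      simp [hg f hfL] at hf)
    rw [hL, e1, e2, zero_add, zero_add]
  push Not at hg
  obtain ⟨h, hhL, hh⟩ := hg
  have hdim := finrank_inf_ker L g hhL hh
  have hpow : (-1 : ℤ) ^ Module.finrank ℝ L =
      -(-1) ^ Module.finrank ℝ (L ⊓ LinearMap.ker g : Submodule ℝ W) := by
    rw [← hdim, pow_succ]; ring
  by_cases hK : ∃ f ∈ U, f ∈ L ⊓ LinearMap.ker g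
  · obtain ⟨f, hfU, hfL, hfg⟩ := hK
    have hfg' : g f = 0 := hfg
    -- moving from `f` a little in both directions along `h`
    have hev : ∀ᶠ t : ℝ in nhds 0, f + t • h ∈ U := by
      have hcont : Continuous fun t : ℝ => f + t • h := by fun_prop
      exact hcont.continuousAt.eventually_mem (hU.mem_nhds (by simpa using hfU))
    obtain ⟨ε, hε, hball⟩ := Metric.eventually_nhds_iff.1 hev
    have hmem : ∀ s : ℝ, |s| = ε / 2 → f + s • h ∈ U := fun s hs =>
      hball (by rw [Real.dist_eq, sub_zero, hs]; linarith)
    have hmemL : ∀ s : ℝ, f + s • h ∈ L := fun s => L.add_mem hfL (L.smul_mem s hhL)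
    have hval : ∀ s : ℝ, g (f + s • h) = s * g h := fun s => by simp [hfg']
    have hplus : ∃ s : ℝ, |s| = ε / 2 ∧ 0 < s * g h := by
      rcases lt_or_gt_of_ne hh with h1 | h1
      · exact ⟨-(ε / 2), by rw [abs_neg, abs_of_pos (by linarith)], by nlinarith⟩
      · exact ⟨ε / 2, by rw [abs_of_pos (by linarith)], by positivity⟩
    obtain ⟨s, hs, hsg⟩ := hplus
    rw [cellChar_of_mem hfU hfL, cellChar_of_mem (L := L ⊓ LinearMap.ker g) hfU ⟨hfL, hfg⟩,
      cellChar_of_mem (U := U ∩ {f | 0 < g f}) (f := f + s • h)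
        ⟨hmem s hs, by simp only [Set.mem_ofPred_eq, hval]; exact hsg⟩ (hmemL s),
      cellChar_of_mem (U := U ∩ {f | 0 < (-g) f}) (f := f + (-s) • h)
        ⟨hmem (-s) (by rw [abs_neg, hs]), by
          simp only [Set.mem_ofPred_eq, LinearMap.neg_apply, hval]; linarith⟩ (hmemL (-s)), hpow]
    ring
  · push Not at hK
    rw [cellChar_of_empty (L := L ⊓ LinearMap.ker g) hK, add_zero]
    by_cases hne : ∃ f ∈ U, f ∈ L
    · obtain ⟨f, hfU, hfL⟩ := hne
      have hf0 : g f ≠ 0 := fun h0 => hK f hfU ⟨hfL, h0⟩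
      -- both signs cannot occur, as the segment between them would meet the kernel of `g`
      have hone : ∀ f₁ ∈ U, f₁ ∈ L → ∀ f₂ ∈ U, f₂ ∈ L → 0 < g f₁ → ¬ 0 < -g f₂ := by
        intro f₁ h1 h1' f₂ h2 h2' hp hn
        have hab : 0 < g f₁ - g f₂ := by linarith
        have hmem : (-g f₂ / (g f₁ - g f₂)) • f₁ + (g f₁ / (g f₁ - g f₂)) • f₂ ∈ U :=
          hc h1 h2 (by positivity) (by positivity) (by field_simp; ring)
        refine hK _ hmem ⟨L.add_mem (L.smul_mem _ h1') (L.smul_mem _ h2'), ?_⟩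
        rw [SetLike.mem_coe, LinearMap.mem_ker]
        simp only [map_add, map_smul, smul_eq_mul]
        field_simp
        ring
      rw [cellChar_of_mem hfU hfL]
      rcases lt_or_gt_of_ne hf0 with h1 | h1
      · rw [cellChar_of_empty (U := U ∩ {f | 0 < g f}),
          cellChar_of_mem (U := U ∩ {f | 0 < (-g) f}) ⟨hfU, by simpa using h1⟩ hfL, zero_add]
        rintro f' ⟨hf', hf''⟩ hfL'
        exact hone f' hf' hfL' f hfU hfL hf'' (by linarith)
      · rw [cellChar_of_empty (U := U ∩ {f | 0 < (-g) f}),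
          cellChar_of_mem (U := U ∩ {f | 0 < g f}) ⟨hfU, h1⟩ hfL, add_zero]
        rintro f' ⟨hf', hf''⟩ hfL'
        exact hone f hfU hfL f' hf' hfL' h1 hf''
    · push Not at hne
      rw [cellChar_of_empty hne, cellChar_of_empty, cellChar_of_empty, add_zero]
      · exact fun f hf => hne f hf.1
      · exact fun f hf => hne f hf.1

/-- The Euler characteristic of the part of `U ∩ L` where `ℓ v ≥ 0` for all `v ∈ V`, computed
from its decomposition into cells, on each of which every `ℓ v` is zero or positive. -/
noncomputable def eulerSum (ℓ : ι → W →ₗ[ℝ] ℝ) (U : Set W) (L : Submodule ℝ W) (V : Finset ι) : ℤ :=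
  ∑ Z ∈ V.powerset, cellChar (U ∩ posSet ℓ (V \ Z)) (L ⊓ zeroSpace ℓ Z)

variable (ℓ : ι → W →ₗ[ℝ] ℝ)

lemma eulerSum_empty (U : Set W) (L : Submodule ℝ W) : eulerSum ℓ U L ∅ = cellChar U L := by
  simp [eulerSum, posSet, zeroSpace]

lemma eulerSum_insert (U : Set W) (L : Submodule ℝ W) {V : Finset ι} {v : ι} (hv : v ∉ V) :
    eulerSum ℓ U L (insert v V) = eulerSum ℓ (U ∩ {f | 0 < ℓ v f}) L V +
      eulerSum ℓ U (L ⊓ LinearMap.ker (ℓ v)) V := by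
  unfold eulerSum
  rw [Finset.sum_powerset_insert hv]
  congr 1
  · refine Finset.sum_congr rfl fun Z hZ => ?_
    rw [Finset.mem_powerset] at hZ
    have h1 : insert v V \ Z = insert v (V \ Z) :=
      Finset.insert_sdiff_of_notMem _ fun h => hv (hZ h)
    have h2 : posSet ℓ (insert v (V \ Z)) = {f | 0 < ℓ v f} ∩ posSet ℓ (V \ Z) := by
      ext f; simp only [posSet, Finset.forall_mem_insert]; rfl
    rw [h1, h2, Set.inter_assoc]
  · refine Finset.sum_congr rfl fun Z hZ => ?_
    rw [Finset.mem_powerset] at hZ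
    have h1 : insert v V \ insert v Z = V \ Z := by
      ext x
      simp only [Finset.mem_sdiff, Finset.mem_insert]
      constructor
      · rintro ⟨h1, h2⟩; push Not at h2; exact ⟨h1.resolve_left h2.1, h2.2⟩
      · rintro ⟨h1, h2⟩
        refine ⟨Or.inr h1, ?_⟩
        rintro (rfl | h3)
        · exact hv h1
        · exact h2 h3
    have h2 : zeroSpace ℓ (insert v Z) = LinearMap.ker (ℓ v) ⊓ zeroSpace ℓ Z := by
      ext f
      simp [mem_zeroSpace]
    rw [h1, h2, inf_assoc]

lemma eulerSum_split {U : Set W} (hU : IsOpen U) (hc : Convex ℝ U) (L : Submodule ℝ W)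
    (V : Finset ι) (g : W →ₗ[ℝ] ℝ) :
    eulerSum ℓ U L V = eulerSum ℓ (U ∩ {f | 0 < g f}) L V +
      eulerSum ℓ (U ∩ {f | 0 < (-g) f}) L V + eulerSum ℓ U (L ⊓ LinearMap.ker g) V := by
  unfold eulerSum
  rw [← Finset.sum_add_distrib, ← Finset.sum_add_distrib]
  refine Finset.sum_congr rfl fun Z _ => ?_
  rw [cellChar_split (hU.inter (isOpen_posSet ℓ _)) (hc.inter (convex_posSet ℓ _)) _ g,
    Set.inter_right_comm, Set.inter_right_comm U {f | 0 < (-g) f}, inf_right_comm]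

/-- A constraint that is strictly implied by another one can be dropped. -/
lemma eulerSum_insert_of_pos {U : Set W} {L : Submodule ℝ W} {V : Finset ι} {v w : ι} (hv : v ∉ V)
    (hw : w ∈ V) (h : ∀ f ∈ U, f ∈ L → 0 ≤ ℓ w f → 0 < ℓ v f) :
    eulerSum ℓ U L (insert v V) = eulerSum ℓ U L V := by
  have hw0 : ∀ (Z : Finset ι) (f : W), f ∈ posSet ℓ (V \ Z) → f ∈ zeroSpace ℓ Z → 0 ≤ ℓ w f := by
    intro Z f h1 h2
    by_cases hwZ : w ∈ Z
    · exact (mem_zeroSpace.1 h2 w hwZ).ge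
    · exact (h1 w (Finset.mem_sdiff.2 ⟨hw, hwZ⟩)).le
  rw [eulerSum_insert ℓ U L hv]
  have h2 : eulerSum ℓ U (L ⊓ LinearMap.ker (ℓ v)) V = 0 := by
    refine Finset.sum_eq_zero fun Z _ => cellChar_of_empty ?_
    rintro f ⟨hfU, hfp⟩ ⟨⟨hfL, hfv⟩, hfZ⟩
    exact (h f hfU hfL (hw0 Z f hfp hfZ)).ne' hfv
  rw [h2, add_zero]
  refine Finset.sum_congr rfl fun Z _ => ?_
  unfold cellChar
  congr 1
  refine propext ⟨?_, ?_⟩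
  · rintro ⟨f, ⟨⟨h1, _⟩, h3⟩, h4⟩; exact ⟨f, ⟨h1, h3⟩, h4⟩
  · rintro ⟨f, ⟨h1, h3⟩, h4⟩
    exact ⟨f, ⟨⟨h1, h f h1 h4.1 (hw0 Z f h3 h4.2)⟩, h3⟩, h4⟩

/-- A constraint that is equivalent to another one can be dropped. -/
lemma eulerSum_insert_of_eq {U : Set W} {L : Submodule ℝ W} {V : Finset ι} {v w : ι} (hv : v ∉ V)
    (hw : w ∈ V) {a b : ℝ} (ha : 0 < a) (hb : 0 < b) (h : ∀ f ∈ L, a * ℓ v f = b * ℓ w f) :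
    eulerSum ℓ U L (insert v V) = eulerSum ℓ U L V := by
  rw [eulerSum_insert ℓ U L hv]
  unfold eulerSum
  rw [← Finset.sum_add_distrib]
  have hpos : ∀ f ∈ L, 0 < ℓ v f ↔ 0 < ℓ w f := fun f hf => by
    rw [← mul_pos_iff_of_pos_left ha, h f hf, mul_pos_iff_of_pos_left hb]
  have hzero : ∀ f ∈ L, ℓ v f = 0 ↔ ℓ w f = 0 := fun f hf => by
    have := h f hf
    constructor
    · intro h0; rw [h0, mul_zero] at this; exact (mul_eq_zero.1 this.symm).resolve_left hb.ne'
    · intro h0; rw [h0, mul_zero] at this; exact (mul_eq_zero.1 this).resolve_left ha.ne'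
  refine Finset.sum_congr rfl fun Z _ => ?_
  by_cases hwZ : w ∈ Z
  · rw [cellChar_of_empty, zero_add]
    · have : L ⊓ LinearMap.ker (ℓ v) ⊓ zeroSpace ℓ Z = L ⊓ zeroSpace ℓ Z := by
        refine le_antisymm (inf_le_inf_right _ inf_le_left) ?_
        rintro f ⟨h1, h2⟩
        exact ⟨⟨h1, (hzero f h1).2 (mem_zeroSpace.1 h2 w hwZ)⟩, h2⟩
      rw [this]
    · rintro f ⟨⟨_, h1⟩, _⟩ ⟨h2, h3⟩
      exact ((hpos f h2).1 h1).ne' (mem_zeroSpace.1 h3 w hwZ)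
  · rw [cellChar_of_empty (L := L ⊓ LinearMap.ker (ℓ v) ⊓ zeroSpace ℓ Z), add_zero]
    · unfold cellChar
      congr 1
      refine propext ⟨?_, ?_⟩
      · rintro ⟨f, ⟨⟨h1, _⟩, h3⟩, h4⟩; exact ⟨f, ⟨h1, h3⟩, h4⟩
      · rintro ⟨f, ⟨h1, h3⟩, h4⟩
        exact ⟨f, ⟨⟨h1, (hpos f h4.1).2 (h3 w (Finset.mem_sdiff.2 ⟨hw, hwZ⟩))⟩, h3⟩, h4⟩
    · rintro f ⟨_, h1⟩ ⟨⟨h2, h3⟩, _⟩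
      exact (h1 w (Finset.mem_sdiff.2 ⟨hw, hwZ⟩)).ne' ((hzero f h2).1 h3)

/-- If all constraints are positive at `u` and the cell is invariant under translations by
multiples of `u`, then the cell is cut along the hyperplanes on which two constraints become active
at the same time, until only one constraint matters on each part. -/
lemma eulerSum_eq_zero_of_forall_pos {u : W} (V : Finset ι) (hV : V.Nonempty)
    (hpos : ∀ v ∈ V, 0 < ℓ v u) (U : Set W) (hU : IsOpen U) (hc : Convex ℝ U)
    (hinv : ∀ f ∈ U, ∀ t : ℝ, f + t • u ∈ U) (L : Submodule ℝ W) (hu : u ∈ L) :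
    eulerSum ℓ U L V = 0 := by
  induction hn : V.card using Nat.strong_induction_on generalizing V U L with
  | _ n ih =>
  obtain ⟨v, hvV⟩ := hV
  have hvu := hpos v hvV
  rcases (V.erase v).eq_empty_or_nonempty with hV' | ⟨w, hw⟩
  · rw [← Finset.insert_erase hvV, hV', eulerSum_insert ℓ U L (by simp), eulerSum_empty,
      eulerSum_empty]
    by_cases hne : ∃ f ∈ U, f ∈ L
    · obtain ⟨f, hfU, hfL⟩ := hne
      have hval : ∀ t : ℝ, ℓ v (f + t • u) = ℓ v f + t * ℓ v u := fun t => by simp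
      rw [cellChar_of_mem (U := U ∩ {f | 0 < ℓ v f}) (f := f + ((1 - ℓ v f) / ℓ v u) • u)
          ⟨hinv f hfU _, by simp only [Set.mem_ofPred_eq, hval]; field_simp; linarith⟩
          (L.add_mem hfL (L.smul_mem _ hu)),
        cellChar_of_mem (L := L ⊓ LinearMap.ker (ℓ v)) (f := f + (-ℓ v f / ℓ v u) • u)
          (hinv f hfU _) ⟨L.add_mem hfL (L.smul_mem _ hu), by
            rw [SetLike.mem_coe, LinearMap.mem_ker, hval]; field_simp; ring⟩,
        ← finrank_inf_ker L (ℓ v) hu hvu.ne', pow_succ]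
      ring
    · push Not at hne
      rw [cellChar_of_empty fun f hf => hne f hf.1,
        cellChar_of_empty (L := L ⊓ LinearMap.ker (ℓ v)) fun f hf hf' => hne f hf hf'.1, add_zero]
  have hwv : w ≠ v := Finset.ne_of_mem_erase hw
  have hwV : w ∈ V := Finset.mem_of_mem_erase hw
  have hwu := hpos w hwV
  have hvw : v ∈ V.erase w := Finset.mem_erase.2 ⟨hwv.symm, hvV⟩
  have hev : insert v (V.erase v) = V := Finset.insert_erase hvV
  have hew : insert w (V.erase w) = V := Finset.insert_erase hwV
  have hcv : (V.erase v).card < n := hn ▸ Finset.card_erase_lt_of_mem hvV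
  have hcw : (V.erase w).card < n := hn ▸ Finset.card_erase_lt_of_mem hwV
  set g : W →ₗ[ℝ] ℝ := (ℓ w u) • ℓ v - (ℓ v u) • ℓ w with hg
  have hgu : g u = 0 := by simp [hg]; ring
  have hgval : ∀ f, g f = ℓ w u * ℓ v f - ℓ v u * ℓ w f := fun f => by simp [hg]
  have hpos' : ∀ x, ∀ y ∈ V.erase x, 0 < ℓ y u := fun x y hy => hpos y (Finset.mem_of_mem_erase hy)
  -- the side where `v` is implied by `w`
  have e1 : eulerSum ℓ (U ∩ {f | 0 < g f}) L V = 0 := by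
    rw [← hev, eulerSum_insert_of_pos ℓ (V.notMem_erase v) hw]
    · refine ih _ hcv _ ⟨w, hw⟩ (hpos' v) _ (hU.inter (isOpen_pos g)) (hc.inter (convex_pos g)) ?_
        L hu rfl
      rintro f ⟨h1, h2⟩ t
      refine ⟨hinv f h1 t, ?_⟩
      simpa [hgu] using h2
    · rintro f ⟨_, h2⟩ _ h3
      have h2' : 0 < g f := h2
      rw [hgval] at h2'
      have := mul_nonneg hvu.le h3
      exact pos_of_mul_pos_right (by linarith : 0 < ℓ w u * ℓ v f) hwu.le
  -- the side where `w` is implied by `v`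
  have e2 : eulerSum ℓ (U ∩ {f | 0 < (-g) f}) L V = 0 := by
    rw [← hew, eulerSum_insert_of_pos ℓ (V.notMem_erase w) hvw]
    · refine ih _ hcw _ ⟨v, hvw⟩ (hpos' w) _ (hU.inter (isOpen_pos (-g)))
        (hc.inter (convex_pos (-g))) ?_ L hu rfl
      rintro f ⟨h1, h2⟩ t
      refine ⟨hinv f h1 t, ?_⟩
      simpa [hgu] using h2
    · rintro f ⟨_, h2⟩ _ h3
      have h2' : 0 < -g f := h2
      rw [hgval] at h2'
      have := mul_nonneg hwu.le h3
      exact pos_of_mul_pos_right (by linarith : 0 < ℓ v u * ℓ w f) hvu.le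
  -- the hyperplane on which `v` and `w` are equivalent
  have e3 : eulerSum ℓ U (L ⊓ LinearMap.ker g) V = 0 := by
    rw [← hev, eulerSum_insert_of_eq ℓ (V.notMem_erase v) hw hwu hvu]
    · exact ih _ hcv _ ⟨w, hw⟩ (hpos' v) U hU hc hinv _ ⟨hu, hgu⟩ rfl
    · rintro f ⟨_, h2⟩
      have h2' : g f = 0 := h2
      rw [hgval] at h2'
      linarith
  rw [eulerSum_split ℓ hU hc L _ g, e1, e2, e3]
  rfl

/-- Euler's relation for a polyhedral cone that is not a linear subspace. -/
lemma eulerSum_eq_zero {u : W} (V : Finset ι) (hV : ∃ v ∈ V, 0 < ℓ v u)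
    (hnn : ∀ v ∈ V, 0 ≤ ℓ v u) (U : Set W) (hU : IsOpen U) (hc : Convex ℝ U)
    (hinv : ∀ f ∈ U, ∀ t : ℝ, f + t • u ∈ U) (L : Submodule ℝ W) (hu : u ∈ L) :
    eulerSum ℓ U L V = 0 := by
  induction hn : V.card using Nat.strong_induction_on generalizing V U L with
  | _ n ih =>
  by_cases h0 : ∃ v ∈ V, ℓ v u = 0
  · obtain ⟨v, hvV, hv0⟩ := h0
    obtain ⟨w, hwV, hw0⟩ := hV
    have hw : w ∈ V.erase v := Finset.mem_erase.2 ⟨fun h => hw0.ne' (h ▸ hv0), hwV⟩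
    have hcv : (V.erase v).card < n := hn ▸ Finset.card_erase_lt_of_mem hvV
    have hnn' : ∀ y ∈ V.erase v, 0 ≤ ℓ y u := fun y hy => hnn y (Finset.mem_of_mem_erase hy)
    rw [← Finset.insert_erase hvV, eulerSum_insert ℓ U L (V.notMem_erase v),
      ih _ hcv _ ⟨w, hw, hw0⟩ hnn' _ (hU.inter (isOpen_pos _)) (hc.inter (convex_pos _)) ?_ L hu
        rfl,
      ih _ hcv _ ⟨w, hw, hw0⟩ hnn' U hU hc hinv (L ⊓ LinearMap.ker (ℓ v))
        ⟨hu, hv0⟩ rfl, add_zero]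
    rintro f ⟨h1, h2⟩ t
    refine ⟨hinv f h1 t, ?_⟩
    simpa [hv0] using h2
  · push Not at h0
    exact eulerSum_eq_zero_of_forall_pos ℓ V (hV.imp fun v hv => hv.1)
      (fun v hv => lt_of_le_of_ne (hnn v hv) (h0 v hv).symm) U hU hc hinv L hu

end Euler

/-! ### From face numbers to `h`-numbers and back -/

section HVector

/-- The `h`-numbers of a sequence `p` of face numbers: the coefficients of the polynomial
`∑ p k x ^ k` with respect to the basis `x ^ i (1 + x) ^ (D - i)`. -/
def hvec (D : ℕ) (p : ℕ → ℤ) (i : ℕ) : ℤ :=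
  ∑ k ∈ Finset.range (i + 1), (-1) ^ (i - k) * ((D - k).choose (i - k) : ℤ) * p k

lemma sum_hvec (D : ℕ) (p : ℕ → ℤ) (x : ℝ) :
    ∑ k ∈ Finset.range (D + 1), (p k : ℝ) * x ^ k =
      ∑ i ∈ Finset.range (D + 1), (hvec D p i : ℝ) * (x ^ i * (1 + x) ^ (D - i)) := by
  let F : ℕ → ℕ → ℝ := fun k j => (p k : ℝ) * x ^ k *
    ((-x) ^ j * (1 + x) ^ (D - k - j) * ((D - k).choose j : ℝ))
  have h1 : ∀ i ∈ Finset.range (D + 1), (hvec D p i : ℝ) * (x ^ i * (1 + x) ^ (D - i)) =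
      ∑ k ∈ Finset.range (i + 1), F k (i - k) := by
    intro i _
    rw [hvec]
    push_cast
    rw [Finset.sum_mul]
    refine Finset.sum_congr rfl fun k hk => ?_
    obtain ⟨j, rfl⟩ := Nat.exists_eq_add_of_le (Nat.lt_succ_iff.1 (Finset.mem_range.1 hk))
    simp only [F, Nat.add_sub_cancel_left, Nat.sub_sub]
    rw [neg_pow x j, pow_add]
    ring
  rw [Finset.sum_congr rfl h1, Finset.sum_range_diag_flip (D + 1) F]
  refine Finset.sum_congr rfl fun k hk => ?_
  have hk' : k ≤ D := Nat.lt_succ_iff.1 (Finset.mem_range.1 hk)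
  simp only [F]
  rw [← Finset.mul_sum, show D + 1 - k = D - k + 1 by omega, ← add_pow]
  simp

/-- The polynomials `x ^ i (1 + x) ^ (D - i)`, `i ≤ D`, are linearly independent. -/
lemma eq_of_sum_eq {D : ℕ} {a b : ℕ → ℝ}
    (h : ∀ x : ℝ, ∑ i ∈ Finset.range (D + 1), a i * (x ^ i * (1 + x) ^ (D - i)) =
      ∑ i ∈ Finset.range (D + 1), b i * (x ^ i * (1 + x) ^ (D - i))) {i : ℕ} (hi : i ≤ D) :
    a i = b i := by
  have key : ∀ (c : ℕ → ℝ) (t : ℝ), t ≠ 1 → (1 - t) ^ D *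
      ∑ i ∈ Finset.range (D + 1), c i * ((t / (1 - t)) ^ i * (1 + t / (1 - t)) ^ (D - i)) =
      (∑ i ∈ Finset.range (D + 1), Polynomial.monomial i (c i)).eval t := by
    intro c t ht
    have ht' : 1 - t ≠ 0 := sub_ne_zero.2 ht.symm
    rw [Polynomial.eval_finsetSum, Finset.mul_sum]
    refine Finset.sum_congr rfl fun j hj => ?_
    have hj' : j ≤ D := Nat.lt_succ_iff.1 (Finset.mem_range.1 hj)
    have e1 : 1 + t / (1 - t) = 1 / (1 - t) := by field_simp; ring
    rw [e1, Polynomial.eval_monomial, div_pow, div_pow, one_pow]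
    obtain ⟨m, rfl⟩ := Nat.exists_eq_add_of_le hj'
    rw [Nat.add_sub_cancel_left, pow_add]
    field_simp
  have hpoly : (∑ i ∈ Finset.range (D + 1), Polynomial.monomial i (a i)) =
      ∑ i ∈ Finset.range (D + 1), Polynomial.monomial i (b i) := by
    refine Polynomial.eq_of_infinite_eval_eq _ _ (Set.Infinite.mono (s := {1}ᶜ) ?_ ?_)
    · intro t ht
      have ht : t ≠ 1 := ht
      change _ = _
      rw [← key a t ht, ← key b t ht, h]
    · exact (Set.finite_singleton 1).infinite_compl
  have := congrArg (fun p => Polynomial.coeff p i) hpoly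
  simpa [Polynomial.finsetSum_coeff, Polynomial.coeff_monomial, Nat.lt_succ_iff.2 hi] using this

lemma binom_natCast_sub (m k i : ℕ) :
    binom m ((k : ℤ) - i) = if i ≤ k then (m.choose (k - i) : ℤ) else 0 := by
  unfold binom
  by_cases h : i ≤ k
  · rw [if_pos (by omega), if_pos h]; congr 2; omega
  · rw [if_neg (by omega), if_neg h]

/-- The face numbers in terms of the `h`-numbers, inverting the definition of `hvec`. -/
lemma eq_sum_binom_hvec (D : ℕ) (p : ℕ → ℤ) {k : ℕ} (hk : k ≤ D) :
    p k = ∑ i ∈ Finset.range (D + 1), binom (D - i) ((k : ℤ) - i) * hvec D p i := by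
  have hpoly : (∑ k ∈ Finset.range (D + 1), Polynomial.monomial k (p k : ℝ)) =
      ∑ i ∈ Finset.range (D + 1), Polynomial.C (hvec D p i : ℝ) *
        (Polynomial.X ^ i * (1 + Polynomial.X) ^ (D - i)) := by
    refine Polynomial.funext fun x => ?_
    simp only [Polynomial.eval_finsetSum, Polynomial.eval_monomial, Polynomial.eval_mul,
      Polynomial.eval_C, Polynomial.eval_pow, Polynomial.eval_X, Polynomial.eval_add,
      Polynomial.eval_one]
    exact sum_hvec D p x
  have h1 := congrArg (fun p => Polynomial.coeff p k) hpoly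
  simp only [Polynomial.finsetSum_coeff, Polynomial.coeff_monomial, Polynomial.coeff_C_mul,
    Polynomial.coeff_X_pow_mul', Polynomial.coeff_one_add_X_pow, Finset.sum_ite_eq',
    Finset.mem_range, Nat.lt_succ_iff, hk, if_true] at h1
  have h2 : (p k : ℝ) = ((∑ i ∈ Finset.range (D + 1),
      binom (D - i) ((k : ℤ) - i) * hvec D p i : ℤ) : ℝ) := by
    rw [h1]
    push_cast
    refine Finset.sum_congr rfl fun i _ => ?_
    rw [binom_natCast_sub]
    split_ifs <;> push_cast <;> ring
  exact_mod_cast h2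

/-- Extension of a sequence, supported on `0, …, D`, to the integers by zero. -/
def extendZero (D : ℕ) (h : ℕ → ℤ) (k : ℤ) : ℤ := if 0 ≤ k ∧ k ≤ D then h k.toNat else 0

/-- Multiplication by `1 = ((1 + x) - x) ^ m` turns `h`-numbers into their backward differences. -/
lemma sum_backward_difference (D m : ℕ) (h : ℕ → ℤ) (x : ℝ) :
    ∑ i ∈ Finset.range (D + 1), (h i : ℝ) * (x ^ i * (1 + x) ^ (D - i)) =
      ∑ k ∈ Finset.range (D + m + 1), ((∑ j ∈ Finset.range (m + 1),
        (-1) ^ j * (m.choose j : ℤ) * extendZero D h ((k : ℤ) - j) : ℤ) : ℝ) *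
          (x ^ k * (1 + x) ^ (D + m - k)) := by
  have shift : ∀ j ∈ Finset.range (m + 1), ∑ k ∈ Finset.range (D + m + 1),
      (extendZero D h ((k : ℤ) - j) : ℝ) * (x ^ k * (1 + x) ^ (D + m - k)) =
      ∑ i ∈ Finset.range (D + 1), (h i : ℝ) * (x ^ (i + j) * (1 + x) ^ (D + m - (i + j))) := by
    intro j hj
    have hj' : j ≤ m := Nat.lt_succ_iff.1 (Finset.mem_range.1 hj)
    symm
    refine Finset.sum_of_injOn (fun i => i + j) (fun a _ b _ h => by simpa using h) ?_ ?_ ?_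
    · intro i hi
      simp only [Finset.coe_range, Set.mem_Iio] at hi ⊢
      omega
    · intro k _ hk
      simp only [Finset.coe_range, Set.mem_image, Set.mem_Iio, not_exists, not_and] at hk
      rw [extendZero, if_neg]
      · simp
      · rintro ⟨h1, h2⟩
        exact hk (k - j) (by omega) (by omega)
    · intro i hi
      have hi' : i ≤ D := Nat.lt_succ_iff.1 (Finset.mem_range.1 hi)
      have : ((i + j : ℕ) : ℤ) - j = i := by push_cast; ring
      simp only [this, extendZero]
      rw [if_pos (by omega)]
      simp
  have h1 : ∀ k ∈ Finset.range (D + m + 1), ((∑ j ∈ Finset.range (m + 1),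
        (-1) ^ j * (m.choose j : ℤ) * extendZero D h ((k : ℤ) - j) : ℤ) : ℝ) *
          (x ^ k * (1 + x) ^ (D + m - k)) = ∑ j ∈ Finset.range (m + 1),
        (-1) ^ j * (m.choose j : ℝ) * ((extendZero D h ((k : ℤ) - j) : ℝ) *
          (x ^ k * (1 + x) ^ (D + m - k))) := by
    intro k _
    push_cast
    rw [Finset.sum_mul]
    exact Finset.sum_congr rfl fun j _ => by ring
  rw [Finset.sum_congr rfl h1, Finset.sum_comm]
  simp_rw [← Finset.mul_sum]
  have e := Finset.sum_congr rfl fun j hj =>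
    congrArg (fun t => (-1) ^ j * (m.choose j : ℝ) * t) (shift j hj)
  rw [e]
  simp_rw [Finset.mul_sum]
  rw [Finset.sum_comm]
  refine Finset.sum_congr rfl fun i hi => ?_
  have hi' : i ≤ D := Nat.lt_succ_iff.1 (Finset.mem_range.1 hi)
  have h2 : ((-x) + (1 + x)) ^ m = 1 := by simp
  rw [add_pow] at h2
  refine (mul_one _).symm.trans ((congrArg (_ * ·) h2.symm).trans ?_)
  rw [Finset.mul_sum]
  refine Finset.sum_congr rfl fun j hj => ?_
  have hj' : j ≤ m := Nat.lt_succ_iff.1 (Finset.mem_range.1 hj)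
  rw [show D + m - (i + j) = (D - i) + (m - j) by omega, pow_add, pow_add, neg_pow x j]
  ring

end HVector

/-! ### The bounds, expressed through `h`-numbers -/

section BoundsAlgebra

variable {r : ℕ}

/-- The number of `k`-subsets of the union of sets with `n i` elements, `i ∈ R`, that meet all
these sets, by inclusion-exclusion. -/
def spanCount (n : Fin r → ℕ) (R : Finset (Fin r)) (k : ℕ) : ℤ :=
  ∑ S ∈ R.powerset with S.Nonempty, (-1) ^ (R.card - S.card) * ((∑ i ∈ S, n i).choose k : ℤ)

/-- Vandermonde's identity, with the upper index `N - D - 1 + i` split as `N + (i - D - 1)`. -/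
lemma choose_sub_eq_sum (D N i : ℕ) (hi : i ≤ D) :
    Ring.choose ((N : ℤ) - D - 1 + i) i =
      ∑ k ∈ Finset.range (i + 1),
        (-1) ^ (i - k) * ((D - k).choose (i - k) : ℤ) * (N.choose k : ℤ) := by
  have h1 : (N : ℤ) - D - 1 + i = (N : ℤ) + (-((D - i + 1 : ℕ) : ℤ)) := by
    push_cast [Nat.cast_sub hi]; ring
  rw [h1, Ring.add_choose_eq i (Commute.all _ _), Finset.Nat.sum_antidiagonal_eq_sum_range_succ_mk]
  refine Finset.sum_congr rfl fun k hk => ?_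
  have hk' : k ≤ i := Nat.lt_succ_iff.1 (Finset.mem_range.1 hk)
  rw [Ring.choose_natCast, Ring.choose_neg]
  have h2 : ((D - i + 1 : ℕ) : ℤ) + ((i - k : ℕ) : ℤ) - 1 = ((D - k : ℕ) : ℤ) := by omega
  rw [h2, Ring.choose_natCast, Int.negOnePow_def]
  simp only [zpow_natCast, Units.smul_def, Units.val_pow_eq_pow_val, Units.val_neg, Units.val_one,
    smul_eq_mul]
  ring

/-- In the lower half the bounds are the `h`-numbers of a system of sets in which all spanning
subsets are faces. -/
lemma hLower_eq_hvec {d : ℕ} (hd : 1 ≤ d) (n : Fin r → ℕ) (R : Finset (Fin r)) {i : ℕ}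
    (hi : i ≤ d + R.card - 1) :
    hLower d n R i = hvec (d + R.card - 1) (spanCount n R) i := by
  unfold hLower hvec spanCount
  simp_rw [Finset.mul_sum]
  rw [Finset.sum_comm]
  refine Finset.sum_congr rfl fun S _ => ?_
  have h1 : (∑ i ∈ S, (n i : ℤ)) - d - R.card + i =
      ((∑ i ∈ S, n i : ℕ) : ℤ) - (d + R.card - 1 : ℕ) - 1 + i := by
    push_cast [show 1 ≤ d + R.card by omega]; ring
  rw [h1, choose_sub_eq_sum _ _ _ hi, Finset.mul_sum]
  exact Finset.sum_congr rfl fun k _ => by ring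

/-- The bound for the face numbers is obtained from the one for the `h`-numbers by the usual
formula. -/
lemma faceBound_eq_sum {d : ℕ} (hd : 1 ≤ d) (n : Fin r → ℕ) (R : Finset (Fin r))
    (hR : R.Nonempty) (k : ℕ) :
    faceBound d n R k = ∑ i ∈ Finset.range (d + R.card - 1 + 1),
      binom (d + R.card - 1 - i) ((k : ℤ) - i) * hBound d n R i := by
  have hc : 1 ≤ R.card := hR.card_pos
  obtain ⟨D, hD⟩ : ∃ D, D = d + R.card - 1 := ⟨_, rfl⟩
  have hDz : (d : ℤ) + R.card - 1 = D := by omega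
  have hlow : ∀ i : ℕ, 2 * i ≤ D → hBound d n R i = hLower d n R i := by
    intro i hi
    rw [hBound, if_neg (by omega), if_pos (by omega)]
    simp
  have hhigh : ∀ i : ℕ, 2 * i < D → hBound d n R ((D - i : ℕ) : ℤ) = hLower d n R i +
      ∑ S ∈ R.ssubsets with S.Nonempty, gBound d n (R.card - S.card) S i := by
    intro i hi
    rw [hBound, if_neg (by omega), if_neg (by omega), hDz]
    have e1 : (D : ℤ) - ((D - i : ℕ) : ℤ) = i := by omega
    simp only [e1, Int.toNat_natCast]
    congr 1
    rw [Finset.sum_filter, ← Finset.sum_attach R.ssubsets]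
    rfl
  have hsplit : ∀ F : ℕ → ℤ, ∑ i ∈ Finset.range (D + 1), F i =
      ∑ i ∈ Finset.range (D / 2 + 1), F i + ∑ i ∈ Finset.range ((D - 1) / 2 + 1), F (D - i) := by
    intro F
    have hrw : D + 1 = (D / 2 + 1) + ((D - 1) / 2 + 1) := by omega
    rw [hrw, Finset.sum_range_add]
    congr 1
    rw [← Finset.sum_range_reflect]
    refine Finset.sum_congr rfl fun i hi => ?_
    rw [Finset.mem_range] at hi
    congr 1
    omega
  rw [← hD, hsplit]
  unfold faceBound cyclicFaces
  rw [← hD, show d + R.card - 2 = D - 1 by omega]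
  have hbin : ∀ i ∈ Finset.range ((D - 1) / 2 + 1),
      binom (D - (D - i)) ((k : ℤ) - ((D - i : ℕ) : ℤ)) * hBound d n R ((D - i : ℕ) : ℤ) =
      binom i ((k : ℤ) - D + i) * hLower d n R i +
        binom i ((k : ℤ) - d - R.card + 1 + i) *
          ∑ S ∈ R.ssubsets with S.Nonempty, gBound d n (R.card - S.card) S i := by
    intro i hi
    rw [Finset.mem_range] at hi
    have e1 : D - (D - i) = i := by omega
    have e2 : (k : ℤ) - ((D - i : ℕ) : ℤ) = (k : ℤ) - D + i := by omega
    have e3 : (k : ℤ) - d - R.card + 1 + i = (k : ℤ) - D + i := by omega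
    rw [hhigh i (by omega), e1, e2, e3]
    ring
  rw [Finset.sum_congr rfl hbin, Finset.sum_add_distrib, ← add_assoc]
  congr 1
  -- the contributions of the lower half
  have hhalf : ∀ F G : ℕ → ℤ, ∑ i ∈ Finset.range (D / 2 + 1), F i +
      ∑ i ∈ Finset.range ((D - 1) / 2 + 1), G i =
      ∑ i ∈ Finset.range (D / 2 + 1), (if 2 * i = D then F i else F i + G i) := by
    intro F G
    have hG : ∑ i ∈ Finset.range ((D - 1) / 2 + 1), G i =
        ∑ i ∈ Finset.range (D / 2 + 1), if 2 * i = D then 0 else G i := by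
      rcases Nat.even_or_odd' D with ⟨m, hm | hm⟩
      · have e1 : D / 2 + 1 = (D - 1) / 2 + 1 + 1 := by omega
        rw [e1, Finset.sum_range_succ _ ((D - 1) / 2 + 1), if_pos (by omega), add_zero]
        refine Finset.sum_congr rfl fun i hi => ?_
        rw [Finset.mem_range] at hi
        rw [if_neg (by omega)]
      · have e1 : D / 2 + 1 = (D - 1) / 2 + 1 := by omega
        rw [e1]
        refine Finset.sum_congr rfl fun i hi => ?_
        rw [if_neg (by omega)]
    rw [hG, ← Finset.sum_add_distrib]
    refine Finset.sum_congr rfl fun i _ => ?_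
    split_ifs <;> ring
  rw [hhalf]
  simp_rw [Finset.mul_sum]
  rw [Finset.sum_comm]
  refine Finset.sum_congr rfl fun i hi => ?_
  rw [Finset.mem_range] at hi
  have e4 : hLower d n R i = ∑ S ∈ R.powerset with S.Nonempty, (-1) ^ (R.card - S.card) *
      Ring.choose ((∑ i ∈ S, (n i : ℤ)) - D - 1 + i) i := by
    unfold hLower
    refine Finset.sum_congr rfl fun S _ => ?_
    rw [← hDz]
    congr 2
    ring
  rw [hlow i (by omega)]
  have e5 : (if 2 * i = D then binom (D - i) ((k : ℤ) - i) * hLower d n R i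
      else binom (D - i) ((k : ℤ) - i) * hLower d n R i +
        binom i ((k : ℤ) - D + i) * hLower d n R i) =
      (if 2 * i = D then binom (D - i) ((k : ℤ) - i)
        else binom (D - i) ((k : ℤ) - i) + binom i ((k : ℤ) - D + i)) * hLower d n R i := by
    split_ifs <;> ring
  rw [e5, e4, Finset.mul_sum]
  exact Finset.sum_congr rfl fun S _ => by ring

/-- The bounds are determined by two properties, which the numbers of mixed faces of the
construction have: they count all spanning subsets in the lower half, and they satisfy the
Dehn-Sommerville equations, which express the upper half of the `h`-numbers. -/
lemma eq_faceBound {d : ℕ} (hd : 1 ≤ d) (n : Fin r → ℕ) (p : Finset (Fin r) → ℕ → ℤ)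
    (hlow : ∀ R : Finset (Fin r), R.Nonempty → ∀ k, 2 * k ≤ d + R.card - 1 →
      p R k = spanCount n R k)
    (hDS : ∀ R : Finset (Fin r), R.Nonempty → ∀ x : ℝ,
      ∑ k ∈ Finset.range (d + R.card - 1 + 1), (p R k : ℝ) * (-(1 + x)) ^ k =
        (-1) ^ (d + R.card - 1) * ∑ S ∈ R.powerset with S.Nonempty,
          ∑ k ∈ Finset.range (d + S.card - 1 + 1), (p S k : ℝ) * x ^ k)
    (R : Finset (Fin r)) (hR : R.Nonempty) {k : ℕ} (hk : k ≤ d + R.card - 1) :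
    p R k = faceBound d n R k := by
  set h : Finset (Fin r) → ℕ → ℤ := fun R => hvec (d + R.card - 1) (p R) with hh
  set hz : Finset (Fin r) → ℤ → ℤ := fun R => extendZero (d + R.card - 1) (h R) with hhz
  -- the Dehn-Sommerville equations for the `h`-numbers
  have hsym : ∀ R : Finset (Fin r), R.Nonempty → ∀ k, k ≤ d + R.card - 1 →
      h R (d + R.card - 1 - k) = ∑ S ∈ R.powerset with S.Nonempty,
        ∑ j ∈ Finset.range (R.card - S.card + 1),
          (-1) ^ j * ((R.card - S.card).choose j : ℤ) * hz S ((k : ℤ) - j) := by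
    intro R hR k hk
    set D := d + R.card - 1 with hD
    have hcast : ((h R (D - k) : ℤ) : ℝ) = ((∑ S ∈ R.powerset with S.Nonempty,
        ∑ j ∈ Finset.range (R.card - S.card + 1),
          (-1) ^ j * ((R.card - S.card).choose j : ℤ) * hz S ((k : ℤ) - j) : ℤ) : ℝ) := by
      refine eq_of_sum_eq (D := D) (a := fun k => ((h R (D - k) : ℤ) : ℝ))
        (b := fun k => ((∑ S ∈ R.powerset with S.Nonempty,
          ∑ j ∈ Finset.range (R.card - S.card + 1),
            (-1) ^ j * ((R.card - S.card).choose j : ℤ) * hz S ((k : ℤ) - j) : ℤ) : ℝ))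
        (fun x => ?_) hk
      have e1 := hDS R hR x
      rw [sum_hvec] at e1
      have e2 : ∑ i ∈ Finset.range (D + 1), (hvec D (p R) i : ℝ) *
          ((-(1 + x)) ^ i * (1 + -(1 + x)) ^ (D - i)) =
          (-1) ^ D * ∑ i ∈ Finset.range (D + 1), ((h R (D - i) : ℤ) : ℝ) *
            (x ^ i * (1 + x) ^ (D - i)) := by
        rw [← Finset.sum_range_reflect, Finset.mul_sum]
        refine Finset.sum_congr rfl fun i hi => ?_
        have hi' : i ≤ D := Nat.lt_succ_iff.1 (Finset.mem_range.1 hi)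
        rw [show D + 1 - 1 - i = D - i by omega, show D - (D - i) = i by omega,
          show 1 + -(1 + x) = -x by ring, neg_pow (1 + x), neg_pow x]
        have e3 : (-1 : ℝ) ^ D = (-1) ^ (D - i) * (-1) ^ i := by
          rw [← pow_add]; congr 1; omega
        rw [e3]
        ring
      rw [e2] at e1
      have e4 := mul_left_cancel₀ (pow_ne_zero D (by norm_num : (-1 : ℝ) ≠ 0)) e1
      rw [e4]
      push_cast
      simp_rw [Finset.sum_mul]
      rw [Finset.sum_comm]
      refine Finset.sum_congr rfl fun S hS => ?_
      rw [Finset.mem_filter, Finset.mem_powerset] at hS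
      have hSR := Finset.card_le_card hS.1
      have hS1 := hS.2.card_pos
      rw [sum_hvec, sum_backward_difference _ (R.card - S.card)]
      have hDD : d + S.card - 1 + (R.card - S.card) = D := by omega
      rw [hDD]
      refine Finset.sum_congr rfl fun k _ => ?_
      push_cast
      rw [Finset.sum_mul]
    exact_mod_cast hcast
  have hlow' : ∀ R : Finset (Fin r), R.Nonempty → ∀ i, 2 * i ≤ d + R.card - 1 →
      h R i = hLower d n R i := by
    intro R hR i hi
    rw [hLower_eq_hvec hd n R (by omega)]
    simp only [hh, hvec]
    refine Finset.sum_congr rfl fun k hk => ?_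
    rw [hlow R hR k (by rw [Finset.mem_range] at hk; omega)]
  have main : ∀ m, ∀ R : Finset (Fin r), R.card = m → R.Nonempty → ∀ k : ℤ,
      hBound d n R k = hz R k := by
    intro m
    induction m using Nat.strong_induction_on with
    | _ m ih =>
      intro R hRm hR k
      have hc := hR.card_pos
      rw [hBound]
      by_cases h1 : k < 0 ∨ (d : ℤ) + R.card - 1 < k
      · rw [if_pos h1]
        simp only [hhz, extendZero]
        rw [if_neg (by omega)]
      rw [if_neg h1]
      have hzk : hz R k = h R k.toNat := by
        simp only [hhz, extendZero]
        rw [if_pos (by omega)]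
      rw [hzk]
      by_cases h2 : 2 * k ≤ (d : ℤ) + R.card - 1
      · rw [if_pos h2, hlow' R hR _ (by omega)]
      rw [if_neg h2]
      set l := d + R.card - 1 - k.toNat with hl
      have hkl : k.toNat = d + R.card - 1 - l := by omega
      have e0 : (d : ℤ) + R.card - 1 - k = l := by omega
      rw [hkl, hsym R hR l (by omega), e0]
      have hins : (R.powerset.filter Finset.Nonempty) =
          insert R (R.ssubsets.filter Finset.Nonempty) := by
        ext S
        simp only [Finset.mem_filter, Finset.mem_powerset, Finset.mem_insert, Finset.mem_ssubsets]
        constructor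
        · rintro ⟨h3, h4⟩
          rcases h3.eq_or_ssubset with rfl | h5
          · exact Or.inl rfl
          · exact Or.inr ⟨h5, h4⟩
        · rintro (rfl | ⟨h3, h4⟩)
          · exact ⟨subset_rfl, hR⟩
          · exact ⟨h3.subset, h4⟩
      rw [hins, Finset.sum_insert (by simp)]
      congr 1
      · simp only [Nat.sub_self, zero_add, Finset.sum_range_one, pow_zero, Nat.choose_self,
          Nat.cast_one, mul_one, one_mul, Nat.cast_zero, sub_zero, hhz, extendZero]
        rw [if_pos (by omega)]
        simp only [Int.toNat_natCast]
        exact (hlow' R hR l (by omega)).symm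
      · rw [Finset.sum_filter, ← Finset.sum_attach R.ssubsets]
        refine Finset.sum_congr rfl fun S _ => ?_
        by_cases hS : S.1.Nonempty
        · rw [if_pos hS, if_pos hS]
          refine Finset.sum_congr rfl fun j _ => ?_
          rw [ih S.1.card (hRm ▸ Finset.card_lt_card (Finset.mem_ssubsets.1 S.2)) S.1 rfl hS]
        · rw [if_neg hS, if_neg hS]
  rw [faceBound_eq_sum hd n R hR, eq_sum_binom_hvec (d + R.card - 1) (p R) hk]
  refine Finset.sum_congr rfl fun i hi => ?_
  have hi' : i ≤ d + R.card - 1 := Nat.lt_succ_iff.1 (Finset.mem_range.1 hi)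
  rw [main _ R rfl hR]
  simp only [hhz, extendZero]
  rw [if_pos (by omega)]
  simp [hh]

end BoundsAlgebra

/-! ### Face sets -/

section FaceSets

set_option linter.unusedSectionVars false

variable {W : Type*} [NormedAddCommGroup W] [NormedSpace ℝ W] [FiniteDimensional ℝ W]
variable {ι : Type*} [DecidableEq ι]

/-- The functionals `ℓ a`, `a ∈ Z`, are linearly independent; stated through a dual family. -/
def Separated (ℓ : ι → W →ₗ[ℝ] ℝ) (Z : Finset ι) : Prop :=
  ∀ a ∈ Z, ∃ g, ℓ a g = 1 ∧ ∀ b ∈ Z, b ≠ a → ℓ b g = 0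

/-- `Z` consists of the `v ∈ V` at which a functional that is non-negative on `V` vanishes. Here
functionals are elements `f : W`, and `ℓ v f` is the value of `f` at `v`. -/
def IsFaceSet (ℓ : ι → W →ₗ[ℝ] ℝ) (V Z : Finset ι) : Prop :=
  Z ⊆ V ∧ ∃ f, (∀ v ∈ Z, ℓ v f = 0) ∧ ∀ v ∈ V, v ∉ Z → 0 < ℓ v f

variable {ℓ : ι → W →ₗ[ℝ] ℝ}

lemma Separated.mono {Z A : Finset ι} (h : Separated ℓ Z) (hA : A ⊆ Z) : Separated ℓ A := by
  intro a ha
  obtain ⟨g, hg, hg'⟩ := h a (hA ha)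
  exact ⟨g, hg, fun b hb => hg' b (hA hb)⟩

lemma Separated.exists_eq {Z : Finset ι} (h : Separated ℓ Z) (c : ι → ℝ) :
    ∃ g, ∀ a ∈ Z, ℓ a g = c a := by
  have h' : ∀ a, ∃ g, a ∈ Z → ℓ a g = 1 ∧ ∀ b ∈ Z, b ≠ a → ℓ b g = 0 := by
    intro a
    by_cases ha : a ∈ Z
    · obtain ⟨g, hg⟩ := h a ha
      exact ⟨g, fun _ => hg⟩
    · exact ⟨0, fun h => absurd h ha⟩
  choose g hg using h'
  refine ⟨∑ a ∈ Z, c a • g a, fun a ha => ?_⟩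
  rw [map_sum, Finset.sum_eq_single_of_mem a ha]
  · simp [(hg a ha).1]
  · intro b hb hba
    simp [(hg b hb).2 a ha hba.symm]

lemma Separated.finrank_add {Z : Finset ι} (h : Separated ℓ Z) :
    Module.finrank ℝ (zeroSpace ℓ Z) + Z.card = Module.finrank ℝ W := by
  let T : W →ₗ[ℝ] (Z → ℝ) := LinearMap.pi fun z => ℓ z
  have hs : LinearMap.range T = ⊤ := by
    rw [LinearMap.range_eq_top]
    intro c
    obtain ⟨g, hg⟩ := h.exists_eq fun a => if ha : a ∈ Z then c ⟨a, ha⟩ else 0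
    refine ⟨g, funext fun z => ?_⟩
    have := hg z z.2
    simpa [T] using this
  have hk : LinearMap.ker T = zeroSpace ℓ Z := by
    ext f
    rw [mem_zeroSpace, LinearMap.mem_ker]
    constructor
    · intro hf v hv; exact congrFun hf ⟨v, hv⟩
    · intro hf; exact funext fun z => hf z z.2
  have h1 := LinearMap.finrank_range_add_finrank_ker T
  rw [hs, hk, finrank_top, Module.finrank_fintype_fun_eq_card, Fintype.card_coe] at h1
  omega

lemma exists_forall_pos_mul_add (s : Finset ι) (a b : ι → ℝ) (ha : ∀ v ∈ s, 0 < a v) :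
    ∃ N : ℝ, ∀ v ∈ s, 0 < N * a v + b v := by
  have h : ∀ᶠ N : ℝ in Filter.atTop, ∀ v ∈ s, 0 < N * a v + b v := by
    rw [Filter.eventually_all_finset]
    intro v hv
    filter_upwards [Filter.eventually_gt_atTop (-b v / a v)] with N hN
    rw [div_lt_iff₀ (ha v hv)] at hN
    linarith
  exact h.exists

/-- A face with independent vertices is a simplex, all of whose faces are faces of the polytope: a
large multiple of the functional of the face dominates any functional with prescribed values on its
vertices. -/
lemma IsFaceSet.subset_of_separated {V Z A : Finset ι} (h : IsFaceSet ℓ V Z)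
    (hs : Separated ℓ Z) (hA : A ⊆ Z) : IsFaceSet ℓ V A := by
  obtain ⟨hZV, f, hf0, hf⟩ := h
  obtain ⟨g, hg⟩ := hs.exists_eq fun a => if a ∈ A then 0 else 1
  obtain ⟨N, hN⟩ := exists_forall_pos_mul_add (V \ Z) (fun v => ℓ v f) (fun v => ℓ v g)
    fun v hv => hf v (Finset.mem_sdiff.1 hv).1 (Finset.mem_sdiff.1 hv).2
  refine ⟨hA.trans hZV, N • f + g, fun v hv => ?_, fun v hv hvA => ?_⟩
  · simp [hf0 v (hA hv), hg v (hA hv), hv]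
  · by_cases hvZ : v ∈ Z
    · simp [hf0 v hvZ, hg v hvZ, hvA]
    · simpa using hN v (Finset.mem_sdiff.2 ⟨hv, hvZ⟩)

open Classical in
/-- Euler's relation for the faces of a polytope that contain a given face. -/
lemma sum_faceSets_eq_zero {V A : Finset ι} (hA : IsFaceSet ℓ V A) (hne : A ≠ V) :
    ∑ Z ∈ V.powerset with A ⊆ Z ∧ IsFaceSet ℓ V Z,
      (-1 : ℤ) ^ Module.finrank ℝ (zeroSpace ℓ Z) = 0 := by
  obtain ⟨hAV, u, hu0, hu⟩ := hA
  obtain ⟨w, hwV, hwA⟩ : ∃ w ∈ V, w ∉ A := by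
    by_contra hcon
    push Not at hcon
    exact hne (hAV.antisymm hcon)
  have key := eulerSum_eq_zero ℓ (u := u) (V \ A) ⟨w, Finset.mem_sdiff.2 ⟨hwV, hwA⟩, hu w hwV hwA⟩
    (fun v hv => (hu v (Finset.mem_sdiff.1 hv).1 (Finset.mem_sdiff.1 hv).2).le) Set.univ isOpen_univ
    convex_univ (fun _ _ _ => Set.mem_univ _) (zeroSpace ℓ A) (mem_zeroSpace.2 hu0)
  rw [← key, eulerSum, ← Finset.filter_filter, Finset.sum_filter]
  refine Finset.sum_nbij' (fun Z => Z \ A) (fun Z => A ∪ Z) ?_ ?_ ?_ ?_ ?_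
  · intro Z hZ
    simp only [Finset.mem_filter, Finset.mem_powerset] at hZ ⊢
    exact Finset.sdiff_subset_sdiff hZ.1 subset_rfl
  · intro Z hZ
    simp only [Finset.mem_filter, Finset.mem_powerset] at hZ ⊢
    exact ⟨Finset.union_subset hAV (hZ.trans Finset.sdiff_subset), Finset.subset_union_left⟩
  · intro Z hZ
    simp only [Finset.mem_filter, Finset.mem_powerset] at hZ
    exact Finset.union_sdiff_of_subset hZ.2
  · intro Z hZ
    rw [Finset.mem_powerset] at hZ
    ext v
    simp only [Finset.mem_sdiff, Finset.mem_union]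
    constructor
    · rintro ⟨h1 | h1, h2⟩
      · exact absurd h1 h2
      · exact h1
    · intro h1; exact ⟨Or.inr h1, (Finset.mem_sdiff.1 (hZ h1)).2⟩
  · intro Z hZ
    simp only [Finset.mem_filter, Finset.mem_powerset] at hZ
    have e1 : zeroSpace ℓ A ⊓ zeroSpace ℓ (Z \ A) = zeroSpace ℓ Z := by
      ext f
      simp only [Submodule.mem_inf, mem_zeroSpace, Finset.mem_sdiff]
      constructor
      · rintro ⟨h1, h2⟩ v hv
        by_cases hvA : v ∈ A
        · exact h1 v hvA
        · exact h2 v ⟨hv, hvA⟩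
      · intro h; exact ⟨fun v hv => h v (hZ.2 hv), fun v hv => h v hv.1⟩
    rw [e1, cellChar]
    congr 1
    refine propext ⟨?_, ?_⟩
    · rintro ⟨_, f, hf0, hf⟩
      refine ⟨f, ⟨Set.mem_univ _, fun v hv => ?_⟩, mem_zeroSpace.2 hf0⟩
      simp only [Finset.mem_sdiff, not_and, not_not] at hv
      exact hf v hv.1.1 fun hvZ => hv.1.2 (hv.2 hvZ)
    · rintro ⟨f, ⟨_, hf⟩, hf0⟩
      refine ⟨hZ.1, f, mem_zeroSpace.1 hf0, fun v hv hvZ => hf v ?_⟩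
      simp only [Finset.mem_sdiff, not_and, not_not]
      exact ⟨⟨hv, fun hvA => hvZ (hZ.2 hvA)⟩, fun h => absurd h hvZ⟩

/-- Möbius inversion on intervals, for the zero function. -/
lemma eq_zero_of_sum_Icc_eq_zero {α : Type*} [DecidableEq α] {S : Finset α} (x : Finset α → ℤ)
    (h : ∀ R, S ⊆ R → ∑ T ∈ R.powerset with S ⊆ T, x T = 0) :
    ∀ R, S ⊆ R → x R = 0 := by
  intro R
  induction hn : R.card using Nat.strong_induction_on generalizing R with
  | _ n ih =>
    intro hR
    have h1 := h R hR
    rw [Finset.sum_eq_single_of_mem R] at h1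
    · exact h1
    · simp [hR]
    · intro T hT hne
      simp only [Finset.mem_filter, Finset.mem_powerset] at hT
      exact ih T.card (hn ▸ Finset.card_lt_card (hT.1.ssubset_of_ne hne)) T rfl hT.2

end FaceSets

/-! ### Dehn-Sommerville equations for mixed faces -/

section Mixed

variable {r d : ℕ} {n : Fin r → ℕ}

/-- The index set of all vertices of the polytopes `P_i`; the vertex `⟨i, j⟩` has color `i`. -/
abbrev Vertex (n : Fin r → ℕ) := Σ i, Fin (n i)

/-- The vertices with colors in `R`. -/
def vset (n : Fin r → ℕ) (R : Finset (Fin r)) : Finset (Vertex n) :=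
  R.sigma fun _ => Finset.univ

/-- The colors that occur in `Z`. -/
def colors (Z : Finset (Vertex n)) : Finset (Fin r) := Z.image Sigma.fst

lemma mem_vset {R : Finset (Fin r)} {v : Vertex n} : v ∈ vset n R ↔ v.1 ∈ R := by
  simp [vset]

lemma card_vset (R : Finset (Fin r)) : (vset n R).card = ∑ i ∈ R, n i := by
  simp [vset]

lemma subset_vset_iff {R : Finset (Fin r)} {Z : Finset (Vertex n)} :
    Z ⊆ vset n R ↔ colors Z ⊆ R := by
  rw [colors, Finset.image_subset_iff]
  exact forall₂_congr fun v _ => mem_vset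

lemma mem_colors {Z : Finset (Vertex n)} {v : Vertex n} (h : v ∈ Z) : v.1 ∈ colors Z :=
  Finset.mem_image_of_mem _ h

lemma colors_mono {A Z : Finset (Vertex n)} (h : A ⊆ Z) : colors A ⊆ colors Z :=
  Finset.image_subset_image h

lemma colors_nonempty {Z : Finset (Vertex n)} : (colors Z).Nonempty ↔ Z.Nonempty :=
  Finset.image_nonempty

lemma card_colors_le (Z : Finset (Vertex n)) : (colors Z).card ≤ Z.card := Finset.card_image_le

lemma colors_vset (hn : ∀ i, d + 1 ≤ n i) (R : Finset (Fin r)) : colors (vset n R) = R := by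
  ext i
  simp only [colors, Finset.mem_image, mem_vset]
  constructor
  · rintro ⟨v, hv, rfl⟩; exact hv
  · intro hi; exact ⟨⟨i, ⟨0, by have := hn i; omega⟩⟩, hi, rfl⟩

lemma le_card_vset (hn : ∀ i, d + 1 ≤ n i) {R : Finset (Fin r)} (hR : R.Nonempty) :
    d + R.card ≤ (vset n R).card := by
  rw [card_vset]
  calc d + R.card ≤ R.card * (d + 1) := by
        have := hR.card_pos
        nlinarith
    _ = ∑ i ∈ R, (d + 1) := by simp
    _ ≤ ∑ i ∈ R, n i := Finset.sum_le_sum fun i _ => hn i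

/-- A set of vertices contains a subset of any size, not less than the number of its colors,
that has the same colors. -/
lemma exists_subset_colors_eq {Z : Finset (Vertex n)} {k : ℕ} (h1 : (colors Z).card ≤ k)
    (h2 : k ≤ Z.card) : ∃ A ⊆ Z, A.card = k ∧ colors A = colors Z := by
  classical
  obtain ⟨B, hB, hB1, hB2⟩ : ∃ B ⊆ Z, B.card = (colors Z).card ∧ colors B = colors Z := by
    obtain ⟨B, hB, hinj, himg⟩ := Finset.exists_subset_injOn_image_eq_of_surjOn (f := Sigma.fst)
      (Z : Set (Vertex n)) (colors Z) (by rw [colors, Finset.coe_image]; exact Set.surjOn_image _ _)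
    exact ⟨B, by exact_mod_cast hB, by rw [← himg, Finset.card_image_of_injOn hinj], himg⟩
  obtain ⟨A, hBA, hAZ, hA⟩ := Finset.exists_subsuperset_card_eq hB (hB1 ▸ h1) h2
  exact ⟨A, hAZ, hA, (colors_mono hAZ).antisymm (hB2 ▸ colors_mono hBA)⟩

lemma exists_superset_colors_eq {T : Finset (Fin r)} {A : Finset (Vertex n)} {k : ℕ}
    (hA : colors A = T) (h1 : A.card ≤ k) (h2 : k ≤ (vset n T).card) :
    ∃ B, A ⊆ B ∧ B.card = k ∧ colors B = T := by
  obtain ⟨B, hAB, hB, hBk⟩ := Finset.exists_subsuperset_card_eq (subset_vset_iff.2 hA.le) h1 h2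
  exact ⟨B, hAB, hBk, (subset_vset_iff.1 hB).antisymm (hA ▸ colors_mono hAB)⟩

end Mixed

section MixedCount

set_option linter.unusedSectionVars false

variable {r d : ℕ} {n : Fin r → ℕ}
variable {W : Type*} [NormedAddCommGroup W] [NormedSpace ℝ W] [FiniteDimensional ℝ W]

/-- The functionals `ℓ v` are those of the vertices of a Cayley polytope in which the vertices are
in general position, as far as the trivial faces `C_T` allow: `d + |T|` vertices with colors `T`
are affinely independent and span `C_T`. -/
structure GenericConfig (d : ℕ) (ℓ : Vertex n → W →ₗ[ℝ] ℝ) : Prop where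
  finrank_eq : Module.finrank ℝ W = d + r
  indicator : ∀ i : Fin r, ∃ e : W, ∀ v : Vertex n, ℓ v e = if v.1 = i then 1 else 0
  le_card : ∀ i, d + 1 ≤ n i
  separated : ∀ A : Finset (Vertex n), A.Nonempty → A.card = d + (colors A).card → Separated ℓ A
  eq_zero : ∀ A : Finset (Vertex n), A.Nonempty → A.card = d + (colors A).card → ∀ f,
    (∀ v ∈ A, ℓ v f = 0) → ∀ v ∈ vset n (colors A), ℓ v f = 0

open Classical in
/-- The vertex sets of the mixed faces of `C_T`. -/
noncomputable def mixedSets (ℓ : Vertex n → W →ₗ[ℝ] ℝ) (T : Finset (Fin r)) :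
    Finset (Finset (Vertex n)) :=
  (vset n T).powerset.filter fun Z => colors Z = T ∧ Z ≠ vset n T ∧ IsFaceSet ℓ (vset n T) Z

variable {ℓ : Vertex n → W →ₗ[ℝ] ℝ}

lemma mem_mixedSets {T : Finset (Fin r)} {Z : Finset (Vertex n)} :
    Z ∈ mixedSets ℓ T ↔ colors Z = T ∧ Z ≠ vset n T ∧ IsFaceSet ℓ (vset n T) Z := by
  classical
  unfold mixedSets
  rw [Finset.mem_filter, Finset.mem_powerset]
  exact ⟨fun h => h.2, fun h => ⟨h.2.2.1, h⟩⟩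

/-- A face of `C_T` is a face of `C_R`, for `T ⊆ R`. -/
lemma isFaceSet_vset_iff
    (hind : ∀ i : Fin r, ∃ e : W, ∀ v : Vertex n, ℓ v e = if v.1 = i then 1 else 0)
    {T R : Finset (Fin r)} (hTR : T ⊆ R) {Z : Finset (Vertex n)}
    (hZ : colors Z ⊆ T) : IsFaceSet ℓ (vset n R) Z ↔ IsFaceSet ℓ (vset n T) Z := by
  choose e he using hind
  constructor
  · rintro ⟨_, f, hf0, hf⟩
    exact ⟨subset_vset_iff.2 hZ, f, hf0, fun v hv => hf v (mem_vset.2 (hTR (mem_vset.1 hv)))⟩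
  · rintro ⟨_, f, hf0, hf⟩
    have hsum : ∀ v : Vertex n, ℓ v (∑ i ∈ R \ T, e i) = if v.1 ∈ R \ T then 1 else 0 := by
      intro v
      simp [he]
    obtain ⟨N, hN⟩ := exists_forall_pos_mul_add (vset n R \ vset n T) (fun _ => 1)
      (fun v => ℓ v f) (fun _ _ => one_pos)
    refine ⟨subset_vset_iff.2 (hZ.trans hTR), f + N • ∑ i ∈ R \ T, e i, fun v hv => ?_,
      fun v hv hvZ => ?_⟩
    · rw [map_add, map_smul, hsum, hf0 v hv, if_neg]
      · simp
      · exact fun h => (Finset.mem_sdiff.1 h).2 (hZ (mem_colors hv))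
    · rw [map_add, map_smul, hsum]
      by_cases hvT : v.1 ∈ T
      · rw [if_neg fun h => (Finset.mem_sdiff.1 h).2 hvT]
        simpa using hf v (mem_vset.2 hvT) hvZ
      · rw [if_pos (Finset.mem_sdiff.2 ⟨mem_vset.1 hv, hvT⟩)]
        have := hN v (Finset.mem_sdiff.2 ⟨hv, fun h => hvT (mem_vset.1 h)⟩)
        simp only [smul_eq_mul, mul_one] at this ⊢
        linarith

lemma GenericConfig.separated_of_card_le (h : GenericConfig d ℓ) {A : Finset (Vertex n)}
    (hA : A.card ≤ d + (colors A).card) : Separated ℓ A := by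
  rcases A.eq_empty_or_nonempty with rfl | hne
  · intro a ha; simp at ha
  have hT := colors_nonempty.2 hne
  obtain ⟨B, hAB, hB, hBc⟩ := exists_superset_colors_eq (A := A) rfl hA (le_card_vset h.le_card hT)
  exact (h.separated B (hne.mono hAB) (by rw [hB, hBc])).mono hAB

/-- A mixed face has fewer than `d + |T|` vertices, as `d + |T|` vertices span `C_T`. -/
lemma GenericConfig.card_lt (h : GenericConfig d ℓ) {T : Finset (Fin r)} (hT : T.Nonempty)
    {Z : Finset (Vertex n)} (hZ : Z ∈ mixedSets ℓ T) : Z.card < d + T.card := by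
  obtain ⟨hc, hne, hZV, f, hf0, hf⟩ := mem_mixedSets.1 hZ
  by_contra hcon
  push Not at hcon
  obtain ⟨A, hAZ, hA, hAc⟩ := exists_subset_colors_eq (Z := Z) (k := d + T.card)
    (by rw [hc]; omega) hcon
  have hA0 : A.Nonempty := colors_nonempty.1 (by rwa [hAc, hc])
  have h1 := h.eq_zero A hA0 (by rw [hA, hAc, hc]) f (fun v hv => hf0 v (hAZ hv))
  rw [hAc, hc] at h1
  apply hne
  refine hZV.antisymm fun v hv => ?_
  by_contra hvZ
  exact (hf v hv hvZ).ne' (h1 v hv)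

lemma GenericConfig.separated_of_mem (h : GenericConfig d ℓ) {T : Finset (Fin r)}
    (hT : T.Nonempty) {Z : Finset (Vertex n)} (hZ : Z ∈ mixedSets ℓ T) : Separated ℓ Z := by
  refine h.separated_of_card_le ?_
  rw [(mem_mixedSets.1 hZ).1]
  exact (h.card_lt hT hZ).le

lemma GenericConfig.finrank_zeroSpace_vset (h : GenericConfig d ℓ) {T : Finset (Fin r)}
    (hT : T.Nonempty) : Module.finrank ℝ (zeroSpace ℓ (vset n T)) + (d + T.card) = d + r := by
  have hc := colors_vset h.le_card T
  obtain ⟨A, hAV, hA, hAc⟩ := exists_subset_colors_eq (Z := vset n T) (k := d + T.card)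
    (by rw [hc]; omega) (le_card_vset h.le_card hT)
  rw [hc] at hAc
  have hA0 : A.Nonempty := colors_nonempty.1 (by rwa [hAc])
  have h1 := (h.separated A hA0 (by rw [hA, hAc])).finrank_add
  have h2 : zeroSpace ℓ (vset n T) = zeroSpace ℓ A := by
    ext f
    simp only [mem_zeroSpace]
    constructor
    · exact fun hf v hv => hf v (hAV hv)
    · intro hf
      have := h.eq_zero A hA0 (by rw [hA, hAc]) f hf
      rwa [hAc] at this
  rw [h2, ← hA, h1, h.finrank_eq]

/-- Non-empty subsets of vertex sets of mixed faces are vertex sets of mixed faces. -/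
lemma GenericConfig.mem_of_subset (h : GenericConfig d ℓ) {T : Finset (Fin r)} (hT : T.Nonempty)
    {A Z : Finset (Vertex n)} (hZ : Z ∈ mixedSets ℓ T) (hA : A ⊆ Z) (hA0 : A.Nonempty) :
    A ∈ mixedSets ℓ (colors A) := by
  have hs := h.separated_of_mem hT hZ
  obtain ⟨hc, hne, hface⟩ := mem_mixedSets.1 hZ
  have hsub : colors A ⊆ T := hc ▸ colors_mono hA
  refine mem_mixedSets.2 ⟨rfl, fun hAe => ?_,
    (isFaceSet_vset_iff h.indicator hsub subset_rfl).1 (hface.subset_of_separated hs hA)⟩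
  -- otherwise `Z` would have too many elements: all of `V_S` and one of each other color
  have h1 := h.card_lt hT hZ
  have h2 := le_card_vset h.le_card (colors_nonempty.2 hA0)
  rw [← hAe] at h2
  have h3 : T \ colors A ⊆ colors (Z \ A) := by
    intro i hi
    rw [Finset.mem_sdiff, ← hc, colors, Finset.mem_image] at hi
    obtain ⟨⟨v, hv, rfl⟩, hi2⟩ := hi
    exact mem_colors (Finset.mem_sdiff.2 ⟨hv, fun hvA => hi2 (mem_colors hvA)⟩)
  have h4 := (Finset.card_le_card h3).trans (card_colors_le _)
  rw [Finset.card_sdiff_of_subset hsub, Finset.card_sdiff_of_subset hA] at h4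
  have h5 := Finset.card_le_card hsub
  have h6 := Finset.card_le_card hA
  omega

open Classical in
/-- The signed number of the mixed faces of `C_T` that contain `A`. -/
noncomputable def signedCount (ℓ : Vertex n → W →ₗ[ℝ] ℝ) (A : Finset (Vertex n))
    (T : Finset (Fin r)) : ℤ :=
  ∑ Z ∈ mixedSets ℓ T with A ⊆ Z, (-1) ^ Z.card

open Classical in
/-- The faces of `C_R` with the colors `T` are `C_T` and its mixed faces. The contribution of the
faces with colors `T` to Euler's relation for `C_R` is therefore an expression in `signedCount`. -/
lemma GenericConfig.sum_slice (h : GenericConfig d ℓ) {A : Finset (Vertex n)}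
    {T R : Finset (Fin r)} (hT : T.Nonempty) (hTR : T ⊆ R) (hAT : colors A ⊆ T) :
    ∑ Z ∈ (vset n R).powerset with (A ⊆ Z ∧ IsFaceSet ℓ (vset n R) Z) ∧ colors Z = T,
      (-1 : ℤ) ^ Module.finrank ℝ (zeroSpace ℓ Z) =
    (-1) ^ (d + r) * (signedCount ℓ A T + (-1) ^ (d + T.card)) := by
  have hset : ((vset n R).powerset.filter
      fun Z => (A ⊆ Z ∧ IsFaceSet ℓ (vset n R) Z) ∧ colors Z = T) =
      insert (vset n T) ((mixedSets ℓ T).filter fun Z => A ⊆ Z) := by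
    ext Z
    simp only [Finset.mem_filter, Finset.mem_powerset, Finset.mem_insert, mem_mixedSets]
    constructor
    · rintro ⟨_, ⟨h2, h3⟩, h4⟩
      by_cases hZ : Z = vset n T
      · exact Or.inl hZ
      · exact Or.inr ⟨⟨h4, hZ, (isFaceSet_vset_iff h.indicator hTR h4.le).1 h3⟩, h2⟩
    · rintro (rfl | ⟨⟨h1, h2, h3⟩, h4⟩)
      · have hc := colors_vset h.le_card T
        refine ⟨subset_vset_iff.2 (hc.le.trans hTR), ⟨subset_vset_iff.2 hAT, ?_⟩, hc⟩
        refine (isFaceSet_vset_iff h.indicator hTR hc.le).2 ⟨subset_rfl, 0, by simp, ?_⟩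
        exact fun v hv hv' => absurd hv hv'
      · exact ⟨subset_vset_iff.2 (h1.le.trans hTR), ⟨h4,
          (isFaceSet_vset_iff h.indicator hTR h1.le).2 h3⟩, h1⟩
  rw [hset, Finset.sum_insert]
  · rw [mul_add, add_comm]
    have hsq : ∀ a : ℕ, (-1 : ℤ) ^ (a + a) = 1 := fun a => by rw [← two_mul, pow_mul]; simp
    congr 1
    · rw [signedCount, Finset.mul_sum]
      refine Finset.sum_congr rfl fun Z hZ => ?_
      have h1 := (h.separated_of_mem hT (Finset.mem_filter.1 hZ).1).finrank_add
      rw [h.finrank_eq] at h1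
      rw [← h1, pow_add, mul_assoc, ← pow_add, hsq, mul_one]
    · have h1 := h.finrank_zeroSpace_vset hT
      rw [← h1, pow_add, mul_assoc, ← pow_add, hsq, mul_one]
  · simp [mem_mixedSets]

open Classical in
/-- Euler's relation, in terms of mixed faces. -/
lemma GenericConfig.sum_signedCount (h : GenericConfig d ℓ) {A : Finset (Vertex n)}
    {R : Finset (Fin r)} (hA : IsFaceSet ℓ (vset n R) A) (hne : A ≠ vset n R) :
    ∑ T ∈ R.powerset with (colors A ⊆ T ∧ T.Nonempty),
      (signedCount ℓ A T + (-1) ^ (d + T.card)) = if A = ∅ then -1 else 0 := by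
  have h1 := sum_faceSets_eq_zero hA hne
  rw [← Finset.sum_fiberwise_of_maps_to (t := R.powerset) (g := colors)] at h1
  · have h2 : ∀ T ∈ R.powerset, ∑ Z ∈ ((vset n R).powerset.filter
        fun Z => A ⊆ Z ∧ IsFaceSet ℓ (vset n R) Z) with colors Z = T,
        (-1 : ℤ) ^ Module.finrank ℝ (zeroSpace ℓ Z) =
        (if colors A ⊆ T ∧ T.Nonempty then
          (-1) ^ (d + r) * (signedCount ℓ A T + (-1) ^ (d + T.card)) else 0) +
          if T = ∅ then (if A = ∅ then (-1) ^ (d + r) else 0) else 0 := by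
      intro T hT
      rw [Finset.mem_powerset] at hT
      rw [Finset.filter_filter]
      rcases T.eq_empty_or_nonempty with rfl | hT0
      · rw [if_neg (by simp), zero_add, if_pos rfl]
        by_cases hA0 : A = ∅
        · rw [if_pos hA0]
          subst hA0
          have : ((vset n R).powerset.filter fun Z => (∅ ⊆ Z ∧ IsFaceSet ℓ (vset n R) Z) ∧
              colors Z = ∅) = {∅} := by
            ext Z
            simp only [Finset.mem_filter, Finset.mem_powerset, Finset.mem_singleton]
            constructor
            · rintro ⟨_, _, h3⟩
              exact Finset.image_eq_empty.1 h3
            · rintro rfl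
              exact ⟨by simp, ⟨subset_rfl, hA⟩, by simp [colors]⟩
          rw [this, Finset.sum_singleton]
          have h3 : zeroSpace ℓ (∅ : Finset (Vertex n)) = ⊤ := by simp [zeroSpace]
          rw [h3, finrank_top, h.finrank_eq]
        · rw [if_neg hA0]
          refine Finset.sum_eq_zero fun Z hZ => ?_
          simp only [Finset.mem_filter] at hZ
          have : Z = ∅ := Finset.image_eq_empty.1 hZ.2.2
          exact absurd (Finset.subset_empty.1 (this ▸ hZ.2.1.1)) hA0
      · rw [if_neg hT0.ne_empty, add_zero]
        by_cases hAT : colors A ⊆ T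
        · rw [if_pos ⟨hAT, hT0⟩]
          exact h.sum_slice hT0 hT hAT
        · rw [if_neg fun h => hAT h.1]
          refine Finset.sum_eq_zero fun Z hZ => ?_
          simp only [Finset.mem_filter] at hZ
          exact absurd (hZ.2.2 ▸ colors_mono hZ.2.1.1) hAT
    rw [Finset.sum_congr rfl h2, Finset.sum_add_distrib, ← Finset.sum_filter, ← Finset.mul_sum,
      Finset.sum_ite_eq' R.powerset ∅, if_pos (Finset.empty_mem_powerset R)] at h1
    have h4 : (-1 : ℤ) ^ (d + r) ≠ 0 := pow_ne_zero _ (by norm_num)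
    refine mul_left_cancel₀ h4 ?_
    split_ifs at h1 ⊢ <;> linarith
  · intro Z hZ
    simp only [Finset.mem_filter, Finset.mem_powerset] at hZ ⊢
    exact subset_vset_iff.1 hZ.1

/-- Euler's relation, solved for the numbers of mixed faces that contain a given mixed face. -/
lemma GenericConfig.signedCount_eq (h : GenericConfig d ℓ) {S T : Finset (Fin r)}
    (hS : S.Nonempty) {A : Finset (Vertex n)} (hA : A ∈ mixedSets ℓ S) (hST : S ⊆ T) :
    signedCount ℓ A T = -(-1) ^ (d + T.card) := by
  obtain ⟨hc, hne, hface⟩ := mem_mixedSets.1 hA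
  have hA0 : A ≠ ∅ := by
    rintro rfl
    simp [colors] at hc
    exact hS.ne_empty hc.symm
  have key := eq_zero_of_sum_Icc_eq_zero (S := S)
    (fun T => signedCount ℓ A T + (-1) ^ (d + T.card)) (fun R hSR => ?_) T hST
  · linarith
  · have h1 := h.sum_signedCount (A := A) (R := R)
      ((isFaceSet_vset_iff h.indicator hSR hc.le).2 hface) ?_
    · rw [if_neg hA0] at h1
      rw [← h1]
      refine Finset.sum_congr ?_ fun _ _ => rfl
      ext T
      simp only [Finset.mem_filter, Finset.mem_powerset, hc]
      exact ⟨fun hT => ⟨hT.1, hT.2, hS.mono hT.2⟩, fun hT => ⟨hT.1, hT.2.1⟩⟩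
    · rintro rfl
      rw [colors_vset h.le_card] at hc
      exact hne (by rw [hc])

lemma isFaceSet_empty (h : GenericConfig d ℓ) (R : Finset (Fin r)) :
    IsFaceSet ℓ (vset n R) ∅ := by
  choose e he using h.indicator
  refine ⟨by simp, ∑ i, e i, by simp, fun v _ _ => ?_⟩
  simp [he]

/-- Euler's relation, solved for the numbers of all mixed faces. In comparison with `signedCount_eq`
there is an additional term, since the empty face is contained in faces with any colors. -/
lemma GenericConfig.signedCount_empty (h : GenericConfig d ℓ) {T : Finset (Fin r)}
    (hT : T.Nonempty) :
    signedCount ℓ ∅ T = -(-1) ^ (d + T.card) + (-1) ^ T.card := by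
  have key := eq_zero_of_sum_Icc_eq_zero (S := (∅ : Finset (Fin r)))
    (fun T => if T.Nonempty then signedCount ℓ ∅ T + (-1) ^ (d + T.card) - (-1) ^ T.card else 0)
    (fun R _ => ?_) T (Finset.empty_subset _)
  · rw [if_pos hT] at key
    linarith
  · simp only [Finset.empty_subset, Finset.filter_true]
    rw [← Finset.sum_filter, Finset.sum_sub_distrib]
    rcases R.eq_empty_or_nonempty with rfl | hR
    · simp [Finset.filter_singleton]
    have h1 := h.sum_signedCount (isFaceSet_empty h R) (by
      intro h0
      have := le_card_vset h.le_card hR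
      rw [← h0, Finset.card_empty] at this
      have := hR.card_pos
      omega)
    simp only [colors, Finset.image_empty, Finset.empty_subset, true_and, if_true] at h1
    rw [h1]
    have h2 := Finset.sum_powerset_neg_one_pow_card_of_nonempty hR
    rw [← Finset.sum_filter_add_sum_filter_not R.powerset Finset.Nonempty] at h2
    have h3 : R.powerset.filter (fun S => ¬ S.Nonempty) = {∅} := by
      ext S
      simp only [Finset.mem_filter, Finset.mem_powerset, Finset.not_nonempty_iff_eq_empty,
        Finset.mem_singleton]
      exact ⟨fun h => h.2, fun h => ⟨by simp [h], h⟩⟩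
    rw [h3, Finset.sum_singleton] at h2
    simp at h2
    linarith

/-- The numbers of mixed faces, with the convention for the empty face that makes the
Dehn-Sommerville equations uniform. -/
noncomputable def mixedCount (ℓ : Vertex n → W →ₗ[ℝ] ℝ) (T : Finset (Fin r)) (k : ℕ) : ℤ :=
  if k = 0 then (-1) ^ (T.card - 1) else ((mixedSets ℓ T).filter fun Z => Z.card = k).card

lemma GenericConfig.sum_mixedCount (h : GenericConfig d ℓ) {T : Finset (Fin r)}
    (hT : T.Nonempty) (x : ℝ) :
    ∑ k ∈ Finset.range (d + T.card - 1 + 1), (mixedCount ℓ T k : ℝ) * x ^ k =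
      (-1) ^ (T.card - 1) + ∑ Z ∈ mixedSets ℓ T, x ^ Z.card := by
  have hc := hT.card_pos
  rw [Finset.sum_range_succ', add_comm]
  congr 1
  · simp [mixedCount]
  · rw [← Finset.sum_fiberwise_of_maps_to (s := mixedSets ℓ T)
      (t := (Finset.range (d + T.card - 1)).image (· + 1)) (g := Finset.card)]
    · rw [Finset.sum_image (by intro a _ b _ hab; simpa using hab)]
      refine Finset.sum_congr rfl fun k _ => ?_
      rw [Finset.sum_congr rfl (g := fun _ => x ^ (k + 1))]
      · simp [mixedCount]
      · intro Z hZ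
        rw [(Finset.mem_filter.1 hZ).2]
    · intro Z hZ
      have h1 := h.card_lt hT hZ
      have h2 : 0 < Z.card := by
        rw [Finset.card_pos, ← colors_nonempty, (mem_mixedSets.1 hZ).1]
        exact hT
      rw [Finset.mem_image]
      exact ⟨Z.card - 1, by rw [Finset.mem_range]; omega, by omega⟩

lemma sum_powerset_nonempty_neg_one_pow {R : Finset (Fin r)} (hR : R.Nonempty) :
    ∑ S ∈ R.powerset with S.Nonempty, (-1 : ℝ) ^ (S.card - 1) = 1 := by
  have h2 := Finset.sum_powerset_neg_one_pow_card_of_nonempty hR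
  rw [← Finset.sum_filter_add_sum_filter_not R.powerset Finset.Nonempty] at h2
  have h3 : R.powerset.filter (fun S => ¬ S.Nonempty) = {∅} := by
    ext S
    simp only [Finset.mem_filter, Finset.mem_powerset, Finset.not_nonempty_iff_eq_empty,
      Finset.mem_singleton]
    exact ⟨fun h => h.2, fun h => ⟨by simp [h], h⟩⟩
  rw [h3, Finset.sum_singleton] at h2
  have h4 : ∑ S ∈ R.powerset with S.Nonempty, (-1 : ℝ) ^ (S.card - 1) =
      -((∑ S ∈ R.powerset with S.Nonempty, (-1 : ℤ) ^ S.card : ℤ) : ℝ) := by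
    push_cast
    rw [← Finset.sum_neg_distrib]
    refine Finset.sum_congr rfl fun S hS => ?_
    have := (Finset.mem_filter.1 hS).2.card_pos
    obtain ⟨m, hm⟩ := Nat.exists_eq_add_of_le this
    rw [hm, Nat.add_sub_cancel_left, pow_add]
    simp
  rw [h4, eq_neg_of_add_eq_zero_left h2]
  simp

/-- The Dehn-Sommerville equations for mixed faces: expand `(1 + x) ^ |Z|` as a sum over the
subsets of `Z`, exchange summations, and apply Euler's relation. -/
lemma GenericConfig.dehn_sommerville (h : GenericConfig d ℓ) {T : Finset (Fin r)}
    (hT : T.Nonempty) (x : ℝ) :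
    ∑ k ∈ Finset.range (d + T.card - 1 + 1), (mixedCount ℓ T k : ℝ) * (-(1 + x)) ^ k =
      (-1) ^ (d + T.card - 1) * ∑ S ∈ T.powerset with S.Nonempty,
        ∑ k ∈ Finset.range (d + S.card - 1 + 1), (mixedCount ℓ S k : ℝ) * x ^ k := by
  classical
  have hc := hT.card_pos
  rw [h.sum_mixedCount hT, Finset.sum_congr rfl fun S hS =>
    h.sum_mixedCount (Finset.mem_filter.1 hS).2 x, Finset.sum_add_distrib,
    sum_powerset_nonempty_neg_one_pow hT]
  have e1 : ∀ Z ∈ mixedSets ℓ T, (-(1 + x)) ^ Z.card =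
      ∑ S ∈ T.powerset, ∑ A ∈ Z.powerset with colors A = S, (-1) ^ Z.card * x ^ A.card := by
    intro Z hZ
    rw [Finset.sum_fiberwise_of_maps_to]
    · rw [← Finset.mul_sum, neg_pow]
      congr 1
      rw [add_comm, ← Finset.sum_pow_mul_eq_add_pow]
      simp
    · intro A hA
      rw [Finset.mem_powerset] at hA ⊢
      exact (mem_mixedSets.1 hZ).1 ▸ colors_mono hA
  rw [Finset.sum_congr rfl e1, Finset.sum_comm]
  have e2 : ∀ S ∈ T.powerset, ∑ Z ∈ mixedSets ℓ T, ∑ A ∈ Z.powerset with colors A = S,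
      (-1 : ℝ) ^ Z.card * x ^ A.card = if S.Nonempty then
        (-1) ^ (d + T.card - 1) * ∑ A ∈ mixedSets ℓ S, x ^ A.card
        else (signedCount ℓ ∅ T : ℝ) := by
    intro S hS
    rw [Finset.mem_powerset] at hS
    by_cases hS0 : S.Nonempty
    · rw [if_pos hS0, Finset.sum_comm' (t' := mixedSets ℓ S)
        (s' := fun A => (mixedSets ℓ T).filter fun Z => A ⊆ Z), Finset.mul_sum]
      · refine Finset.sum_congr rfl fun A hA => ?_
        rw [← Finset.sum_mul]
        congr 1
        have := h.signedCount_eq hS0 hA hS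
        rw [signedCount] at this
        have h3 : ((∑ Z ∈ mixedSets ℓ T with A ⊆ Z, (-1) ^ Z.card : ℤ) : ℝ) =
            ((-(-1) ^ (d + T.card) : ℤ) : ℝ) := by rw [this]
        push_cast at h3
        rw [h3]
        obtain ⟨m, hm⟩ := Nat.exists_eq_add_of_le (show 1 ≤ d + T.card by omega)
        rw [hm, Nat.add_sub_cancel_left, pow_add]
        simp
      · intro Z A
        simp only [Finset.mem_filter, Finset.mem_powerset]
        constructor
        · rintro ⟨h1, h2, h3⟩
          refine ⟨⟨h1, h2⟩, ?_⟩
          have := h.mem_of_subset hT h1 h2 (colors_nonempty.1 (h3 ▸ hS0))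
          rwa [h3] at this
        · rintro ⟨⟨h1, h2⟩, h3⟩
          exact ⟨h1, h2, (mem_mixedSets.1 h3).1⟩
    · rw [if_neg hS0, signedCount]
      rw [Finset.not_nonempty_iff_eq_empty] at hS0
      push_cast
      simp only [Finset.empty_subset, Finset.filter_true]
      refine Finset.sum_congr rfl fun Z _ => ?_
      have : (Z.powerset.filter fun A => colors A = S) = {∅} := by
        ext A
        simp only [Finset.mem_filter, Finset.mem_powerset, Finset.mem_singleton, hS0, colors,
          Finset.image_eq_empty]
        exact ⟨fun h => h.2, fun h => ⟨by simp [h], h⟩⟩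
      rw [this]
      simp
  rw [Finset.sum_congr rfl e2, Finset.sum_ite]
  have e3 : (T.powerset.filter fun S => ¬ S.Nonempty) = {∅} := by
    ext S
    simp only [Finset.mem_filter, Finset.mem_powerset, Finset.not_nonempty_iff_eq_empty,
      Finset.mem_singleton]
    exact ⟨fun h => h.2, fun h => ⟨by simp [h], h⟩⟩
  rw [e3, Finset.sum_singleton, h.signedCount_empty hT, ← Finset.mul_sum]
  obtain ⟨m, hm⟩ := Nat.exists_eq_add_of_le (show 1 ≤ T.card by omega)
  rw [hm, show d + (1 + m) - 1 = d + m by omega, Nat.add_sub_cancel_left]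
  push_cast
  rw [pow_add _ d (1 + m), pow_add _ d m, pow_add _ 1 m]
  ring

end MixedCount

/-! ### Neighborly configurations attain the bounds -/

section SpanCount

variable {r d : ℕ} {n : Fin r → ℕ}

lemma neg_one_pow_sub_eq {a b : ℕ} (h : b ≤ a) : (-1 : ℤ) ^ (a - b) = (-1) ^ a * (-1) ^ b := by
  obtain ⟨m, rfl⟩ := Nat.exists_eq_add_of_le h
  rw [Nat.add_sub_cancel_left, pow_add, mul_right_comm, ← pow_add, ← two_mul, pow_mul]
  simp

/-- Inclusion-exclusion for the vertex sets that have all colors in `T`. -/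
lemma card_spanning (T : Finset (Fin r)) {k : ℕ} (hk : k ≠ 0) :
    ((((vset n T).powersetCard k).filter fun A => colors A = T).card : ℤ) = spanCount n T k := by
  classical
  have h1 : spanCount n T k = ∑ S ∈ T.powerset, (-1) ^ (T.card - S.card) *
      ((∑ i ∈ S, n i).choose k : ℤ) := by
    rw [spanCount, Finset.sum_filter]
    refine Finset.sum_congr rfl fun S _ => ?_
    by_cases hS : S.Nonempty
    · rw [if_pos hS]
    · rw [if_neg hS, Finset.not_nonempty_iff_eq_empty.1 hS]
      simp [Nat.choose_eq_zero_of_lt (Nat.pos_of_ne_zero hk)]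
  have h2 : ∀ S ∈ T.powerset, (-1) ^ (T.card - S.card) * ((∑ i ∈ S, n i).choose k : ℤ) =
      ∑ A ∈ (vset n T).powersetCard k, if colors A ⊆ S then (-1) ^ (T.card - S.card) else 0 := by
    intro S hS
    rw [Finset.mem_powerset] at hS
    have h3 : ((vset n T).powersetCard k).filter (fun A => colors A ⊆ S) =
        (vset n S).powersetCard k := by
      ext A
      simp only [Finset.mem_filter, Finset.mem_powersetCard, ← subset_vset_iff]
      constructor
      · rintro ⟨⟨_, h4⟩, h5⟩; exact ⟨h5, h4⟩
      · rintro ⟨h5, h4⟩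
        exact ⟨⟨subset_vset_iff.2 ((subset_vset_iff.1 h5).trans hS), h4⟩, h5⟩
    rw [← Finset.sum_filter, h3, Finset.sum_const, Finset.card_powersetCard, card_vset]
    simp [mul_comm]
  rw [h1, Finset.sum_congr rfl h2, Finset.sum_comm, Finset.card_filter]
  push_cast
  refine Finset.sum_congr rfl fun A hA => ?_
  have hAT := subset_vset_iff.1 (Finset.mem_powersetCard.1 hA).1
  have h4 : ∑ S ∈ T.powerset, (if colors A ⊆ S then (-1 : ℤ) ^ (T.card - S.card) else 0) =
      ∑ S ∈ (T \ colors A).powerset, (-1) ^ S.card := by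
    rw [← Finset.sum_filter]
    refine Finset.sum_nbij' (fun S => T \ S) (fun S => T \ S) ?_ ?_ ?_ ?_ ?_
    · intro S hS
      simp only [Finset.mem_filter, Finset.mem_powerset] at hS ⊢
      exact Finset.sdiff_subset_sdiff subset_rfl hS.2
    · intro S hS
      simp only [Finset.mem_filter, Finset.mem_powerset] at hS ⊢
      refine ⟨Finset.sdiff_subset, fun i hi => Finset.mem_sdiff.2 ⟨hAT hi, fun hiS => ?_⟩⟩
      exact (Finset.mem_sdiff.1 (hS hiS)).2 hi
    · intro S hS
      simp only [Finset.mem_filter, Finset.mem_powerset] at hS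
      exact Finset.sdiff_sdiff_eq_self hS.1
    · intro S hS
      simp only [Finset.mem_powerset] at hS
      exact Finset.sdiff_sdiff_eq_self (hS.trans Finset.sdiff_subset)
    · intro S hS
      simp only [Finset.mem_filter, Finset.mem_powerset] at hS
      rw [Finset.card_sdiff_of_subset hS.1]
  rw [h4, Finset.sum_powerset_neg_one_pow_card]
  have h5 : colors A = T ↔ T \ colors A = ∅ := by
    rw [Finset.sdiff_eq_empty_iff_subset]
    exact ⟨fun h => h.ge, fun h => hAT.antisymm h⟩
  simp only [h5]

lemma spanCount_zero {T : Finset (Fin r)} (hT : T.Nonempty) :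
    spanCount n T 0 = (-1) ^ (T.card - 1) := by
  have h1 := sum_powerset_nonempty_neg_one_pow hT
  have h2 : ∑ S ∈ T.powerset with S.Nonempty, (-1 : ℤ) ^ (S.card - 1) = 1 := by
    exact_mod_cast h1
  have hc := hT.card_pos
  refine Eq.trans ?_ ((Finset.mul_sum _ _ _).symm.trans ((congrArg (_ * ·) h2).trans (mul_one _)))
  rw [spanCount]
  refine Finset.sum_congr rfl fun S hS => ?_
  rw [Finset.mem_filter, Finset.mem_powerset] at hS
  have h3 := hS.2.card_pos
  have h4 := Finset.card_le_card hS.1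
  rw [Nat.choose_zero_right, Nat.cast_one, mul_one,
    show T.card - S.card = (T.card - 1) - (S.card - 1) by omega, neg_one_pow_sub_eq (by omega)]

variable {W : Type*} [NormedAddCommGroup W] [NormedSpace ℝ W] [FiniteDimensional ℝ W]
variable {ℓ : Vertex n → W →ₗ[ℝ] ℝ}

/-- All spanning subsets of `⋃_{i ∈ T} V_i` with at most `(d + |T| - 1) / 2` elements are faces. -/
def NeighborlyConfig (d : ℕ) (ℓ : Vertex n → W →ₗ[ℝ] ℝ) : Prop :=
  ∀ A : Finset (Vertex n), A.Nonempty → 2 * A.card + 1 ≤ d + (colors A).card →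
    IsFaceSet ℓ (vset n (colors A)) A

lemma mixedSets_filter_card (hn : ∀ i, d + 1 ≤ n i) (T : Finset (Fin r)) {k : ℕ} (hk : k ≠ 0)
    (hkT : k < d + T.card)
    (hface : ∀ A : Finset (Vertex n), colors A = T → A.card = k → IsFaceSet ℓ (vset n T) A) :
    ((mixedSets ℓ T).filter fun Z => Z.card = k) =
      ((vset n T).powersetCard k).filter fun A => colors A = T := by
  ext Z
  simp only [Finset.mem_filter, mem_mixedSets, Finset.mem_powersetCard]
  constructor
  · rintro ⟨⟨h1, _, h2⟩, h3⟩
    exact ⟨⟨h2.1, h3⟩, h1⟩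
  · rintro ⟨⟨h1, h2⟩, h3⟩
    refine ⟨⟨h3, fun h4 => ?_, hface Z h3 h2⟩, h2⟩
    have hZ : Z.Nonempty := Finset.card_pos.1 (by omega)
    have := le_card_vset hn (h3 ▸ colors_nonempty.2 hZ)
    rw [← h4] at this
    omega

/-- In a neighborly configuration in general position, the bounds for the numbers of mixed faces
are attained. -/
lemma GenericConfig.card_mixedSets (h : GenericConfig d ℓ) (hN : NeighborlyConfig d ℓ) (hd : 1 ≤ d)
    {T : Finset (Fin r)} (hT : T.Nonempty) {k : ℕ} (hk : k ≠ 0) (hkT : k < d + T.card) :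
    (((mixedSets ℓ T).filter fun Z => Z.card = k).card : ℤ) = faceBound d n T k := by
  have := eq_faceBound hd n (mixedCount ℓ) (fun R hR k hk => ?_)
    (fun R hR x => h.dehn_sommerville hR x) T hT (show k ≤ d + T.card - 1 by omega)
  · rw [← this, mixedCount, if_neg hk]
  · have hc := hR.card_pos
    unfold mixedCount
    split_ifs with hk0
    · rw [hk0, spanCount_zero hR]
    · rw [← card_spanning R hk0, mixedSets_filter_card h.le_card R hk0 (by omega)]
      intro A hA hAk
      have := hN A (colors_nonempty.1 (hA ▸ hR)) (by rw [hA, hAk]; omega)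
      rwa [hA] at this

/-- In the lower half the bound counts the spanning subsets. This is an identity between
polynomials in the `n i`; here it is read off from a configuration. -/
lemma GenericConfig.spanCount_eq_faceBound (h : GenericConfig d ℓ) (hN : NeighborlyConfig d ℓ)
    (hd : 1 ≤ d) {T : Finset (Fin r)} (hT : T.Nonempty) {k : ℕ} (hk : k ≠ 0)
    (hkT : 2 * k + 1 ≤ d + T.card) :
    spanCount n T k = faceBound d n T k := by
  rw [← h.card_mixedSets hN hd hT hk (by omega), ← card_spanning T hk,
    mixedSets_filter_card h.le_card T hk (by omega)]
  intro A hA hAk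
  have := hN A (colors_nonempty.1 (hA ▸ hT)) (by rw [hA, hAk]; omega)
  rwa [hA] at this

end SpanCount

/-! ### Perturbation -/

section Perturbation

set_option linter.unusedSectionVars false

variable {W : Type*} [NormedAddCommGroup W] [NormedSpace ℝ W] [FiniteDimensional ℝ W]
variable {ι : Type*} [DecidableEq ι]

open Filter Topology

/-- A dual family at parameter `0` deforms to dual families near `0`. -/
lemma eventually_exists_dual (ℓ : ℝ → ι → W →ₗ[ℝ] ℝ) (hc : ∀ v f, Continuous fun ζ => ℓ ζ v f)
    {A : Finset ι} (hA : Separated (ℓ 0) A) :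
    ∃ G : ℝ → A → W, (∀ᶠ ζ in 𝓝 0, ∀ a b : A, ℓ ζ b (G ζ a) = if b = a then 1 else 0) ∧
      ∀ v a, ContinuousAt (fun ζ => ℓ ζ v (G ζ a)) 0 := by
  have hA' : ∀ a : A, ∃ g, ℓ 0 a g = 1 ∧ ∀ b ∈ A, b ≠ a → ℓ 0 b g = 0 := fun a => hA a a.2
  choose g hg hg' using hA'
  let M : ℝ → Matrix A A ℝ := fun ζ => Matrix.of fun b a => ℓ ζ b (g a)
  have hM0 : M 0 = 1 := by
    ext b a
    by_cases hab : b = a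
    · subst hab; simp [M, hg]
    · rw [Matrix.one_apply_ne hab]
      exact hg' a b b.2 fun h => hab (Subtype.ext h)
  have hMc : Continuous M := continuous_matrix fun b a => hc b (g a)
  have hdet : ContinuousAt (fun ζ => (M ζ).det) 0 := hMc.matrix_det.continuousAt
  have hdet0 : (M 0).det ≠ 0 := by rw [hM0, Matrix.det_one]; exact one_ne_zero
  refine ⟨fun ζ a => ∑ c, (M ζ)⁻¹ c a • g c, ?_, fun v a => ?_⟩
  · filter_upwards [hdet.eventually_ne hdet0] with ζ hζ a b
    have h1 := congrFun (congrFun (Matrix.mul_nonsing_inv (M ζ) (isUnit_iff_ne_zero.2 hζ)) b) a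
    rw [Matrix.mul_apply, Matrix.one_apply] at h1
    rw [← h1, map_sum]
    refine Finset.sum_congr rfl fun c _ => ?_
    simp [M, mul_comm]
  · simp only [map_sum, map_smul, smul_eq_mul]
    refine tendsto_finsetSum _ fun c _ => ContinuousAt.mul ?_ (hc v (g c)).continuousAt
    simp only [Matrix.inv_def, Ring.inverse_eq_inv', Matrix.smul_apply, smul_eq_mul]
    refine ContinuousAt.mul (hdet.inv₀ hdet0) ?_
    exact (hMc.matrix_adjugate.matrix_elem c a).continuousAt

lemma eventually_separated (ℓ : ℝ → ι → W →ₗ[ℝ] ℝ) (hc : ∀ v f, Continuous fun ζ => ℓ ζ v f)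
    {A : Finset ι} (hA : Separated (ℓ 0) A) : ∀ᶠ ζ in 𝓝 0, Separated (ℓ ζ) A := by
  obtain ⟨G, hG, _⟩ := eventually_exists_dual ℓ hc hA
  filter_upwards [hG] with ζ hζ a ha
  refine ⟨G ζ ⟨a, ha⟩, ?_, fun b hb hba => ?_⟩
  · simpa using hζ ⟨a, ha⟩ ⟨a, ha⟩
  · simpa [hba] using hζ ⟨a, ha⟩ ⟨b, hb⟩

lemma eventually_isFaceSet (ℓ : ℝ → ι → W →ₗ[ℝ] ℝ) (hc : ∀ v f, Continuous fun ζ => ℓ ζ v f)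
    {V A : Finset ι} (hA : Separated (ℓ 0) A) (hface : IsFaceSet (ℓ 0) V A) :
    ∀ᶠ ζ in 𝓝 0, IsFaceSet (ℓ ζ) V A := by
  obtain ⟨G, hG, hGc⟩ := eventually_exists_dual ℓ hc hA
  obtain ⟨hAV, f, hf0, hf⟩ := hface
  have hcont : ∀ v, ContinuousAt
      (fun ζ => ℓ ζ v (f - ∑ a : A, ℓ ζ a f • G ζ a)) 0 := by
    intro v
    simp only [map_sub, map_sum, map_smul, smul_eq_mul]
    exact (hc v f).continuousAt.sub
      (tendsto_finsetSum _ fun a _ => ContinuousAt.mul (hc a f).continuousAt (hGc v a))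
  have hval : ∀ v, ℓ 0 v (f - ∑ a : A, ℓ 0 a f • G 0 a) = ℓ 0 v f := by
    intro v
    have : ∑ a : A, ℓ 0 a f • G 0 a = 0 :=
      Finset.sum_eq_zero fun a _ => by rw [hf0 a a.2, zero_smul]
    rw [this, sub_zero]
  have hpos : ∀ᶠ ζ in 𝓝 0, ∀ v ∈ V \ A, 0 < ℓ ζ v (f - ∑ a : A, ℓ ζ a f • G ζ a) := by
    rw [eventually_all_finset]
    intro v hv
    rw [Finset.mem_sdiff] at hv
    refine (hcont v).eventually_const_lt ?_
    exact (hf v hv.1 hv.2).trans_eq (hval v).symm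
  filter_upwards [hG, hpos] with ζ hζ hζ'
  refine ⟨hAV, _, fun b hb => ?_, fun v hv hvA => hζ' v (Finset.mem_sdiff.2 ⟨hv, hvA⟩)⟩
  rw [map_sub, map_sum, Finset.sum_eq_single ⟨b, hb⟩]
  · rw [map_smul, hζ ⟨b, hb⟩ ⟨b, hb⟩]; simp
  · intro a _ hab
    have := hζ a ⟨b, hb⟩
    rw [if_neg hab.symm] at this
    rw [map_smul, this, smul_zero]
  · simp

lemma Separated.insert_of_ne_zero {ℓ : ι → W →ₗ[ℝ] ℝ} {A : Finset ι} (hA : Separated ℓ A)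
    {u : ι} {f : W} (hf : ∀ a ∈ A, ℓ a f = 0) (hu : ℓ u f ≠ 0) : Separated ℓ (insert u A) := by
  have huA : u ∉ A := fun h => hu (hf u h)
  intro a ha
  rcases Finset.mem_insert.1 ha with rfl | ha
  · refine ⟨(ℓ a f)⁻¹ • f, by simp [hu], fun b hb hba => ?_⟩
    simp [hf b ((Finset.mem_insert.1 hb).resolve_left hba)]
  · obtain ⟨g, hg, hg'⟩ := hA a ha
    refine ⟨g - (ℓ u g / ℓ u f) • f, by simp [hg, hf a ha], fun b hb hba => ?_⟩
    rcases Finset.mem_insert.1 hb with rfl | hb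
    · simp [hu]
    · simp [hg' b hb hba, hf b hb]

lemma Separated.card_le {ℓ : ι → W →ₗ[ℝ] ℝ} {A : Finset ι} (hA : Separated ℓ A) :
    A.card ≤ Module.finrank ℝ W := by
  have := hA.finrank_add
  omega

end Perturbation

section Colored

set_option linter.unusedSectionVars false

variable {r d : ℕ} {n : Fin r → ℕ}
variable {W : Type*} [NormedAddCommGroup W] [NormedSpace ℝ W] [FiniteDimensional ℝ W]
variable {ℓ : Vertex n → W →ₗ[ℝ] ℝ}

/-- Vertices of new, distinct colors are independent of the given ones. -/
lemma Separated.union_of_colors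
    (hind : ∀ i : Fin r, ∃ e : W, ∀ v : Vertex n, ℓ v e = if v.1 = i then 1 else 0)
    {A : Finset (Vertex n)} (hA : Separated ℓ A) (B : Finset (Vertex n))
    (hB : Set.InjOn Sigma.fst (B : Set (Vertex n))) (hAB : ∀ b ∈ B, b.1 ∉ colors A) :
    Separated ℓ (A ∪ B) := by
  induction B using Finset.induction_on with
  | empty => simpa using hA
  | insert b B hb ih =>
    obtain ⟨e, he⟩ := hind b.1
    rw [Finset.union_insert]
    refine (ih (hB.mono (by simp)) fun b hb => hAB b (by simp [hb])).insert_of_ne_zero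
      (f := e) ?_ ?_
    · intro a ha
      rw [he, if_neg]
      intro hab
      rcases Finset.mem_union.1 ha with ha | ha
      · exact hAB b (by simp) (hab ▸ mem_colors ha)
      · exact hb (hB (by simp [ha]) (by simp) hab ▸ ha)
    · simp [he]

/-- `d + |T|` independent vertices with colors `T` determine the functionals up to those
vanishing on all vertices with colors in `T`, by counting dimensions. -/
lemma Separated.eq_zero_of_card (hdim : Module.finrank ℝ W = d + r)
    (hind : ∀ i : Fin r, ∃ e : W, ∀ v : Vertex n, ℓ v e = if v.1 = i then 1 else 0)
    (hn : ∀ i, d + 1 ≤ n i) {A : Finset (Vertex n)} (hA : Separated ℓ A)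
    (hcard : A.card = d + (colors A).card) {f : W} (hf : ∀ v ∈ A, ℓ v f = 0) {v : Vertex n}
    (hv : v ∈ vset n (colors A)) : ℓ v f = 0 := by
  by_contra hne
  -- `A` together with `v` and one vertex of each of the missing colors would be independent
  have h1 := hA.insert_of_ne_zero hf hne
  have hvA : v ∉ A := fun h => hne (hf v h)
  have hcol : colors (insert v A) = colors A := by
    rw [colors, Finset.image_insert]
    exact Finset.insert_eq_of_mem (mem_vset.1 hv)
  set B : Finset (Vertex n) :=
    (Finset.univ \ colors A).image fun i => ⟨i, ⟨0, by have := hn i; omega⟩⟩ with hB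
  have hBc : B.card = r - (colors A).card := by
    rw [hB, Finset.card_image_of_injective, Finset.card_sdiff_of_subset (Finset.subset_univ _),
      Finset.card_univ, Fintype.card_fin]
    intro i j hij
    exact congrArg Sigma.fst hij
  have hBcol : ∀ b ∈ B, b.1 ∉ colors A := by
    intro b hb
    rw [hB, Finset.mem_image] at hb
    obtain ⟨i, hi, rfl⟩ := hb
    exact (Finset.mem_sdiff.1 hi).2
  have h2 := (h1.union_of_colors hind B ?_ ?_).card_le
  · rw [Finset.card_union_of_disjoint, Finset.card_insert_of_notMem hvA, hBc, hdim] at h2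
    · have h3 : (colors A).card ≤ r := by simpa using Finset.card_le_univ (colors A)
      omega
    · rw [Finset.disjoint_left]
      intro a ha hb
      exact hBcol a hb (hcol ▸ mem_colors ha)
  · intro b hb b' hb' hbb
    rw [hB, Finset.coe_image] at hb hb'
    obtain ⟨i, _, rfl⟩ := hb
    obtain ⟨j, _, rfl⟩ := hb'
    have hij : i = j := hbb
    rw [hij]
  · rwa [hcol]

/-- If all spanning subsets of `A` are faces then `A` is independent: the functional of the face
`A \ {a}` separates `a` from the rest, or, if `a` is the only vertex of its color, the indicator of
this color does. -/
lemma separated_of_forall_isFaceSet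
    (hind : ∀ i : Fin r, ∃ e : W, ∀ v : Vertex n, ℓ v e = if v.1 = i then 1 else 0)
    {A : Finset (Vertex n)}
    (h : ∀ B ⊆ A, colors B = colors A → IsFaceSet ℓ (vset n (colors A)) B) : Separated ℓ A := by
  intro a ha
  by_cases hc : a.1 ∈ colors (A.erase a)
  · have hcol : colors (A.erase a) = colors A := by
      rw [← Finset.insert_erase ha, colors, colors, Finset.image_insert,
        Finset.erase_insert (Finset.notMem_erase a A)]
      exact (Finset.insert_eq_of_mem hc).symm
    obtain ⟨_, f, hf0, hf⟩ := h _ (Finset.erase_subset a A) hcol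
    have hfa := hf a (mem_vset.2 (mem_colors ha)) (Finset.notMem_erase a A)
    refine ⟨(ℓ a f)⁻¹ • f, by simp [hfa.ne'], fun b hb hba => ?_⟩
    simp [hf0 b (Finset.mem_erase.2 ⟨hba, hb⟩)]
  · obtain ⟨e, he⟩ := hind a.1
    refine ⟨e, by simp [he], fun b hb hba => ?_⟩
    rw [he, if_neg]
    intro hab
    exact hc (hab ▸ mem_colors (Finset.mem_erase.2 ⟨hba, hb⟩))

end Colored

/-! ### The functionals of the construction -/

section Construction

set_option linter.unusedSectionVars false

open Polynomial

variable {r d : ℕ} {n : Fin r → ℕ}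

/-- The parameters of the vertices are positive, and those of different polytopes lie in disjoint
intervals that are ordered like the polytopes. -/
structure OrderedParams (y : Vertex n → ℝ) : Prop where
  pos : ∀ v, 0 < y v
  lt : ∀ v w, v.1 < w.1 → y v < y w
  inj : ∀ v w, v.1 = w.1 → y v = y w → v = w

/-- The exponent in the coordinate `c` of the curves, except in the own coordinate of a curve. -/
def expo (d r : ℕ) (c : Fin d) : ℕ := if (c : ℕ) < r then d - r + 2 + c else c - r + 2

/-- The coefficients of the curves: `w` for the first `r` coordinates, `1` for the others. -/
noncomputable def weight (w : Fin r → ℝ) (c : Fin d) : ℝ := if h : (c : ℕ) < r then w ⟨c, h⟩ else 1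

/-- The curves of the construction, with the perturbation parameter `ζ` in the coordinate `j`
replaced by `w j`. -/
noncomputable def weightedCurve (d : ℕ) (w : Fin r → ℝ) (i : Fin r) (t : ℝ) : Fin d → ℝ :=
  fun c => if (c : ℕ) = i then t else weight w c * t ^ expo d r c

/-- The value at a vertex `v` of an affine functional on the Cayley polytope. The functional is
given by its linear part `f.2` on `ℝ^d` and its values `f.1 i` at the points `(e_i, 0)`. -/
noncomputable def evalAt (d : ℕ) (y : Vertex n → ℝ) (w : Fin r → ℝ) (v : Vertex n) :
    ((Fin r → ℝ) × (Fin d → ℝ)) →ₗ[ℝ] ℝ where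
  toFun f := f.1 v.1 + ∑ c, f.2 c * weightedCurve d w v.1 (y v) c
  map_add' f g := by
    simp only [Prod.fst_add, Prod.snd_add, Pi.add_apply, add_mul, Finset.sum_add_distrib]
    ring
  map_smul' t f := by
    simp only [Prod.smul_fst, Prod.smul_snd, Pi.smul_apply, smul_eq_mul, mul_assoc,
      ← Finset.mul_sum, RingHom.id_apply]
    ring

variable {y : Vertex n → ℝ}

lemma evalAt_apply (w : Fin r → ℝ) (v : Vertex n) (f : (Fin r → ℝ) × (Fin d → ℝ)) :
    evalAt d y w v f = f.1 v.1 + ∑ c, f.2 c * weightedCurve d w v.1 (y v) c := rfl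

lemma evalAt_indicator (w : Fin r → ℝ) (i : Fin r) :
    ∃ e, ∀ v : Vertex n, evalAt d y w v e = if v.1 = i then 1 else 0 :=
  ⟨(Pi.single i 1, 0), fun v => by simp [evalAt_apply, Pi.single_apply]⟩

lemma expo_injective (hrd : r < d) : Function.Injective (expo d r) := by
  intro a b hab
  unfold expo at hab
  apply Fin.ext
  have := a.2
  have := b.2
  split_ifs at hab <;> omega

lemma two_le_expo (c : Fin d) : 2 ≤ expo d r c := by
  unfold expo; split_ifs <;> omega

/-- The common non-affine part of a functional along the curves. -/
noncomputable def commonPart (w : Fin r → ℝ) (f : Fin d → ℝ) : ℝ[X] :=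
  ∑ c, monomial (expo d r c) (weight w c * f c)

/-- The exponents that occur in the common parts. -/
noncomputable def exponents (d : ℕ) (w : Fin r → ℝ) : Finset ℕ :=
  (Finset.univ.filter fun c : Fin d => weight w c ≠ 0).image (expo d r)

lemma commonPart_coeff (hrd : r < d) (w : Fin r → ℝ) (f : Fin d → ℝ) (c : Fin d) :
    (commonPart w f).coeff (expo d r c) = weight w c * f c := by
  simp only [commonPart, finsetSum_coeff, coeff_monomial]
  rw [Finset.sum_eq_single c]
  · simp
  · intro b _ hb; rw [if_neg]; exact fun h => hb (expo_injective hrd h)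
  · simp

lemma commonPart_support (w : Fin r → ℝ) (f : Fin d → ℝ) :
    (commonPart w f).support ⊆ exponents d w := by
  intro m hm
  by_contra hmE
  rw [mem_support_iff] at hm
  apply hm
  simp only [commonPart, finsetSum_coeff, coeff_monomial]
  refine Finset.sum_eq_zero fun c _ => ?_
  split_ifs with h
  · by_contra hne
    exact hmE (Finset.mem_image.2 ⟨c, Finset.mem_filter.2 ⟨Finset.mem_univ _,
      left_ne_zero_of_mul hne⟩, h⟩)
  · rfl

/-- Along the curve of color `i` a functional is the sum of an affine function and the common part,
as long as the own coordinate of the curve does not occur in the common part. -/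
lemma evalAt_eq (hrd : r < d) {w : Fin r → ℝ} {v : Vertex n} (hw : w v.1 = 0)
    (f : (Fin r → ℝ) × (Fin d → ℝ)) :
    evalAt d y w v f = f.1 v.1 + f.2 (Fin.castLE hrd.le v.1) * y v +
      (commonPart w f.2).eval (y v) := by
  have h1 : ∀ c, f.2 c * weightedCurve d w v.1 (y v) c =
      (if c = Fin.castLE hrd.le v.1 then f.2 c * y v else 0) +
        weight w c * f.2 c * y v ^ expo d r c := by
    intro c
    unfold weightedCurve
    by_cases hc : (c : ℕ) = v.1
    · have h2 : c = Fin.castLE hrd.le v.1 := Fin.ext hc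
      have h3 : weight w c = 0 := by
        have h4 : (c : ℕ) < r := hc ▸ v.1.2
        rw [weight, dif_pos h4, ← hw]
        congr 1
        exact Fin.ext hc
      rw [if_pos hc, if_pos h2, h3]
      ring
    · rw [if_neg hc, if_neg fun h => hc (by rw [h]; rfl)]
      ring
  rw [evalAt_apply, Finset.sum_congr rfl fun c _ => h1 c, Finset.sum_add_distrib,
    Finset.sum_ite_eq', if_pos (Finset.mem_univ _), commonPart, eval_finsetSum]
  simp only [eval_monomial]
  ring

/-- Any affine parts for the indices in `S` and any common part with admissible exponents come
from a functional. -/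
lemma exists_functional (hrd : r < d) {S : Finset (Fin r)} {w : Fin r → ℝ} (hw : ∀ i ∈ S, w i = 0)
    (a c : Fin r → ℝ) (q : ℝ[X]) (hq : q.support ⊆ exponents d w) :
    ∃ f : (Fin r → ℝ) × (Fin d → ℝ), ∀ v : Vertex n, v.1 ∈ S →
      evalAt d y w v f = a v.1 + c v.1 * y v + q.eval (y v) := by
  classical
  let g : Fin d → ℝ := fun b =>
    if h : ∃ i ∈ S, Fin.castLE hrd.le i = b then c h.choose else q.coeff (expo d r b) / weight w b
  have hg1 : ∀ i ∈ S, g (Fin.castLE hrd.le i) = c i := by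
    intro i hi
    have h : ∃ j ∈ S, Fin.castLE hrd.le j = Fin.castLE hrd.le i := ⟨i, hi, rfl⟩
    simp only [g, dif_pos h]
    congr 1
    exact Fin.castLE_injective hrd.le h.choose_spec.2
  have hw0 : ∀ b : Fin d, weight w b = 0 → q.coeff (expo d r b) = 0 := by
    intro b hb
    by_contra hne
    obtain ⟨b', hb', hbb⟩ := Finset.mem_image.1 (hq (mem_support_iff.2 hne))
    rw [expo_injective hrd hbb] at hb'
    exact (Finset.mem_filter.1 hb').2 hb
  have hg2 : ∀ b : Fin d, weight w b * g b = q.coeff (expo d r b) := by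
    intro b
    by_cases hb : weight w b = 0
    · rw [hb, zero_mul, hw0 b hb]
    · have h : ¬ ∃ i ∈ S, Fin.castLE hrd.le i = b := by
        rintro ⟨i, hi, rfl⟩
        apply hb
        rw [weight, dif_pos (by simp), ← hw i hi]
        rfl
      simp only [g, dif_neg h]
      field_simp
  have hq2 : commonPart w g = q := by
    ext m
    by_cases hm : ∃ b, expo d r b = m
    · obtain ⟨b, rfl⟩ := hm
      rw [commonPart_coeff hrd, hg2]
    · have h1 : m ∉ exponents d w := by
        intro h
        obtain ⟨b, _, hb⟩ := Finset.mem_image.1 h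
        exact hm ⟨b, hb⟩
      rw [notMem_support_iff.1 fun h => h1 (hq h),
        notMem_support_iff.1 fun h => h1 (commonPart_support w g h)]
  exact ⟨(a, g), fun v hv => by
    rw [evalAt_eq hrd (hw _ hv), hq2]
    change a v.1 + g (Fin.castLE hrd.le v.1) * y v + _ = _
    rw [hg1 _ hv]⟩

/-- The parameters of the vertices of color `i` in `A`. -/
noncomputable def fiberParams (y : Vertex n → ℝ) (A : Finset (Vertex n)) (i : Fin r) : Finset ℝ :=
  (A.filter fun v => v.1 = i).image y

lemma mem_fiberParams {A : Finset (Vertex n)} {i : Fin r} {x : ℝ} :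
    x ∈ fiberParams y A i ↔ ∃ v ∈ A, v.1 = i ∧ y v = x := by
  simp [fiberParams, and_assoc]

lemma OrderedParams.card_fiberParams (hy : OrderedParams y) (A : Finset (Vertex n)) (i : Fin r) :
    (fiberParams y A i).card = (A.filter fun v => v.1 = i).card := by
  refine Finset.card_image_of_injOn fun v hv v' hv' h => ?_
  simp only [Finset.coe_filter, Set.mem_ofPred_eq] at hv hv'
  exact hy.inj v v' (hv.2.trans hv'.2.symm) h

lemma OrderedParams.sum_card_fiberParams (hy : OrderedParams y) {A : Finset (Vertex n)}
    {S : Finset (Fin r)} (hA : colors A = S) :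
    ∑ i ∈ S, (fiberParams y A i).card = A.card := by
  rw [Finset.card_eq_sum_card_fiberwise (f := Sigma.fst) (t := S)]
  · exact Finset.sum_congr rfl fun i _ => hy.card_fiberParams A i
  · intro v hv
    rw [← hA]
    exact mem_colors hv

/-- The intervals spanned by the parameters of the vertices in `A`. -/
lemma OrderedParams.exists_intervals (hy : OrderedParams y) (A : Finset (Vertex n)) :
    ∃ lo hi : Fin r → ℝ, OrderedIntervals (colors A) lo hi ∧
      (∀ i ∈ colors A, lo i ∈ fiberParams y A i ∧ hi i ∈ fiberParams y A i) ∧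
      ∀ i ∈ colors A, ∀ x ∈ fiberParams y A i, lo i ≤ x ∧ x ≤ hi i := by
  have hne : ∀ i ∈ colors A, (fiberParams y A i).Nonempty := by
    intro i hi
    obtain ⟨v, hv, rfl⟩ := Finset.mem_image.1 hi
    exact ⟨y v, mem_fiberParams.2 ⟨v, hv, rfl, rfl⟩⟩
  have hex : ∀ i, ∃ l u : ℝ, i ∈ colors A → (l ∈ fiberParams y A i ∧ u ∈ fiberParams y A i) ∧
      ∀ x ∈ fiberParams y A i, l ≤ x ∧ x ≤ u := by
    intro i
    by_cases hi : i ∈ colors A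
    · exact ⟨(fiberParams y A i).min' (hne i hi), (fiberParams y A i).max' (hne i hi),
        fun _ => ⟨⟨Finset.min'_mem _ _, Finset.max'_mem _ _⟩, fun x hx =>
          ⟨Finset.min'_le _ _ hx, Finset.le_max' _ _ hx⟩⟩⟩
    · exact ⟨0, 0, fun h => absurd h hi⟩
  choose lo hi h using hex
  refine ⟨lo, hi, ⟨fun i hiA => ?_, fun i hiA j hjA hij => ?_⟩, fun i hiA => (h i hiA).1,
    fun i hiA => (h i hiA).2⟩
  · obtain ⟨v, _, _, hv⟩ := mem_fiberParams.1 (h i hiA).1.1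
    exact hv ▸ hy.pos v
  · obtain ⟨v, _, rfl, hv⟩ := mem_fiberParams.1 (h i hiA).1.2
    obtain ⟨v', _, rfl, hv'⟩ := mem_fiberParams.1 (h j hjA).1.1
    rw [← hv, ← hv']
    exact hy.lt v v' hij

/-- If the weights of the colors of `A` vanish, then `A` is a face as long as its size is less than
half of the number of parameters of the functionals. -/
lemma isFaceSet_of_weight_eq_zero (hrd : r < d) (hn : ∀ i, d + 1 ≤ n i) (hy : OrderedParams y)
    {w : Fin r → ℝ} {A : Finset (Vertex n)} (hw : ∀ i ∈ colors A, w i = 0)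
    (hcard : 2 * A.card + 1 ≤ 2 * (colors A).card + (exponents d w).card) :
    IsFaceSet (evalAt d y w) (vset n (colors A)) A := by
  set S := colors A with hS
  have hcS : colors (vset n S) = S := colors_vset hn S
  obtain ⟨lo', hi', -, hA0, hA1⟩ := hy.exists_intervals A
  obtain ⟨lo, hi, hord, hV0, hV1⟩ := hy.exists_intervals (vset n S)
  rw [hcS] at hord hV0 hV1
  have hAV : A ⊆ vset n S := subset_vset_iff.2 hS.ge
  have hfib : ∀ i, fiberParams y A i ⊆ fiberParams y (vset n S) i := by
    intro i x hx
    obtain ⟨v, hv, h1, h2⟩ := mem_fiberParams.1 hx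
    exact mem_fiberParams.2 ⟨v, hAV hv, h1, h2⟩
  have hle : S.card ≤ A.card := card_colors_le A
  obtain ⟨E, hE, hEc⟩ := Finset.exists_subset_card_eq
    (show 2 * A.card + 1 - 2 * S.card ≤ (exponents d w).card by omega)
  obtain ⟨a, c, q, hq, hf⟩ := exists_nonneg_family hord (fiberParams y A) hA0 hA1
    (fun i hi => ⟨(hV1 i hi _ (hfib i (hA0 i hi).1)).1, (hV1 i hi _ (hfib i (hA0 i hi).2)).2⟩) E
    (fun m hm => by
      obtain ⟨b, _, rfl⟩ := Finset.mem_image.1 (hE hm)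
      exact two_le_expo b)
    (by rw [hy.sum_card_fiberParams hS.symm, hEc]; omega)
  obtain ⟨f, hf'⟩ := exists_functional (y := y) hrd hw a c q (hq.trans hE)
  refine ⟨hAV, f, fun v hv => ?_, fun v hv hvA => ?_⟩
  · have hvS : v.1 ∈ S := mem_colors hv
    rw [hf' v hvS]
    exact (hf v.1 hvS).1 _ (mem_fiberParams.2 ⟨v, hv, rfl, rfl⟩)
  · have hvS : v.1 ∈ S := mem_vset.1 hv
    have hx := hV1 v.1 hvS (y v) (mem_fiberParams.2 ⟨v, hv, rfl, rfl⟩)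
    rw [hf' v hvS]
    refine (hf v.1 hvS).2 _ hx.1 hx.2 fun hx => ?_
    obtain ⟨v', hv', h1, h2⟩ := mem_fiberParams.1 hx
    exact hvA (hy.inj v' v h1 h2 ▸ hv')

/-- The weights of the limit systems: coordinates in `S` have weight `ζ`, the others `1`. -/
noncomputable def limitWeight (S : Finset (Fin r)) (ζ : ℝ) : Fin r → ℝ :=
  fun i => if i ∈ S then ζ else 1

lemma card_exponents (hrd : r < d) (w : Fin r → ℝ) :
    (exponents d w).card + (Finset.univ.filter fun i => w i = 0).card = d := by
  rw [exponents, Finset.card_image_of_injective _ (expo_injective hrd)]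
  have h1 : (Finset.univ.filter fun i => w i = 0).card =
      (Finset.univ.filter fun c : Fin d => ¬ weight w c ≠ 0).card := by
    rw [← Finset.card_map (Fin.castLEEmb hrd.le)]
    congr 1
    ext c
    simp only [Finset.mem_map, Finset.mem_filter, Finset.mem_univ, true_and, not_not,
      Fin.castLEEmb_apply]
    constructor
    · rintro ⟨i, hi, rfl⟩
      rw [weight, dif_pos (by simp), ← hi]
      rfl
    · intro hc
      rw [weight] at hc
      split_ifs at hc with h
      · exact ⟨⟨c, h⟩, hc, rfl⟩
      · exact absurd hc one_ne_zero
  rw [h1, Finset.card_filter_add_card_filter_not, Finset.card_univ, Fintype.card_fin]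

lemma card_exponents_limitWeight (hrd : r < d) (S : Finset (Fin r)) :
    (exponents d (limitWeight S 0)).card + S.card = d := by
  have h := card_exponents hrd (limitWeight S 0)
  have h1 : (Finset.univ.filter fun i => limitWeight S 0 i = 0) = S := by
    ext i
    by_cases h : i ∈ S <;> simp [limitWeight, h]
  rwa [h1] at h

lemma card_exponents_zero (hrd : r < d) : (exponents d (0 : Fin r → ℝ)).card = d - r := by
  have := card_exponents hrd (0 : Fin r → ℝ)
  simp at this
  omega

/-- In the limit system for `S`, sets with colors `S` and at least two elements of each of these
colors are in general position: a functional that vanishes on such a set has too many zeros. -/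
lemma separated_limit (hrd : r < d) (hy : OrderedParams y) {A : Finset (Vertex n)}
    (hA2 : ∀ i ∈ colors A, 2 ≤ (A.filter fun v => v.1 = i).card)
    (hcard : A.card = d + (colors A).card) :
    Separated (evalAt d y (limitWeight (colors A) 0)) A := by
  set S := colors A with hS
  set w := limitWeight S 0 with hwdef
  have hw : ∀ i ∈ S, w i = 0 := fun i hi => by simp [hwdef, limitWeight, hi]
  have hw1 : ∀ i ∉ S, w i = 1 := fun i hi => by simp [hwdef, limitWeight, hi]
  obtain ⟨lo, hi, hord, hA0, hA1⟩ := hy.exists_intervals A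
  -- evaluation on `A`, together with the constants for the other colors, is bijective by counting
  let T : ((Fin r → ℝ) × (Fin d → ℝ)) →ₗ[ℝ] (A → ℝ) × ((Finset.univ \ S : Finset (Fin r)) → ℝ) :=
    LinearMap.prod (LinearMap.pi fun v => evalAt d y w v)
      (LinearMap.pi fun i => (LinearMap.proj (i : Fin r)).comp (LinearMap.fst ℝ _ _))
  have hinj : Function.Injective T := by
    rw [← LinearMap.ker_eq_bot, LinearMap.ker_eq_bot']
    intro f hf
    have e1 : ∀ v ∈ A, evalAt d y w v f = 0 := fun v hv => congrFun (congrArg Prod.fst hf) ⟨v, hv⟩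
    have e2 : ∀ i, i ∉ S → f.1 i = 0 := fun i hi =>
      congrFun (congrArg Prod.snd hf) ⟨i, by simp [hi]⟩
    have h1 := card_exponents_limitWeight hrd S
    rw [← hwdef] at h1
    obtain ⟨hq, hac⟩ := family_eq_zero hord (fiberParams y A) hA1
      (fun i hi => by rw [hy.card_fiberParams]; exact hA2 i hi) (exponents d w)
      (fun m hm => by
        obtain ⟨b, _, rfl⟩ := Finset.mem_image.1 hm
        exact two_le_expo b)
      (by rw [← hS, hy.sum_card_fiberParams hS.symm]; omega)
      f.1 (fun i => f.2 (Fin.castLE hrd.le i)) (commonPart w f.2) (commonPart_support w f.2)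
      (fun i hi x hx => by
        obtain ⟨v, hv, rfl, rfl⟩ := mem_fiberParams.1 hx
        rw [← evalAt_eq hrd (hw _ hi)]
        exact e1 v hv)
    refine Prod.ext (funext fun i => ?_) (funext fun c => ?_)
    · by_cases hi : i ∈ S
      · exact (hac i hi).1
      · exact e2 i hi
    · by_cases hc : ∃ i ∈ S, Fin.castLE hrd.le i = c
      · obtain ⟨i, hi, rfl⟩ := hc
        exact (hac i hi).2
      · have h2 := commonPart_coeff hrd w f.2 c
        rw [hq, coeff_zero] at h2
        have h3 : weight w c = 1 := by
          rw [weight]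
          split_ifs with h
          · exact hw1 _ fun hi => hc ⟨⟨c, h⟩, hi, rfl⟩
          · rfl
        rw [h3, one_mul] at h2
        exact h2.symm
  have hsurj : Function.Surjective T := by
    refine (LinearMap.injective_iff_surjective_of_finrank_eq_finrank ?_).1 hinj
    simp only [Module.finrank_prod, Module.finrank_fintype_fun_eq_card, Fintype.card_fin,
      Fintype.card_coe, Finset.card_sdiff_of_subset (Finset.subset_univ S), Finset.card_univ]
    have h3 : S.card ≤ r := by simpa using Finset.card_le_univ S
    omega
  intro a ha
  obtain ⟨g, hg⟩ := hsurj (Pi.single ⟨a, ha⟩ 1, 0)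
  have hg' : ∀ b (hb : b ∈ A), evalAt d y w b g = (Pi.single ⟨a, ha⟩ 1 : A → ℝ) ⟨b, hb⟩ :=
    fun b hb => congrFun (congrArg Prod.fst hg) ⟨b, hb⟩
  refine ⟨g, by rw [hg' a ha]; simp, fun b hb hba => ?_⟩
  rw [hg' b hb, Pi.single_apply, if_neg]
  exact fun h => hba (congrArg Subtype.val h)

lemma continuous_evalAt_limitWeight (S : Finset (Fin r)) (v : Vertex n)
    (f : (Fin r → ℝ) × (Fin d → ℝ)) : Continuous fun ζ => evalAt d y (limitWeight S ζ) v f := by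
  simp only [evalAt_apply, weightedCurve]
  refine continuous_const.add (continuous_finsetSum _ fun c _ => continuous_const.mul ?_)
  split_ifs
  · exact continuous_const
  · refine Continuous.mul ?_ continuous_const
    unfold weight limitWeight
    split_ifs <;> fun_prop

/-- Rescaling the coordinates outside `S` identifies the system with parameter `ζ ≠ 0` with the
perturbed limit system for `S`. -/
lemma exists_rescale {S : Finset (Fin r)} {ζ : ℝ} (hζ : ζ ≠ 0)
    (f : (Fin r → ℝ) × (Fin d → ℝ)) : ∃ f' : (Fin r → ℝ) × (Fin d → ℝ), ∀ v : Vertex n, v.1 ∈ S →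
      evalAt d y (fun _ => ζ) v f' = evalAt d y (limitWeight S ζ) v f := by
  refine ⟨(f.1, fun c => if h : (c : ℕ) < r then
    (if ⟨c, h⟩ ∈ S then f.2 c else f.2 c / ζ) else f.2 c), fun v hv => ?_⟩
  rw [evalAt_apply, evalAt_apply]
  congr 1
  refine Finset.sum_congr rfl fun c _ => ?_
  unfold weightedCurve weight limitWeight
  by_cases hc : (c : ℕ) < r
  · by_cases hcS : (⟨c, hc⟩ : Fin r) ∈ S
    · simp [hc, hcS]
    · have hcv : ¬ (c : ℕ) = v.1 := by
        intro h
        apply hcS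
        have : (⟨c, hc⟩ : Fin r) = v.1 := Fin.ext h
        rwa [this]
      simp only [hc, hcS, hcv, dif_pos, if_false]
      field_simp
  · simp [hc]

open Filter Topology

/-- For small `ζ > 0` the vertices are in general position, by perturbation of the limit systems. -/
lemma eventually_genericConfig (hrd : r < d) (hn : ∀ i, d + 1 ≤ n i) (hy : OrderedParams y) :
    ∀ᶠ ζ in 𝓝[>] (0 : ℝ), GenericConfig d (evalAt d y fun _ => ζ) := by
  classical
  have h1 : ∀ᶠ ζ in 𝓝[>] (0 : ℝ), ∀ A : Finset (Vertex n),
      (∀ i ∈ colors A, 2 ≤ (A.filter fun v => v.1 = i).card) →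
      A.card = d + (colors A).card → Separated (evalAt d y fun _ => ζ) A := by
    rw [eventually_all]
    intro A
    by_cases hA : (∀ i ∈ colors A, 2 ≤ (A.filter fun v => v.1 = i).card) ∧
      A.card = d + (colors A).card
    · have h2 := eventually_separated (fun ζ => evalAt d y (limitWeight (colors A) ζ))
        (continuous_evalAt_limitWeight (colors A)) (separated_limit hrd hy hA.1 hA.2)
      filter_upwards [h2.filter_mono nhdsWithin_le_nhds, self_mem_nhdsWithin] with ζ h3 hζ _ _
      intro a ha
      obtain ⟨g, hg, hg'⟩ := h3 a ha
      obtain ⟨f, hf⟩ := exists_rescale (y := y) (S := colors A) (ne_of_gt hζ) g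
      exact ⟨f, by rw [hf a (mem_colors ha)]; exact hg, fun b hb hba => by
        rw [hf b (mem_colors hb)]; exact hg' b hb hba⟩
    · exact Eventually.of_forall fun ζ h2 h3 => absurd ⟨h2, h3⟩ hA
  filter_upwards [h1] with ζ hζ
  have hdim : Module.finrank ℝ ((Fin r → ℝ) × (Fin d → ℝ)) = d + r := by
    simp [add_comm]
  -- single vertices of a color can be added to the set of the other vertices
  have hsep : ∀ A : Finset (Vertex n), A.Nonempty → A.card = d + (colors A).card →
      Separated (evalAt d y fun _ => ζ) A := by
    intro A _ hA
    set S := (colors A).filter fun i => 2 ≤ (A.filter fun v => v.1 = i).card with hS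
    set A₁ := A.filter fun v => v.1 ∈ S with hA₁
    set A₂ := A.filter fun v => ¬ v.1 ∈ S with hA₂
    have hA12 : A₁ ∪ A₂ = A := Finset.filter_union_filter_not_eq _ _
    have hfib : ∀ i ∈ S, A₁.filter (fun v => v.1 = i) = A.filter fun v => v.1 = i := by
      intro i hi
      rw [hA₁, Finset.filter_filter]
      refine Finset.filter_congr fun v _ => ?_
      exact ⟨fun h => h.2, fun h => ⟨h ▸ hi, h⟩⟩
    have hc1 : colors A₁ = S := by
      ext i
      constructor
      · intro hi
        obtain ⟨v, hv, rfl⟩ := Finset.mem_image.1 hi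
        exact (Finset.mem_filter.1 hv).2
      · intro hi
        have h2 := (Finset.mem_filter.1 hi).2
        obtain ⟨v, hv⟩ := Finset.card_pos.1 (show 0 < (A.filter fun v => v.1 = i).card by omega)
        obtain ⟨hvA, hvi⟩ := Finset.mem_filter.1 hv
        exact hvi ▸ mem_colors (Finset.mem_filter.2 ⟨hvA, by rwa [hvi]⟩)
    have hinj : Set.InjOn Sigma.fst (A₂ : Set (Vertex n)) := by
      intro v hv v' hv' hvv
      rw [Finset.mem_coe, hA₂, Finset.mem_filter] at hv hv'
      by_contra hne
      apply hv.2
      rw [hS, Finset.mem_filter]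
      refine ⟨mem_colors hv.1, ?_⟩
      have : 1 < (A.filter fun u => u.1 = v.1).card :=
        Finset.one_lt_card.2 ⟨v, by simp [hv.1], v', by simp [hv'.1, hvv], hne⟩
      exact this
    have hc2 : colors A₂ = colors A \ S := by
      ext i
      rw [Finset.mem_sdiff]
      constructor
      · intro hi
        obtain ⟨v, hv, rfl⟩ := Finset.mem_image.1 hi
        exact ⟨mem_colors (Finset.mem_filter.1 hv).1, (Finset.mem_filter.1 hv).2⟩
      · rintro ⟨hi, hi'⟩
        obtain ⟨v, hv, rfl⟩ := Finset.mem_image.1 hi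
        exact mem_colors (Finset.mem_filter.2 ⟨hv, hi'⟩)
    have hcard2 : A₂.card = (colors A).card - S.card := by
      rw [← Finset.card_sdiff_of_subset (Finset.filter_subset _ _), ← hc2, colors,
        Finset.card_image_of_injOn hinj]
    have hcard1 : A₁.card = d + (colors A₁).card := by
      have h2 : A₁.card + A₂.card = A.card := Finset.card_filter_add_card_filter_not _
      have h3 : S.card ≤ (colors A).card := Finset.card_le_card (Finset.filter_subset _ _)
      rw [hc1]
      omega
    rw [← hA12]
    refine (hζ A₁ (fun i hi => ?_) hcard1).union_of_colors (evalAt_indicator _) A₂ hinj ?_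
    · rw [hc1] at hi
      rw [hfib i hi]
      exact (Finset.mem_filter.1 hi).2
    · intro b hb
      rw [hc1]
      exact (Finset.mem_filter.1 hb).2
  exact
    { finrank_eq := hdim
      indicator := evalAt_indicator _
      le_card := hn
      separated := hsep
      eq_zero := fun A hA hc f hf v hv =>
        (hsep A hA hc).eq_zero_of_card hdim (evalAt_indicator _) hn hc hf hv }

/-- For small `ζ > 0` the configuration is neighborly: in the limit system for the colors `S` of
`A`, the common parts have `d - |S|` exponents, so that there are `d + |S|` parameters. -/
lemma eventually_neighborlyConfig (hrd : r < d) (hn : ∀ i, d + 1 ≤ n i) (hy : OrderedParams y) :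
    ∀ᶠ ζ in 𝓝[>] (0 : ℝ), NeighborlyConfig d (evalAt d y fun _ => ζ) := by
  unfold NeighborlyConfig
  rw [eventually_all]
  intro A
  by_cases hA : 2 * A.card + 1 ≤ d + (colors A).card
  · have hface : ∀ B ⊆ A, colors B = colors A →
        IsFaceSet (evalAt d y (limitWeight (colors A) 0)) (vset n (colors A)) B := by
      intro B hB hBc
      rw [← hBc]
      have h1 := card_exponents_limitWeight hrd (colors B)
      have h2 := Finset.card_le_card hB
      rw [← hBc] at hA
      refine isFaceSet_of_weight_eq_zero hrd hn hy (fun i hi => by simp [limitWeight, hi]) ?_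
      omega
    have hsep := separated_of_forall_isFaceSet (evalAt_indicator _) hface
    have h2 := eventually_isFaceSet (fun ζ => evalAt d y (limitWeight (colors A) ζ))
      (continuous_evalAt_limitWeight (colors A)) hsep (hface A subset_rfl rfl)
    filter_upwards [h2.filter_mono nhdsWithin_le_nhds, self_mem_nhdsWithin] with ζ h3 hζ _ _
    obtain ⟨hAV, g, hg, hg'⟩ := h3
    obtain ⟨f, hf⟩ := exists_rescale (y := y) (S := colors A) (ne_of_gt hζ) g
    exact ⟨hAV, f, fun v hv => by rw [hf v (mem_colors hv)]; exact hg v hv, fun v hv hvA => by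
      rw [hf v (mem_vset.1 hv)]; exact hg' v hv hvA⟩
  · exact Eventually.of_forall fun ζ _ h => absurd h hA

end Construction

/-! ### Faces of the convex hull of a finite family of points -/

section Hulls

set_option linter.unusedSectionVars false

variable {E : Type*} [AddCommGroup E] [Module ℝ E] [TopologicalSpace E]
  {ι : Type*} [DecidableEq ι]
  {W : Type*} [NormedAddCommGroup W] [NormedSpace ℝ W] [FiniteDimensional ℝ W]

/-- A linear functional attains its maximum on a polytope in the convex hull of the vertices at
which it is maximal. -/
lemma maximizers_convexHull {p : ι → E} {V Z : Finset ι} (hZV : Z ⊆ V) (hZ : Z.Nonempty)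
    (l : E →ₗ[ℝ] ℝ) {m : ℝ} (hm : ∀ v ∈ Z, l (p v) = m) (hlt : ∀ v ∈ V, v ∉ Z → l (p v) < m) :
    {x ∈ convexHull ℝ (p '' V) | ∀ y ∈ convexHull ℝ (p '' V), l y ≤ l x} =
      convexHull ℝ (p '' Z) := by
  have hsub : p '' Z ⊆ p '' V := Set.image_mono hZV
  have hle : ∀ y ∈ convexHull ℝ (p '' V), l y ≤ m := by
    refine convexHull_min ?_ (convex_halfSpace_le l.isLinear m)
    rintro _ ⟨v, hv, rfl⟩
    by_cases h : v ∈ Z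
    · exact (hm v h).le
    · exact (hlt v hv h).le
  have heq : ∀ y ∈ convexHull ℝ (p '' Z), l y = m := by
    refine convexHull_min ?_ (convex_hyperplane l.isLinear m)
    rintro _ ⟨v, hv, rfl⟩
    exact hm v hv
  ext x
  constructor
  · rintro ⟨hx, hmax⟩
    have hxm : l x = m := by
      obtain ⟨z, hz⟩ := hZ
      refine le_antisymm (hle x hx) ?_
      rw [← hm z hz]
      exact hmax _ (subset_convexHull ℝ _ ⟨z, hZV hz, rfl⟩)
    by_cases hD : (V \ Z).Nonempty
    · have hVu : p '' (V : Set ι) = p '' Z ∪ p '' (V \ Z : Finset ι) := by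
        rw [← Set.image_union, ← Finset.coe_union, Finset.union_sdiff_of_subset hZV]
      have hlt' : ∀ y ∈ convexHull ℝ (p '' (V \ Z : Finset ι)), l y < m := by
        refine convexHull_min ?_ (convex_halfSpace_lt l.isLinear m)
        rintro _ ⟨v, hv, rfl⟩
        exact hlt v (Finset.mem_sdiff.1 hv).1 (Finset.mem_sdiff.1 hv).2
      rw [hVu, convexHull_union ((Finset.coe_nonempty.2 hZ).image _)
        ((Finset.coe_nonempty.2 hD).image _), mem_convexJoin] at hx
      obtain ⟨a, ha, b, hb, s, t, hs, ht, hst, rfl⟩ := hx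
      rw [map_add, map_smul, map_smul, heq a ha, smul_eq_mul, smul_eq_mul] at hxm
      have h1 := hlt' b hb
      have ht0 : t = 0 := by
        by_contra hne
        have htpos : 0 < t := lt_of_le_of_ne ht (Ne.symm hne)
        have h2 : t * l b < t * m := mul_lt_mul_of_pos_left h1 htpos
        have h3 : s * m + t * m = m := by rw [← add_mul, hst, one_mul]
        linarith
      rw [ht0, add_zero] at hst
      rw [ht0, hst, one_smul, zero_smul, add_zero]
      exact ha
    · have hVZ : V = Z := by
        rw [Finset.not_nonempty_iff_eq_empty, Finset.sdiff_eq_empty_iff_subset] at hD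
        exact Finset.Subset.antisymm hD hZV
      rwa [hVZ] at hx
  · intro hx
    refine ⟨convexHull_mono hsub hx, fun y hy => ?_⟩
    rw [heq x hx]
    exact hle y hy

/-- The functionals `ℓ v` on `W` are the evaluations at the points `p v` of affine functionals:
the elements of `W` represent exactly the functions `v ↦ m - l (p v)` on `V`, with `l` linear
and continuous. -/
structure Represents (ℓ : ι → W →ₗ[ℝ] ℝ) (p : ι → E) (V : Finset ι) : Prop where
  toDual : ∀ f, ∃ (l : StrongDual ℝ E) (m : ℝ), ∀ v ∈ V, ℓ v f = m - l (p v)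
  ofDual : ∀ (l : StrongDual ℝ E) (m : ℝ), ∃ f, ∀ v ∈ V, ℓ v f = m - l (p v)

variable {ℓ : ι → W →ₗ[ℝ] ℝ} {p : ι → E} {V Z : Finset ι}

lemma Represents.mono (h : Represents ℓ p V) (hZ : Z ⊆ V) : Represents ℓ p Z where
  toDual f := by
    obtain ⟨l, m, hl⟩ := h.toDual f
    exact ⟨l, m, fun v hv => hl v (hZ hv)⟩
  ofDual l m := by
    obtain ⟨f, hf⟩ := h.ofDual l m
    exact ⟨f, fun v hv => hf v (hZ hv)⟩

lemma Represents.isFace (h : Represents ℓ p V) (hZ : IsFaceSet ℓ V Z) (hne : Z.Nonempty) :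
    IsFace (convexHull ℝ (p '' V)) (convexHull ℝ (p '' Z)) := by
  obtain ⟨hZV, f, hf0, hf1⟩ := hZ
  obtain ⟨l, m, hl⟩ := h.toDual f
  refine ⟨((Finset.coe_nonempty.2 hne).image _).convexHull, fun _ => ⟨l, ?_⟩⟩
  refine (maximizers_convexHull hZV hne (l : E →ₗ[ℝ] ℝ) (m := m) (fun v hv => ?_)
    fun v hv hvZ => ?_).symm
  · have := hl v (hZV hv)
    rw [hf0 v hv] at this
    simp only [ContinuousLinearMap.coe_coe]
    linarith
  · have := hl v hv
    have := hf1 v hv hvZ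
    simp only [ContinuousLinearMap.coe_coe]
    linarith

lemma Represents.exists_eq_of_isFace (h : Represents ℓ p V) {F : Set E}
    (hF : IsFace (convexHull ℝ (p '' V)) F) :
    ∃ Z, IsFaceSet ℓ V Z ∧ Z.Nonempty ∧ F = convexHull ℝ (p '' Z) := by
  obtain ⟨⟨x, hxF⟩, hexp⟩ := hF
  obtain ⟨l, hl⟩ := hexp ⟨x, hxF⟩
  have hx : x ∈ convexHull ℝ (p '' V) ∧ ∀ y ∈ convexHull ℝ (p '' V), l y ≤ l x := by
    rw [hl] at hxF
    exact hxF
  have hle : ∀ v ∈ V, l (p v) ≤ l x := fun v hv => hx.2 _ (subset_convexHull ℝ _ ⟨v, hv, rfl⟩)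
  obtain ⟨f, hf⟩ := h.ofDual l (l x)
  set Z := V.filter fun v => l (p v) = l x with hZ
  have hne : Z.Nonempty := by
    by_contra hne
    have hlt : ∀ y ∈ convexHull ℝ (p '' V), l y < l x := by
      refine convexHull_min ?_ (convex_halfSpace_lt (l : E →ₗ[ℝ] ℝ).isLinear _)
      rintro _ ⟨v, hv, rfl⟩
      refine lt_of_le_of_ne (hle v hv) fun h => hne ⟨v, Finset.mem_filter.2 ⟨hv, h⟩⟩
    exact lt_irrefl _ (hlt x hx.1)
  have hlt : ∀ v ∈ V, v ∉ Z → l (p v) < l x := fun v hv hvZ =>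
    lt_of_le_of_ne (hle v hv) fun h => hvZ (Finset.mem_filter.2 ⟨hv, h⟩)
  refine ⟨Z, ⟨Finset.filter_subset _ _, f, fun v hv => ?_, fun v hv hvZ => ?_⟩, hne, ?_⟩
  · rw [hf v (Finset.mem_filter.1 hv).1, (Finset.mem_filter.1 hv).2, sub_self]
  · rw [hf v hv]
    exact sub_pos.2 (hlt v hv hvZ)
  · rw [hl, ← maximizers_convexHull (Finset.filter_subset _ _) hne (l : E →ₗ[ℝ] ℝ)
      (fun v hv => (Finset.mem_filter.1 hv).2) hlt]
    ext y
    refine ⟨fun hy => hy, fun hy => hy⟩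

/-- A face set is determined by its face. -/
lemma Represents.mem_of_mem_convexHull (h : Represents ℓ p V) (hZ : IsFaceSet ℓ V Z) {v : ι}
    (hv : v ∈ V) (hpv : p v ∈ convexHull ℝ (p '' Z)) : v ∈ Z := by
  obtain ⟨hZV, f, hf0, hf1⟩ := hZ
  obtain ⟨l, m, hl⟩ := h.toDual f
  have heq : ∀ y ∈ convexHull ℝ (p '' Z), l y = m := by
    refine convexHull_min ?_ (convex_hyperplane (l : E →ₗ[ℝ] ℝ).isLinear m)
    rintro _ ⟨z, hz, rfl⟩
    have := hl z (hZV hz)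
    rw [hf0 z hz] at this
    have h1 : l (p z) = m := by linarith
    exact h1
  by_contra hvZ
  have h1 := hl v hv
  rw [heq _ hpv, sub_self] at h1
  exact absurd h1 (hf1 v hv hvZ).ne'

lemma Represents.injOn (h : Represents ℓ p V) (hs : ∀ v ∈ V, IsFaceSet ℓ V {v}) :
    Set.InjOn p V := by
  intro v hv v' hv' hvv
  refine Finset.mem_singleton.1 (h.mem_of_mem_convexHull (hs v' hv') hv ?_)
  rw [hvv]
  exact subset_convexHull ℝ _ ⟨v', by simp, rfl⟩

lemma Represents.vertices_convexHull [IsTopologicalAddGroup E] [ContinuousSMul ℝ E]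
    (h : Represents ℓ p V) (hs : ∀ v ∈ V, IsFaceSet ℓ V {v}) :
    vertices (convexHull ℝ (p '' V)) = p '' V := by
  refine Set.Subset.antisymm extremePoints_convexHull_subset ?_
  rintro _ ⟨v, hv, rfl⟩
  have h1 := (h.isFace (hs v hv) (Finset.singleton_nonempty v)).2.isExtreme
  rw [Finset.coe_singleton, Set.image_singleton, convexHull_singleton] at h1
  exact isExtreme_singleton.1 h1

lemma dim_convexHull (s : Set E) : dim (convexHull ℝ s) = Module.finrank ℝ (vectorSpan ℝ s) := by
  rw [dim, ← direction_affineSpan, affineSpan_convexHull, direction_affineSpan]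

lemma dim_convexHull_mono [FiniteDimensional ℝ E] {s t : Set E} (h : s ⊆ t) :
    dim (convexHull ℝ s) ≤ dim (convexHull ℝ t) := by
  rw [dim_convexHull, dim_convexHull]
  exact Submodule.finrank_mono (vectorSpan_mono ℝ h)

lemma Represents.dim_convexHull (h : Represents ℓ p Z) (hZ : Separated ℓ Z) (hne : Z.Nonempty) :
    dim (convexHull ℝ (p '' Z)) = Z.card - 1 := by
  have haff : AffineIndependent ℝ (fun v : Z => p v) := by
    rw [affineIndependent_iff]
    intro s w hw0 hw1 a ha
    obtain ⟨g, hg, hg'⟩ := hZ a a.2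
    obtain ⟨l, m, hl⟩ := h.toDual g
    have h1 : ∑ b ∈ s, w b * ℓ b g = 0 := by
      have h2 := congrArg l hw1
      rw [map_sum, map_zero] at h2
      simp only [map_smul, smul_eq_mul] at h2
      rw [Finset.sum_congr rfl fun b _ => by rw [hl b b.2, mul_sub], Finset.sum_sub_distrib, h2,
        ← Finset.sum_mul, hw0, zero_mul, sub_zero]
    rw [Finset.sum_eq_single a, hg, mul_one] at h1
    · exact h1
    · intro b _ hb
      rw [hg' b b.2 fun h => hb (Subtype.ext h), mul_zero]
    · exact fun h => absurd ha h
  have hcard : 0 < Z.card := Finset.card_pos.2 hne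
  have h1 := haff.finrank_vectorSpan (n := Z.card - 1) (by rw [Fintype.card_coe]; omega)
  rw [CayleyTight.dim_convexHull, ← h1, Set.image_eq_range]
  rfl

lemma dim_convexHull_le_card (hne : Z.Nonempty) : dim (convexHull ℝ (p '' Z)) ≤ Z.card - 1 := by
  classical
  rw [dim_convexHull, ← Finset.coe_image]
  have h := finrank_vectorSpan_image_finset_le ℝ p Z (n := Z.card - 1)
    (by have := Finset.card_pos.2 hne; omega)
  exact h

/-- A face contains every set of vertices that extends its own vertex set without raising the
dimension. -/
lemma Represents.subset_of_dim_eq [FiniteDimensional ℝ E] (h : Represents ℓ p V) {B : Finset ι}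
    (hB : IsFaceSet ℓ V B) (hne : B.Nonempty) (hBZ : B ⊆ Z) (hZV : Z ⊆ V)
    (hdim : dim (convexHull ℝ (p '' B)) = dim (convexHull ℝ (p '' Z))) : Z ⊆ B := by
  obtain ⟨hBV, f, hf0, hf1⟩ := hB
  obtain ⟨l, m, hl⟩ := h.toDual f
  obtain ⟨b, hb⟩ := hne
  rw [CayleyTight.dim_convexHull, CayleyTight.dim_convexHull] at hdim
  have hspan := Submodule.eq_of_le_of_finrank_eq
    (vectorSpan_mono ℝ (Set.image_mono (f := p) (Finset.coe_subset.2 hBZ))) hdim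
  have hker : vectorSpan ℝ (p '' B) ≤ LinearMap.ker (l : E →ₗ[ℝ] ℝ) := by
    rw [vectorSpan_def, Submodule.span_le]
    rintro _ ⟨_, ⟨x, hx, rfl⟩, _, ⟨x', hx', rfl⟩, rfl⟩
    have h1 := hl x (hBV hx)
    have h2 := hl x' (hBV hx')
    rw [hf0 x hx] at h1
    rw [hf0 x' hx'] at h2
    simp only [vsub_eq_sub, SetLike.mem_coe, LinearMap.mem_ker, ContinuousLinearMap.coe_coe,
      map_sub]
    linarith
  intro z hz
  have h1 : p z -ᵥ p b ∈ vectorSpan ℝ (p '' Z) :=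
    vsub_mem_vectorSpan ℝ ⟨z, hz, rfl⟩ ⟨b, hBZ hb, rfl⟩
  rw [← hspan] at h1
  have h2 := hker h1
  simp only [vsub_eq_sub, LinearMap.mem_ker, ContinuousLinearMap.coe_coe, map_sub] at h2
  by_contra hzB
  have h3 := hf1 z (hZV hz) hzB
  have h4 := hf0 b hb
  rw [hl z (hZV hz)] at h3
  rw [hl b (hBV hb)] at h4
  linarith

end Hulls

/-! ### Mixed faces of the Cayley polytopes -/

section Cayley

set_option linter.unusedSectionVars false

variable {r d : ℕ} {n : Fin r → ℕ}

/-- The polytopes spanned by the points of each color. -/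
def hulls (pt : Vertex n → Fin d → ℝ) (i : Fin r) : Set (Fin d → ℝ) :=
  convexHull ℝ (Set.range fun j => pt ⟨i, j⟩)

/-- The point `pt v`, embedded into the space of the Cayley polytopes. -/
def cayleyPoint (pt : Vertex n → Fin d → ℝ) (v : Vertex n) : (Fin (r - 1) → ℝ) × (Fin d → ℝ) :=
  cayleyIncl v.1 (pt v)

/-- `ℓ v f` is the value at the embedded point `pt v` of the affine functional with linear part
`f.2` on `ℝ^d` and value `f.1 i` at `(e_i, 0)`. -/
def IsEval (ℓ : Vertex n → ((Fin r → ℝ) × (Fin d → ℝ)) →ₗ[ℝ] ℝ) (pt : Vertex n → Fin d → ℝ) :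
    Prop :=
  ∀ v f, ℓ v f = f.1 v.1 + ∑ c, f.2 c * pt v c

variable {pt : Vertex n → Fin d → ℝ} {ℓ : Vertex n → ((Fin r → ℝ) × (Fin d → ℝ)) →ₗ[ℝ] ℝ}

lemma exists_dual_eq_sum {m : ℕ} (f : Fin m → ℝ) :
    ∃ l : StrongDual ℝ (Fin m → ℝ), ∀ x, l x = ∑ c, f c * x c :=
  ⟨∑ c, f c • ContinuousLinearMap.proj c, fun x => by simp⟩

lemma dual_eq_sum {m : ℕ} (l : (Fin m → ℝ) →ₗ[ℝ] ℝ) :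
    ∃ f : Fin m → ℝ, ∀ x, l x = ∑ c, f c * x c := by
  refine ⟨fun c => l fun j => if c = j then 1 else 0, fun x => ?_⟩
  rw [LinearMap.pi_apply_eq_sum_univ]
  exact Finset.sum_congr rfl fun c _ => mul_comm _ _

lemma IsEval.indicator (h : IsEval ℓ pt) (i : Fin r) :
    ∃ e, ∀ v, ℓ v e = if v.1 = i then 1 else 0 :=
  ⟨(Pi.single i 1, 0), fun v => by simp [h v, Pi.single_apply]⟩

lemma IsEval.represents_point (h : IsEval ℓ pt) (i : Fin r) : Represents ℓ pt (vset n {i}) where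
  toDual f := by
    obtain ⟨l, hl⟩ := exists_dual_eq_sum f.2
    refine ⟨-l, f.1 i, fun v hv => ?_⟩
    rw [h v, Finset.mem_singleton.1 (mem_vset.1 hv), neg_apply, hl]
    ring
  ofDual l m := by
    obtain ⟨f, hf⟩ := dual_eq_sum (l : (Fin d → ℝ) →ₗ[ℝ] ℝ)
    refine ⟨(fun _ => m, -f), fun v _ => ?_⟩
    have h1 := hf (pt v)
    rw [ContinuousLinearMap.coe_coe] at h1
    rw [h v, h1]
    simp only [Pi.neg_apply, neg_mul, Finset.sum_neg_distrib, sub_eq_add_neg]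

lemma sum_mul_affBasis (a : Fin r → ℝ) (hr : 0 < r) (i : Fin r) :
    ∑ j : Fin (r - 1), (a ⟨j + 1, by omega⟩ - a ⟨0, hr⟩) * affBasis r i j = a i - a ⟨0, hr⟩ := by
  by_cases hi : (i : ℕ) = 0
  · have h0 : i = ⟨0, hr⟩ := Fin.ext hi
    rw [← h0, sub_self]
    refine Finset.sum_eq_zero fun j _ => ?_
    rw [affBasis, if_neg (by omega), mul_zero]
  · have hlt := i.2
    rw [Finset.sum_eq_single ⟨i - 1, by omega⟩]
    · have h1 : (⟨(i : ℕ) - 1 + 1, by omega⟩ : Fin r) = i := Fin.ext (by simp only; omega)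
      rw [affBasis, if_pos (by simp only; omega), mul_one]
      simp only [h1]
    · intro j _ hj
      rw [affBasis, if_neg, mul_zero]
      intro h
      exact hj (Fin.ext (by simp only; omega))
    · exact fun h => absurd (Finset.mem_univ _) h

lemma IsEval.represents_cayleyPoint (h : IsEval ℓ pt) (V : Finset (Vertex n)) :
    Represents ℓ (cayleyPoint pt) V where
  toDual f := by
    by_cases hr : 0 < r
    · obtain ⟨l, hl⟩ := exists_dual_eq_sum f.2
      obtain ⟨l', hl'⟩ := exists_dual_eq_sum
        fun j : Fin (r - 1) => f.1 ⟨j + 1, by omega⟩ - f.1 ⟨0, hr⟩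
      refine ⟨-(l'.comp (ContinuousLinearMap.fst ℝ _ _) +
        l.comp (ContinuousLinearMap.snd ℝ _ _)), f.1 ⟨0, hr⟩, fun v _ => ?_⟩
      have h1 : l' (cayleyPoint pt v).1 = f.1 v.1 - f.1 ⟨0, hr⟩ := by
        rw [hl']
        exact sum_mul_affBasis f.1 hr v.1
      have h2 : l (cayleyPoint pt v).2 = ∑ c, f.2 c * pt v c := hl _
      rw [h v]
      simp only [neg_apply, add_apply,
        ContinuousLinearMap.comp_apply, ContinuousLinearMap.coe_fst', ContinuousLinearMap.coe_snd',
        h1, h2]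
      ring
    · exact ⟨0, 0, fun v _ => absurd v.1.2 (by omega)⟩
  ofDual l m := by
    obtain ⟨f, hf⟩ := dual_eq_sum
      ((l : _ →ₗ[ℝ] ℝ).comp (LinearMap.inr ℝ (Fin (r - 1) → ℝ) (Fin d → ℝ)))
    refine ⟨(fun i => m - l (affBasis r i, 0), -f), fun v _ => ?_⟩
    have h1 := hf (pt v)
    simp only [LinearMap.comp_apply, LinearMap.inr_apply, ContinuousLinearMap.coe_coe] at h1
    have h2 : cayleyPoint pt v = (affBasis r v.1, 0) + (0, pt v) := by
      simp [cayleyPoint, cayleyIncl]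
    rw [h v, h2, map_add, h1]
    simp only [Pi.neg_apply, neg_mul, Finset.sum_neg_distrib]
    ring

lemma range_eq_image_vset (i : Fin r) :
    (Set.range fun j => pt ⟨i, j⟩) = pt '' (vset n {i} : Finset (Vertex n)) := by
  ext x
  constructor
  · rintro ⟨j, rfl⟩
    exact ⟨⟨i, j⟩, by simp [mem_vset], rfl⟩
  · rintro ⟨⟨i', j⟩, hv, rfl⟩
    obtain rfl : i' = i := Finset.mem_singleton.1 (mem_vset.1 hv)
    exact ⟨j, rfl⟩

lemma isFaceSet_singleton_of_mem (hs : ∀ v, IsFaceSet ℓ (vset n {v.1}) {v}) (i : Fin r) :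
    ∀ v ∈ vset n {i}, IsFaceSet ℓ (vset n {i}) {v} := by
  intro v hv
  obtain rfl : v.1 = i := Finset.mem_singleton.1 (mem_vset.1 hv)
  exact hs v

lemma IsEval.vertices_hulls (h : IsEval ℓ pt) (hs : ∀ v, IsFaceSet ℓ (vset n {v.1}) {v})
    (i : Fin r) : vertices (hulls pt i) = Set.range fun j => pt ⟨i, j⟩ := by
  rw [hulls, range_eq_image_vset]
  exact (h.represents_point i).vertices_convexHull (isFaceSet_singleton_of_mem hs i)

lemma IsEval.ncard_vertices_hulls (h : IsEval ℓ pt)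
    (hs : ∀ v, IsFaceSet ℓ (vset n {v.1}) {v}) (i : Fin r) :
    (vertices (hulls pt i)).ncard = n i := by
  rw [h.vertices_hulls hs, range_eq_image_vset,
    ((h.represents_point i).injOn (isFaceSet_singleton_of_mem hs i)).ncard_image,
    Set.ncard_coe_finset, card_vset, Finset.sum_singleton]

lemma IsEval.dim_hulls (h : IsEval ℓ pt) (hg : GenericConfig d ℓ) (i : Fin r) :
    dim (hulls pt i) = d := by
  refine le_antisymm ?_ ?_
  · exact (Submodule.finrank_le _).trans (by simp)
  · have hc := colors_vset hg.le_card {i}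
    obtain ⟨A, hAV, hA, hAc⟩ := exists_subset_colors_eq (Z := vset n {i}) (k := d + 1)
      (by rw [hc, Finset.card_singleton]; omega)
      (by simpa using le_card_vset hg.le_card (Finset.singleton_nonempty i))
    rw [hc] at hAc
    have hne : A.Nonempty := Finset.card_pos.1 (by omega)
    have h1 := ((h.represents_point i).mono hAV).dim_convexHull
      (hg.separated A hne (by rw [hAc, hA, Finset.card_singleton])) hne
    rw [hA, Nat.add_sub_cancel] at h1
    rw [hulls, range_eq_image_vset]
    calc d = _ := h1.symm
      _ ≤ _ := dim_convexHull_mono (Set.image_mono (Finset.coe_subset.2 hAV))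

lemma IsEval.cayleyPoint_injective (h : IsEval ℓ pt)
    (hs : ∀ v, IsFaceSet ℓ (vset n {v.1}) {v}) : Function.Injective (cayleyPoint pt) := by
  intro v v' hvv
  have hrep := h.represents_cayleyPoint (Finset.univ : Finset (Vertex n))
  have hval : ∀ f, ℓ v f = ℓ v' f := by
    intro f
    obtain ⟨l, m, hl⟩ := hrep.toDual f
    rw [hl v (Finset.mem_univ _), hl v' (Finset.mem_univ _), hvv]
  obtain ⟨e, he⟩ := h.indicator v'.1
  have hc : v.1 = v'.1 := by
    have h1 := hval e
    rw [he, he, if_pos rfl] at h1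
    by_contra hne
    rw [if_neg hne] at h1
    exact zero_ne_one h1
  obtain ⟨_, f, hf0, hf1⟩ := hs v'
  by_contra hne
  have h1 := hf1 v (by simp [mem_vset, hc]) (by simpa using hne)
  rw [hval f, hf0 v' (by simp)] at h1
  exact lt_irrefl _ h1

lemma IsEval.cayleyVertices_hulls (h : IsEval ℓ pt)
    (hs : ∀ v, IsFaceSet ℓ (vset n {v.1}) {v}) (i : Fin r) :
    cayleyVertices (hulls pt) i = cayleyPoint pt '' (vset n {i} : Finset (Vertex n)) := by
  rw [cayleyVertices, h.vertices_hulls hs, range_eq_image_vset, Set.image_image]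
  refine Set.image_congr fun v hv => ?_
  rw [← Finset.mem_singleton.1 (mem_vset.1 hv)]
  rfl

lemma IsEval.mem_cayleyVertices (h : IsEval ℓ pt)
    (hs : ∀ v, IsFaceSet ℓ (vset n {v.1}) {v}) (v : Vertex n) :
    cayleyPoint pt v ∈ cayleyVertices (hulls pt) v.1 := by
  rw [h.cayleyVertices_hulls hs]
  exact ⟨v, by simp [mem_vset], rfl⟩

lemma IsEval.iUnion_cayleyVertices (h : IsEval ℓ pt)
    (hs : ∀ v, IsFaceSet ℓ (vset n {v.1}) {v}) (R : Finset (Fin r)) :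
    ⋃ i ∈ R, cayleyVertices (hulls pt) i = cayleyPoint pt '' (vset n R : Finset (Vertex n)) := by
  ext x
  simp only [Set.mem_iUnion, h.cayleyVertices_hulls hs]
  constructor
  · rintro ⟨i, hi, v, hv, rfl⟩
    have hvi := Finset.mem_singleton.1 (mem_vset.1 hv)
    exact ⟨v, mem_vset.2 (hvi ▸ hi), rfl⟩
  · rintro ⟨v, hv, rfl⟩
    exact ⟨v.1, mem_vset.1 hv, v, by simp [mem_vset], rfl⟩

lemma IsEval.cayleyPolytope_hulls (h : IsEval ℓ pt)
    (hs : ∀ v, IsFaceSet ℓ (vset n {v.1}) {v}) (R : Finset (Fin r)) :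
    cayleyPolytope (hulls pt) R =
      convexHull ℝ (cayleyPoint pt '' (vset n R : Finset (Vertex n))) := by
  rw [cayleyPolytope, h.iUnion_cayleyVertices hs]

/-- The mixed faces of `C_R` are the convex hulls of the points of the sets in `mixedSets ℓ R`. -/
lemma IsEval.mixedFaces_eq (h : IsEval ℓ pt) (hs : ∀ v, IsFaceSet ℓ (vset n {v.1}) {v})
    {R : Finset (Fin r)} (hR : R.Nonempty) :
    mixedFaces (hulls pt) R = (fun Z : Finset (Vertex n) => convexHull ℝ (cayleyPoint pt '' Z)) ''
      (mixedSets ℓ R : Finset (Finset (Vertex n))) := by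
  have hrep := h.represents_cayleyPoint (vset n R)
  ext F
  constructor
  · rintro ⟨hF, hne, hcol⟩
    rw [h.cayleyPolytope_hulls hs] at hF hne
    obtain ⟨Z, hZ, hZne, rfl⟩ := hrep.exists_eq_of_isFace hF
    refine ⟨Z, mem_mixedSets.2 ⟨?_, fun hZV => hne (by rw [hZV]), hZ⟩, rfl⟩
    refine (subset_vset_iff.1 hZ.1).antisymm fun i hi => ?_
    obtain ⟨x, hx, hxi⟩ := hcol i hi
    rw [h.cayleyVertices_hulls hs] at hxi
    obtain ⟨v, hv, rfl⟩ := hxi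
    obtain rfl : v.1 = i := Finset.mem_singleton.1 (mem_vset.1 hv)
    exact mem_colors (hrep.mem_of_mem_convexHull hZ (mem_vset.2 hi) hx)
  · rintro ⟨Z, hZ, rfl⟩
    obtain ⟨hc, hne, hZ⟩ := mem_mixedSets.1 hZ
    refine ⟨?_, ?_, fun i hi => ?_⟩
    · rw [h.cayleyPolytope_hulls hs]
      exact hrep.isFace hZ (colors_nonempty.1 (hc ▸ hR))
    · rw [h.cayleyPolytope_hulls hs]
      intro heq
      refine hne (hZ.1.antisymm fun v hv => hrep.mem_of_mem_convexHull hZ hv ?_)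
      simp only at heq
      rw [heq]
      exact subset_convexHull ℝ _ ⟨v, hv, rfl⟩
    · rw [← hc] at hi
      obtain ⟨v, hv, rfl⟩ := Finset.mem_image.1 hi
      exact ⟨cayleyPoint pt v, subset_convexHull ℝ _ ⟨v, hv, rfl⟩, h.mem_cayleyVertices hs v⟩

lemma IsEval.numMixedFaces_eq (h : IsEval ℓ pt) (hs : ∀ v, IsFaceSet ℓ (vset n {v.1}) {v})
    {R : Finset (Fin r)} (hR : R.Nonempty) (k : ℕ) :
    numMixedFaces (hulls pt) R k = ((mixedSets ℓ R).filter
      fun Z : Finset (Vertex n) => dim (convexHull ℝ (cayleyPoint pt '' Z)) = k).card := by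
  have hrep := h.represents_cayleyPoint (vset n R)
  rw [numMixedFaces, ← Set.ncard_coe_finset]
  have hinj : Set.InjOn (fun Z : Finset (Vertex n) => convexHull ℝ (cayleyPoint pt '' Z))
      (mixedSets ℓ R : Finset (Finset (Vertex n))) := by
    have hle : ∀ Z ∈ mixedSets ℓ R, ∀ Z' ∈ mixedSets ℓ R,
        convexHull ℝ (cayleyPoint pt '' Z) = convexHull ℝ (cayleyPoint pt '' Z') → Z ⊆ Z' := by
      intro Z hZ Z' hZ' heq v hv
      refine hrep.mem_of_mem_convexHull (mem_mixedSets.1 hZ').2.2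
        ((mem_mixedSets.1 hZ).2.2.1 hv) ?_
      rw [← heq]
      exact subset_convexHull ℝ _ ⟨v, hv, rfl⟩
    exact fun Z hZ Z' hZ' heq => (hle Z hZ Z' hZ' heq).antisymm (hle Z' hZ' Z hZ heq.symm)
  rw [← (hinj.mono (Finset.coe_subset.2 (Finset.filter_subset _ _))).ncard_image]
  congr 1
  rw [h.mixedFaces_eq hs hR]
  ext F
  constructor
  · rintro ⟨⟨Z, hZ, rfl⟩, hdim⟩
    exact ⟨Z, Finset.mem_coe.2 (Finset.mem_filter.2 ⟨hZ, hdim⟩), rfl⟩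
  · rintro ⟨Z, hZ, rfl⟩
    obtain ⟨h1, h2⟩ := Finset.mem_filter.1 (Finset.mem_coe.1 hZ)
    exact ⟨⟨Z, h1, rfl⟩, h2⟩

lemma IsEval.numMixedFaces_of_generic (h : IsEval ℓ pt)
    (hs : ∀ v, IsFaceSet ℓ (vset n {v.1}) {v}) (hg : GenericConfig d ℓ)
    {R : Finset (Fin r)} (hR : R.Nonempty) {k : ℕ} (hk : k ≠ 0) :
    numMixedFaces (hulls pt) R (k - 1) =
      ((mixedSets ℓ R).filter fun Z => Z.card = k).card := by
  rw [h.numMixedFaces_eq hs hR]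
  congr 1
  refine Finset.filter_congr fun Z hZ => ?_
  have hne : Z.Nonempty := colors_nonempty.1 ((mem_mixedSets.1 hZ).1 ▸ hR)
  have hpos := Finset.card_pos.2 hne
  rw [(h.represents_cayleyPoint Z).dim_convexHull (hg.separated_of_mem hR hZ) hne]
  omega

/-- If all sets of `k` vertices with colors `R` are faces, then these are the mixed faces of
dimension `k - 1`. No general position is assumed: a mixed face of this dimension contains one of
these sets, which has the same dimension. -/
lemma IsEval.numMixedFaces_of_forall_isFaceSet (h : IsEval ℓ pt)
    (hs : ∀ v, IsFaceSet ℓ (vset n {v.1}) {v}) (hn : ∀ i, d + 1 ≤ n i)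
    {R : Finset (Fin r)} (hR : R.Nonempty) {k : ℕ} (hRk : R.card ≤ k) (hkR : k < d + R.card)
    (hface : ∀ B, colors B = R → B.card ≤ k → IsFaceSet ℓ (vset n R) B) :
    (numMixedFaces (hulls pt) R (k - 1) : ℤ) = spanCount n R k := by
  have hRpos := hR.card_pos
  have hdim : ∀ B : Finset (Vertex n), colors B = R → B.card = k →
      dim (convexHull ℝ (cayleyPoint pt '' B)) = k - 1 := by
    intro B hB hBk
    rw [(h.represents_cayleyPoint B).dim_convexHull ?_ (Finset.card_pos.1 (by omega)), hBk]
    refine separated_of_forall_isFaceSet h.indicator fun B' hB' hB'c => ?_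
    rw [hB]
    exact hface B' (hB'c.trans hB) (hBk ▸ Finset.card_le_card hB')
  rw [← card_spanning R (by omega), h.numMixedFaces_eq hs hR]
  congr 2
  ext Z
  simp only [Finset.mem_filter, Finset.mem_powersetCard, mem_mixedSets]
  constructor
  · rintro ⟨⟨hc, hne, hZ⟩, hZk⟩
    have hZne : Z.Nonempty := colors_nonempty.1 (hc ▸ hR)
    have hle := dim_convexHull_le_card (p := cayleyPoint pt) hZne
    have hpos := Finset.card_pos.2 hZne
    obtain ⟨B, hBZ, hBk, hBc⟩ := exists_subset_colors_eq (Z := Z) (k := k)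
      (by rw [hc]; exact hRk) (by omega)
    rw [hc] at hBc
    have hsub := (h.represents_cayleyPoint (vset n R)).subset_of_dim_eq (hface B hBc hBk.le)
      (Finset.card_pos.1 (by omega)) hBZ hZ.1 (by rw [hdim B hBc hBk, hZk])
    obtain rfl : B = Z := hBZ.antisymm hsub
    exact ⟨⟨hZ.1, hBk⟩, hc⟩
  · rintro ⟨⟨hZV, hZk⟩, hc⟩
    refine ⟨⟨hc, fun hZe => ?_, hface Z hc hZk.le⟩, hdim Z hc hZk⟩
    have h1 := le_card_vset hn hR
    rw [← hZe] at h1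
    omega

lemma IsEval.isMinkowskiNeighborly (h : IsEval ℓ pt)
    (hs : ∀ v, IsFaceSet ℓ (vset n {v.1}) {v}) (hg : GenericConfig d ℓ)
    (hN : NeighborlyConfig d ℓ) (R : Finset (Fin r)) : IsMinkowskiNeighborly (hulls pt) R := by
  classical
  intro S _ hS A hA hcol _ hcard
  have hinj := h.cayleyPoint_injective hs
  rw [h.iUnion_cayleyVertices hs] at hA
  obtain ⟨B, hBV, rfl⟩ : ∃ B ⊆ vset n S, cayleyPoint pt '' (B : Set (Vertex n)) = A := by
    refine ⟨(vset n S).filter fun v => cayleyPoint pt v ∈ A, Finset.filter_subset _ _, ?_⟩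
    ext x
    constructor
    · rintro ⟨v, hv, rfl⟩
      exact (Finset.mem_filter.1 (Finset.mem_coe.1 hv)).2
    · intro hx
      obtain ⟨v, hv, rfl⟩ := hA hx
      exact ⟨v, Finset.mem_coe.2 (Finset.mem_filter.2 ⟨hv, hx⟩), rfl⟩
  have hBc : colors B = S := by
    refine (subset_vset_iff.1 hBV).antisymm fun i hi => ?_
    obtain ⟨x, ⟨v, hv, rfl⟩, hx⟩ := hcol i hi
    rw [h.cayleyVertices_hulls hs] at hx
    obtain ⟨v', hv', hvv⟩ := hx
    obtain rfl := hinj hvv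
    rw [← Finset.mem_singleton.1 (mem_vset.1 hv')]
    exact mem_colors hv
  rw [Set.ncard_image_of_injective _ hinj, Set.ncard_coe_finset] at hcard
  have hSpos := hS.card_pos
  have hBne : B.Nonempty := colors_nonempty.1 (hBc ▸ hS)
  have hface := hN B hBne (by rw [hBc]; omega)
  rw [hBc] at hface
  have hsep : Separated ℓ B := hg.separated_of_card_le (by rw [hBc]; omega)
  refine ⟨?_, (h.represents_cayleyPoint B).vertices_convexHull fun v hv => ?_⟩
  · rw [h.cayleyPolytope_hulls hs]
    exact (h.represents_cayleyPoint _).isFace hface hBne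
  · exact IsFaceSet.subset_of_separated ⟨subset_rfl, 0, by simp, fun v hv hvB => absurd hv hvB⟩
      hsep (Finset.singleton_subset_iff.2 hv)

end Cayley

/-! ### Faces of the Minkowski sum -/

section Minkowski

set_option linter.unusedSectionVars false

variable {r d : ℕ} {n : Fin r → ℕ}
  {pt : Vertex n → Fin d → ℝ} {ℓ : Vertex n → ((Fin r → ℝ) × (Fin d → ℝ)) →ₗ[ℝ] ℝ}

/-- The choices of one vertex of each color from `Z`. -/
def selections (Z : Finset (Vertex n)) : Finset (∀ i, Fin (n i)) :=
  Finset.univ.filter fun c => ∀ i, ⟨i, c i⟩ ∈ Z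

/-- The sum of the points of a choice of vertices. -/
def sumPoint (pt : Vertex n → Fin d → ℝ) (c : ∀ i, Fin (n i)) : Fin d → ℝ := ∑ i, pt ⟨i, c i⟩

/-- The sum of the values of a functional at a choice of vertices. -/
noncomputable def sumEval (ℓ : Vertex n → ((Fin r → ℝ) × (Fin d → ℝ)) →ₗ[ℝ] ℝ)
    (c : ∀ i, Fin (n i)) : ((Fin r → ℝ) × (Fin d → ℝ)) →ₗ[ℝ] ℝ := ∑ i, ℓ ⟨i, c i⟩

lemma mem_selections {Z : Finset (Vertex n)} {c : ∀ i, Fin (n i)} :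
    c ∈ selections Z ↔ ∀ i, ⟨i, c i⟩ ∈ Z := by
  simp [selections]

lemma selections_mono {Z Z' : Finset (Vertex n)} (h : Z ⊆ Z') : selections Z ⊆ selections Z' :=
  fun _ hc => mem_selections.2 fun i => h (mem_selections.1 hc i)

lemma update_mem_selections {Z : Finset (Vertex n)} {c : ∀ i, Fin (n i)} (hc : c ∈ selections Z)
    {v : Vertex n} (hv : v ∈ Z) : Function.update c v.1 v.2 ∈ selections Z := by
  refine mem_selections.2 fun i => ?_
  by_cases hi : i = v.1
  · subst hi
    simpa using hv
  · rw [Function.update_of_ne hi]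
    exact mem_selections.1 hc i

lemma selections_nonempty {Z : Finset (Vertex n)} (hZ : colors Z = Finset.univ) :
    (selections Z).Nonempty := by
  have h : ∀ i, ∃ j, (⟨i, j⟩ : Vertex n) ∈ Z := by
    intro i
    have hi : i ∈ colors Z := hZ ▸ Finset.mem_univ i
    obtain ⟨v, hv, rfl⟩ := Finset.mem_image.1 hi
    exact ⟨v.2, hv⟩
  choose c hc using h
  exact ⟨c, mem_selections.2 hc⟩

lemma subset_of_selections_subset {Z Z' : Finset (Vertex n)} (hZ : colors Z = Finset.univ)
    (h : selections Z ⊆ selections Z') : Z ⊆ Z' := by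
  intro v hv
  obtain ⟨c, hc⟩ := selections_nonempty hZ
  have h1 := mem_selections.1 (h (update_mem_selections hc hv)) v.1
  simpa using h1

lemma minkowskiSum_hulls : minkowskiSum (hulls pt) = convexHull ℝ (sumPoint pt ''
    (Finset.univ : Finset (∀ i, Fin (n i)))) := by
  unfold minkowskiSum hulls
  rw [← convexHull_sum]
  congr 1
  ext x
  rw [Set.mem_fintype_sum]
  constructor
  · rintro ⟨g, hg, rfl⟩
    choose c hc using hg
    exact ⟨c, by simp, Finset.sum_congr rfl fun i _ => hc i⟩
  · rintro ⟨c, _, rfl⟩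
    exact ⟨fun i => pt ⟨i, c i⟩, fun i => ⟨c i, rfl⟩, rfl⟩

lemma IsEval.sumEval_apply (h : IsEval ℓ pt) (c : ∀ i, Fin (n i))
    (f : (Fin r → ℝ) × (Fin d → ℝ)) :
    sumEval ℓ c f = ∑ i, f.1 i + ∑ b, f.2 b * sumPoint pt c b := by
  simp only [sumEval, LinearMap.sum_apply, h _ f, Finset.sum_add_distrib, sumPoint,
    Finset.sum_apply, Finset.mul_sum]
  rw [Finset.sum_comm]

lemma IsEval.represents_sumPoint (h : IsEval ℓ pt) (hr : 0 < r) :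
    Represents (sumEval ℓ) (sumPoint pt) Finset.univ where
  toDual f := by
    obtain ⟨l, hl⟩ := exists_dual_eq_sum f.2
    refine ⟨-l, ∑ i, f.1 i, fun c _ => ?_⟩
    rw [h.sumEval_apply, neg_apply, hl]
    ring
  ofDual l m := by
    obtain ⟨f, hf⟩ := dual_eq_sum (l : (Fin d → ℝ) →ₗ[ℝ] ℝ)
    refine ⟨(Pi.single ⟨0, hr⟩ m, -f), fun c _ => ?_⟩
    have h1 := hf (sumPoint pt c)
    rw [ContinuousLinearMap.coe_coe] at h1
    rw [h.sumEval_apply, h1]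
    simp [sub_eq_add_neg]

lemma isFaceSet_selections {Z : Finset (Vertex n)} (hZ : IsFaceSet ℓ (vset n Finset.univ) Z) :
    IsFaceSet (sumEval ℓ) Finset.univ (selections Z) := by
  obtain ⟨_, f, hf0, hf1⟩ := hZ
  have hnn : ∀ v, 0 ≤ ℓ v f := by
    intro v
    by_cases hv : v ∈ Z
    · exact (hf0 v hv).ge
    · exact (hf1 v (by simp [mem_vset]) hv).le
  refine ⟨Finset.subset_univ _, f, fun c hc => ?_, fun c _ hc => ?_⟩
  · rw [sumEval, LinearMap.sum_apply]
    exact Finset.sum_eq_zero fun i _ => hf0 _ (mem_selections.1 hc i)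
  · rw [mem_selections, not_forall] at hc
    obtain ⟨i, hi⟩ := hc
    rw [sumEval, LinearMap.sum_apply]
    exact Finset.sum_pos' (fun i _ => hnn _) ⟨i, Finset.mem_univ _, hf1 _ (by simp [mem_vset]) hi⟩

/-- A face of the Minkowski sum decomposes into faces of the summands. The functional is
normalized so that its minimum on each summand is zero. -/
lemma exists_eq_selections (hind : ∀ i : Fin r, ∃ e, ∀ v, ℓ v e = if v.1 = i then 1 else 0)
    {C : Finset (∀ i, Fin (n i))} (hC : IsFaceSet (sumEval ℓ) Finset.univ C) (hne : C.Nonempty) :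
    ∃ Z, IsFaceSet ℓ (vset n Finset.univ) Z ∧ colors Z = Finset.univ ∧ C = selections Z := by
  classical
  choose e he using hind
  obtain ⟨_, f', hf0, hf1⟩ := hC
  obtain ⟨c₀, hc₀⟩ := hne
  set f := f' - ∑ i, ℓ ⟨i, c₀ i⟩ f' • e i with hfdef
  have hf : ∀ v, ℓ v f = ℓ v f' - ℓ ⟨v.1, c₀ v.1⟩ f' := by
    intro v
    simp [hfdef, he]
  have hnn' : ∀ c, 0 ≤ sumEval ℓ c f' := by
    intro c
    by_cases hc : c ∈ C
    · exact (hf0 c hc).ge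
    · exact (hf1 c (Finset.mem_univ _) hc).le
  have hsum : ∀ c, sumEval ℓ c f' = ∑ i, ℓ ⟨i, c i⟩ f := by
    intro c
    have h1 := hf0 c₀ hc₀
    rw [sumEval, LinearMap.sum_apply] at h1
    rw [Finset.sum_congr rfl fun i _ => hf ⟨i, c i⟩, Finset.sum_sub_distrib]
    simp only
    rw [h1, sub_zero, sumEval, LinearMap.sum_apply]
  have hnn : ∀ v, 0 ≤ ℓ v f := by
    intro v
    have h1 := hnn' (Function.update c₀ v.1 v.2)
    rw [hsum, Finset.sum_eq_single v.1] at h1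
    · simpa using h1
    · intro i _ hi
      rw [Function.update_of_ne hi, hf, sub_self]
    · exact fun h => absurd (Finset.mem_univ _) h
  refine ⟨Finset.univ.filter fun v => ℓ v f = 0, ⟨fun v _ => by simp [mem_vset], f,
    fun v hv => (Finset.mem_filter.1 hv).2, fun v _ hv => lt_of_le_of_ne (hnn v) fun h =>
      hv (Finset.mem_filter.2 ⟨Finset.mem_univ _, h.symm⟩)⟩, ?_, ?_⟩
  · refine Finset.eq_univ_of_forall fun i => ?_
    exact mem_colors (v := ⟨i, c₀ i⟩)
      (Finset.mem_filter.2 ⟨Finset.mem_univ _, by rw [hf, sub_self]⟩)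
  · ext c
    rw [mem_selections]
    have h1 : c ∈ C ↔ sumEval ℓ c f' = 0 := by
      constructor
      · exact hf0 c
      · intro h
        by_contra hc
        exact (hf1 c (Finset.mem_univ _) hc).ne' h
    rw [h1, hsum, Finset.sum_eq_zero_iff_of_nonneg fun i _ => hnn _]
    simp

/-- The face of the Minkowski sum given by a set `Z` in general position: the differences of the
points of `Z` and one selected point of the same color are a basis of its direction. -/
lemma IsEval.dim_selections (h : IsEval ℓ pt) {Z : Finset (Vertex n)} (hsep : Separated ℓ Z)
    (hZ : colors Z = Finset.univ) :
    dim (convexHull ℝ (sumPoint pt '' selections Z)) = Z.card - r := by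
  classical
  obtain ⟨c₀, hc₀⟩ := selections_nonempty hZ
  set S : Finset (Vertex n) := Finset.univ.image fun i => (⟨i, c₀ i⟩ : Vertex n) with hS
  have hSZ : S ⊆ Z := by
    intro v hv
    obtain ⟨i, _, rfl⟩ := Finset.mem_image.1 hv
    exact mem_selections.1 hc₀ i
  have hScard : S.card = r := by
    rw [hS, Finset.card_image_of_injective _ fun i j hij => congrArg Sigma.fst hij]
    simp
  let u : Vertex n → Fin d → ℝ := fun v => pt v - pt ⟨v.1, c₀ v.1⟩
  have hmemS : ∀ i, (⟨i, c₀ i⟩ : Vertex n) ∈ S := fun i =>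
    Finset.mem_image_of_mem _ (Finset.mem_univ i)
  have hindep : LinearIndependent ℝ fun v : (Z \ S : Finset (Vertex n)) => u v := by
    rw [Fintype.linearIndependent_iff]
    intro w hw a
    obtain ⟨haZ, haS⟩ := Finset.mem_sdiff.1 a.2
    obtain ⟨g, hg, hg'⟩ := hsep a haZ
    obtain ⟨l, hl⟩ := exists_dual_eq_sum g.2
    have hlu : ∀ v, l (u v) = ℓ v g - ℓ ⟨v.1, c₀ v.1⟩ g := by
      intro v
      rw [map_sub, hl, hl, h v, h ⟨v.1, c₀ v.1⟩]
      ring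
    have hzero : ∀ i, ℓ ⟨i, c₀ i⟩ g = 0 := fun i =>
      hg' _ (hSZ (hmemS i)) fun heq => haS (heq ▸ hmemS i)
    have h1 := congrArg l hw
    simp only [map_sum, map_smul, smul_eq_mul, map_zero, hlu, hzero, sub_zero] at h1
    rw [Finset.sum_eq_single a, hg, mul_one] at h1
    · exact h1
    · intro b _ hb
      rw [hg' b (Finset.mem_sdiff.1 b.2).1 fun heq => hb (Subtype.ext heq), mul_zero]
    · exact fun h => absurd (Finset.mem_univ _) h
  have hspan : vectorSpan ℝ (sumPoint pt '' selections Z) =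
      Submodule.span ℝ (Set.range fun v : (Z \ S : Finset (Vertex n)) => u v) := by
    rw [vectorSpan_eq_span_vsub_set_right ℝ
      (Set.mem_image_of_mem (sumPoint pt) (Finset.mem_coe.2 hc₀))]
    refine le_antisymm (Submodule.span_le.2 ?_) (Submodule.span_le.2 ?_)
    · rintro _ ⟨_, ⟨c, hc, rfl⟩, rfl⟩
      have h1 : sumPoint pt c -ᵥ sumPoint pt c₀ = ∑ i, u ⟨i, c i⟩ := by
        rw [vsub_eq_sub, sumPoint, sumPoint, ← Finset.sum_sub_distrib]
      simp only [SetLike.mem_coe]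
      rw [h1]
      refine Submodule.sum_mem _ fun i _ => ?_
      by_cases hi : (⟨i, c i⟩ : Vertex n) ∈ S
      · obtain ⟨j, _, hj⟩ := Finset.mem_image.1 hi
        have hu : u ⟨i, c i⟩ = 0 := by
          rw [← hj]
          exact sub_self _
        rw [hu]
        exact Submodule.zero_mem _
      · exact Submodule.subset_span
          ⟨⟨⟨i, c i⟩, Finset.mem_sdiff.2 ⟨mem_selections.1 hc i, hi⟩⟩, rfl⟩
    · rintro _ ⟨v, rfl⟩
      refine Submodule.subset_span ⟨_, ⟨_, Finset.mem_coe.2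
        (update_mem_selections hc₀ (Finset.mem_sdiff.1 v.2).1), rfl⟩, ?_⟩
      simp only [vsub_eq_sub, sumPoint]
      rw [← Finset.sum_sub_distrib, Finset.sum_eq_single v.1.1]
      · simp [u]
      · intro i _ hi
        rw [Function.update_of_ne hi, sub_self]
      · exact fun h => absurd (Finset.mem_univ _) h
  rw [dim_convexHull, hspan, finrank_span_eq_card hindep, Fintype.card_coe,
    Finset.card_sdiff_of_subset hSZ, hScard]

lemma IsEval.le_dim_minkowskiSum (h : IsEval ℓ pt) (hg : GenericConfig d ℓ) (hr : 0 < r) :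
    d ≤ dim (convexHull ℝ (sumPoint pt '' selections (vset n Finset.univ))) := by
  have hne : (Finset.univ : Finset (Fin r)).Nonempty := ⟨⟨0, hr⟩, Finset.mem_univ _⟩
  have hc := colors_vset hg.le_card Finset.univ
  obtain ⟨A, hAV, hA, hAc⟩ := exists_subset_colors_eq (Z := vset n Finset.univ) (k := d + r)
    (by rw [hc]; simp) (by simpa using le_card_vset hg.le_card hne)
  rw [hc] at hAc
  have h1 := h.dim_selections (hg.separated_of_card_le (by rw [hA, hAc]; simp)) hAc
  rw [hA, Nat.add_sub_cancel] at h1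
  calc d = _ := h1.symm
    _ ≤ _ := dim_convexHull_mono (Set.image_mono (Finset.coe_subset.2 (selections_mono hAV)))

/-- The faces of the Minkowski sum of dimension `k - 1` correspond to the mixed faces of the
Cayley polytope of all summands of dimension `k + r - 2`. -/
lemma IsEval.numFaces_minkowskiSum (h : IsEval ℓ pt) (hg : GenericConfig d ℓ) (hr : 0 < r)
    {k : ℕ} (hk : 1 ≤ k) (hkd : k ≤ d) :
    numFaces (minkowskiSum (hulls pt)) (k - 1) =
      ((mixedSets ℓ Finset.univ).filter fun Z => Z.card = k + r - 1).card := by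
  have hrep := h.represents_sumPoint hr
  have hne : (Finset.univ : Finset (Fin r)).Nonempty := ⟨⟨0, hr⟩, Finset.mem_univ _⟩
  have hinj : Set.InjOn (fun Z : Finset (Vertex n) => convexHull ℝ (sumPoint pt '' selections Z))
      (mixedSets ℓ Finset.univ : Finset (Finset (Vertex n))) := by
    have hle : ∀ Z ∈ mixedSets ℓ Finset.univ, ∀ Z' ∈ mixedSets ℓ Finset.univ,
        convexHull ℝ (sumPoint pt '' selections Z) =
          convexHull ℝ (sumPoint pt '' selections Z') → Z ⊆ Z' := by
      intro Z hZ Z' hZ' heq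
      refine subset_of_selections_subset (mem_mixedSets.1 hZ).1 fun c hc => ?_
      refine hrep.mem_of_mem_convexHull (isFaceSet_selections (mem_mixedSets.1 hZ').2.2)
        (Finset.mem_univ _) ?_
      rw [← heq]
      exact subset_convexHull ℝ _ ⟨c, hc, rfl⟩
    exact fun Z hZ Z' hZ' heq => (hle Z hZ Z' hZ' heq).antisymm (hle Z' hZ' Z hZ heq.symm)
  have hdim : ∀ Z ∈ mixedSets ℓ Finset.univ,
      (dim (convexHull ℝ (sumPoint pt '' selections Z)) = k - 1 ↔ Z.card = k + r - 1) := by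
    intro Z hZ
    have hc := (mem_mixedSets.1 hZ).1
    rw [h.dim_selections (hg.separated_of_mem hne hZ) hc]
    have h1 := card_colors_le Z
    rw [hc, Finset.card_univ, Fintype.card_fin] at h1
    omega
  rw [numFaces, minkowskiSum_hulls, ← Set.ncard_coe_finset,
    ← (hinj.mono (Finset.coe_subset.2 (Finset.filter_subset _ _))).ncard_image]
  congr 1
  ext F
  constructor
  · rintro ⟨hF, hFdim⟩
    obtain ⟨C, hC, hCne, rfl⟩ := hrep.exists_eq_of_isFace hF
    obtain ⟨Z, hZ, hZc, rfl⟩ := exists_eq_selections h.indicator hC hCne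
    have hZV : Z ≠ vset n Finset.univ := by
      rintro rfl
      have := h.le_dim_minkowskiSum hg hr
      omega
    have hZm : Z ∈ mixedSets ℓ Finset.univ := mem_mixedSets.2 ⟨hZc, hZV, hZ⟩
    exact ⟨Z, Finset.mem_coe.2 (Finset.mem_filter.2 ⟨hZm, (hdim Z hZm).1 hFdim⟩), rfl⟩
  · rintro ⟨Z, hZ, rfl⟩
    obtain ⟨h1, h2⟩ := Finset.mem_filter.1 (Finset.mem_coe.1 hZ)
    obtain ⟨hZc, -, hZf⟩ := mem_mixedSets.1 h1
    exact ⟨hrep.isFace (isFaceSet_selections hZf) (selections_nonempty hZc), (hdim Z h1).2 h2⟩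

end Minkowski

/-! ### The polytopes of the construction -/

section Params

variable {r d : ℕ} {n : Fin r → ℕ}

/-- The parameters of the points on the curves. -/
noncomputable def curveParam (p : Params r n) (τ : ℝ) (v : Vertex n) : ℝ :=
  p.x v.1 v.2 * τ ^ p.β v.1

/-- As `β` is decreasing, the factors `τ ^ β i` increase with `i` for `τ < 1`, so that they preserve
the order of the parameters. -/
lemma orderedParams_curveParam (p : Params r n) {τ : ℝ} (h0 : 0 < τ) (h1 : τ < 1) :
    OrderedParams (curveParam p τ) where
  pos v := mul_pos (p.x_pos _ _) (pow_pos h0 _)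
  lt v w hvw := mul_lt_mul'' (p.x_lt _ _ hvw _ _) (pow_lt_pow_right_of_lt_one₀ h0 h1
    (p.β_strictAnti hvw)) (p.x_pos _ _).le (pow_pos h0 _).le
  inj := by
    rintro ⟨i, j⟩ ⟨i', j'⟩ hvw h
    obtain rfl : i = i' := hvw
    have h2 := mul_right_cancel₀ (pow_pos h0 _).ne' h
    exact congrArg (Sigma.mk i) ((p.x_strictMono i).injective h2)

lemma isEval_evalAt (p : Params r n) (τ ζ : ℝ) :
    IsEval (evalAt d (curveParam p τ) fun _ => ζ) fun v => point d p τ ζ v.1 v.2 := by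
  intro v f
  rw [evalAt_apply]
  congr 1
  refine Finset.sum_congr rfl fun c _ => ?_
  simp only [weightedCurve, weight, expo, point, curve, curveParam]
  split_ifs <;> simp

/-- The points on the curves with `ζ = 0`: every small set that contains a vertex of each color in
`R` is a face, and there are no other mixed faces of small dimension. -/
lemma numMixedFaces_poly_zero (hrd : r < d) (hn : ∀ i, d + 1 ≤ n i) (p : Params r n) {τ : ℝ}
    (hy : OrderedParams (curveParam p τ)) {R : Finset (Fin r)} (hR : R.Nonempty) {k : ℕ}
    (hRk : R.card ≤ k) (hk : k ≤ (d - r + 2 * R.card - 1) / 2) :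
    (numMixedFaces (poly d p τ 0) R (k - 1) : ℤ) = spanCount n R k := by
  have hpos := hR.card_pos
  have hface : ∀ B : Finset (Vertex n), 2 * B.card + 1 ≤ 2 * (colors B).card + (d - r) →
      IsFaceSet (evalAt d (curveParam p τ) fun _ => 0) (vset n (colors B)) B := by
    intro B hB
    refine isFaceSet_of_weight_eq_zero hrd hn hy (fun _ _ => rfl) ?_
    have h1 := card_exponents_zero hrd
    rw [show (fun _ : Fin r => (0 : ℝ)) = 0 from rfl, h1]
    exact hB
  refine (isEval_evalAt p τ 0).numMixedFaces_of_forall_isFaceSet (fun v => ?_) hn hR hRk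
    (by omega) fun B hB hBk => ?_
  · have h1 := hface {v}
    rw [colors, Finset.image_singleton] at h1
    refine h1 ?_
    simp only [Finset.card_singleton]
    omega
  · rw [← hB]
    refine hface B ?_
    rw [hB]
    omega

end Params

end CayleyTight

theorem mainTheorem7 (d r : ℕ) (hr : 1 ≤ r) (hrd : r < d) (n : Fin r → ℕ)
    (hn : ∀ i, d + 1 ≤ n i) (p : Params r n) :
    ∃ τ₀ : ℝ, 0 < τ₀ ∧ ∀ τ : ℝ, 0 < τ → τ < τ₀ →
      -- the unperturbed polytopes, `ζ = 0`
      (∀ R : Finset (Fin r), R.Nonempty →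
        ∀ k : ℕ, R.card ≤ k → k ≤ (d - r + 2 * R.card - 1) / 2 →
          (numMixedFaces (poly d p τ 0) R (k - 1) : ℤ) = faceBound d n R k) ∧
      -- the perturbed polytopes
      ∃ ζ₀ : ℝ, 0 < ζ₀ ∧ ∀ ζ : ℝ, 0 < ζ → ζ < ζ₀ →
        -- `P_i` is a `d`-polytope with exactly `n_i` vertices, the chosen points
        (∀ i, dim (poly d p τ ζ i) = d ∧
          vertices (poly d p τ ζ i) = Set.range (point d p τ ζ i) ∧
          (vertices (poly d p τ ζ i)).ncard = n i) ∧
        -- the numbers of mixed faces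
        (∀ R : Finset (Fin r), R.Nonempty →
          ∀ k : ℕ, R.card ≤ k → k ≤ (d + R.card - 1) / 2 →
            (numMixedFaces (poly d p τ ζ) R (k - 1) : ℤ) = faceBound d n R k) ∧
        -- the Cayley polytope is Minkowski-neighborly
        IsMinkowskiNeighborly (poly d p τ ζ) Finset.univ ∧
        -- the upper bounds for the face numbers of the Minkowski sum are attained
        (∀ k : ℕ, 1 ≤ k → k ≤ d →
          (numFaces (minkowskiSum (poly d p τ ζ)) (k - 1) : ℤ) =
            faceBound d n Finset.univ (k + r - 1)) := by
  -- `τ < 1` is all that is needed: it puts the parameters of the polytopes in increasing order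
  refine ⟨1, one_pos, fun τ hτ0 hτ1 => ?_⟩
  have hy := orderedParams_curveParam p hτ0 hτ1
  have hd : 1 ≤ d := by omega
  have hev := (eventually_genericConfig hrd hn hy).and (eventually_neighborlyConfig hrd hn hy)
  refine ⟨fun R hR k hRk hk => ?_, ?_⟩
  · have hpos := hR.card_pos
    have hRr : R.card ≤ r := by simpa using Finset.card_le_univ R
    -- the bound is identified with a number of vertex sets through some perturbed configuration
    obtain ⟨ζ, hg, hN⟩ := hev.exists
    rw [numMixedFaces_poly_zero hrd hn p hy hR hRk hk]
    exact hg.spanCount_eq_faceBound hN hd hR (by omega) (by omega)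
  · obtain ⟨ζ₀, hζ₀, hev⟩ := mem_nhdsGT_iff_exists_Ioo_subset.1 hev
    refine ⟨ζ₀, hζ₀, fun ζ h0 h1 => ?_⟩
    obtain ⟨hg, hN⟩ := hev ⟨h0, h1⟩
    have h := isEval_evalAt (d := d) p τ ζ
    have hs : ∀ v : Vertex n, IsFaceSet (evalAt d (curveParam p τ) fun _ => ζ)
        (vset n {v.1}) {v} := by
      intro v
      have h2 := hN {v} (Finset.singleton_nonempty v)
      rw [colors, Finset.image_singleton] at h2
      refine h2 ?_
      simp only [Finset.card_singleton]
      omega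
    refine ⟨fun i => ⟨h.dim_hulls hg i, h.vertices_hulls hs i, h.ncard_vertices_hulls hs i⟩,
      fun R hR k hRk hk => ?_, h.isMinkowskiNeighborly hs hg hN _, fun k hk hkd => ?_⟩
    · have hpos := hR.card_pos
      rw [← hg.card_mixedSets hN hd hR (show k ≠ 0 by omega) (by omega),
        ← h.numMixedFaces_of_generic hs hg hR (by omega)]
      rfl
    · have hne : (Finset.univ : Finset (Fin r)).Nonempty := ⟨⟨0, hr⟩, Finset.mem_univ _⟩
      rw [← hg.card_mixedSets hN hd hne (show k + r - 1 ≠ 0 by omega)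
        (by rw [Finset.card_univ, Fintype.card_fin]; omega),
        ← h.numFaces_minkowskiSum hg hr hk hkd]
      rfl
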